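/- \textbf{Setting.} Fix finite sets $\mathsf{Prop}$, $\mathsf{Prog}$, $\mathsf{Var}$ of atomic propositions, atomic programs and variables. A program $\alpha$ is $a$ or $a^-$ with $a\in\mathsf{Prog}$. Formulas of the full graded $\mu$-calculus are $$\varphi ::= \mathsf{true}\mid\mathsf{false}\mid p\mid\neg p\mid x\mid \varphi\vee\varphi\mid\varphi\wedge\varphi\mid\langle n,\alpha\rangle\varphi\mid[n,\alpha]\varphi\mid\mu y.\varphi\mid\nu y.\varphi\qquad(n\in\mathbb N),$$ interpreted as usual over Kripke structures $K=\langle W,R,L\rangle$ ($R(a^-)$ is the converse of $R(a)$; $\langle n,\alpha\rangle\varphi$: more than $n$ $\alpha$-successors satisfy $\varphi$; $[n,\alpha]\varphi$: at most $n$ $\alpha$-successors do not satisfy $\varphi$). The length $|\varphi|$ counts one for each symbol plus $\lceil\log_2 n\rceil$ for each grade $n$ (with $\lceil\log_2 0\rceil:=0$). The sentence $\varphi$ counts up to $b$ if the largest grade in $\varphi$ is $b-1$ ($b=1$ if there is no graded modality). A tree is a nonempty set $T\subseteq\mathbb N^+$, closed under nonempty prefixes, with a single root (element of length one); the successors of $x\in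 T$ are the $x\cdot c\in T$ with $c\in\mathbb N$. A tree model of $\varphi$ is a Kripke structure $K=\langle T,R,L\rangle$ on a tree $T$ such that $\bigcup_\alpha R(\alpha)$ is exactly the set of pairs of nodes one of which is a successor of the other, and such that $\varphi$ holds at the root. Let $\Gamma(\varphi)$ consist of $\mathsf{Prop}$ and of new propositions $p_a,p_{a^-}$ for every $a\in\mathsf{Prog}$ such that $a$ or $a^-$ occurs in $\varphi$. The encoding of $K$ is the $2^{\Gamma(\varphi)}$-labeled tree $\langle T,L^*\rangle$ where $p\in L^*(w)$ iff $w\in L(p)$, and $p_\alpha\in L^*(w)$ iff $w$ has a predecessor $v$ in $T$ with $(v,w)\in R(\alpha)$. A 2GAPT $A=\langle\Sigma,b,Q,\delta,q_0,\mathcal F\rangle$ (two-way graded alternating parity tree automaton) with counting bound $b>0$ has a transition function $\delta$ from $Q\times\Sigma$ to positive Boolean formulas over $\{-1,\varepsilon,\langle 0\rangle,\dots,\langle b\rangle,[0],\dots,[b]\}\times Q$. The moves $(-1,q)$, $(\varepsilon,q)$, $(\langle n\rangle,q)$, $([n],q)$ send state $q$ to the (necessarily existing) predecessor, to the current node, to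 $n+1$ distinct successors, and to all successors but at most $n$, respectively. It has a parity condition $\mathcal F_1\subseteq\dots\subseteq\mathcal F_k=Q$ of index $k$. A labeled tree is accepted if there is a run tree starting at the root in state $q_0$ such that, on each of its infinite paths, the least $i$ for which $\mathcal F_i$ contains a state occurring infinitely often is even. \textbf{Theorem.} There are an absolute constant $C$ and a random access machine program (unit cost, with successor and predecessor as the only arithmetic operations) such that the following holds for all finite $\mathsf{Prop}$, $\mathsf{Prog}$, $\mathsf{Var}$ and every sentence $\varphi$ of the full graded $\mu$-calculus that counts up to $b$. On input $\varphi$ (with grades in binary) and the sizes of these three sets, the program outputs within $C\,|\varphi|$ steps a description of a 2GAPT $A_\varphi$ over the alphabet $2^{\Gamma(\varphi)}$ such that $A_\varphi$ (1) accepts exactly those $2^{\Gamma(\varphi)}$-labeled trees that are encodings of tree models of $\varphi$, and (2) has at most $C\,|\varphi|$ states, index at most $C\,|\varphi|$, and counting bound $b$. Here an automaton is described by listing $b$ (in binary), the number of states, the index and the initial state, and for each state $q$ its rank (the least $i$ with $q\in\mathcal F_i$) and one positive Boolean formula, built from moves and from tests $g\in\sigma$, $g\notin\sigma$ with $g\in\Gamma(\varphi)$,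 which yields $\delta(q,\sigma)$ when the tests are replaced by their truth values. -/

import Mathlib

open Set Filter

namespace FullGraded

/-! ### Full graded mu-calculus (no nominals) -/

/-- Programs: atomic programs `a` and inverse programs `a⁻`. -/
inductive Prg (A : Type) : Type
  | fwd (a : A)
  | bwd (a : A)

/-- The atomic program underlying a program. -/
def Prg.base {A : Type} : Prg A → A
  | .fwd a => a
  | .bwd a => a

/-- Formulas in positive normal form over atomic propositions `P`, atomic programs `A` and
propositional variables `X`. `dia n α φ` is the atleast formula `⟨n, α⟩φ` and `box n α φ` is the
allbut formula `[n, α]φ`. -/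
inductive Formula (P A X : Type) : Type
  | tt
  | ff
  | prop (p : P)
  | nprop (p : P)
  | var (x : X)
  | or (φ ψ : Formula P A X)
  | and (φ ψ : Formula P A X)
  | dia (n : ℕ) (α : Prg A) (φ : Formula P A X)
  | box (n : ℕ) (α : Prg A) (φ : Formula P A X)
  | mu (y : X) (φ : Formula P A X)
  | nu (y : X) (φ : Formula P A X)

namespace Formula

variable {P A X : Type}

/-- Free propositional variables. -/
def free : Formula P A X → Set X
  | tt | ff | prop _ | nprop _ => ∅
  | var x => {x}
  | or φ ψ | and φ ψ => φ.free ∪ ψ.free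
  | dia _ _ φ | box _ _ φ => φ.free
  | mu y φ | nu y φ => φ.free \ {y}

/-- A sentence has no free variables. -/
def IsSentence (φ : Formula P A X) : Prop := φ.free = ∅

/-- Length, with the grades coded in binary. -/
def length : Formula P A X → ℕ
  | tt | ff | prop _ | nprop _ | var _ => 1
  | or φ ψ | and φ ψ => 1 + φ.length + ψ.length
  | dia n _ φ | box n _ φ => Nat.clog 2 n + 1 + φ.length
  | mu _ φ | nu _ φ => 1 + φ.length

/-- The largest integer in a graded modality (`0` if there is no graded modality). -/
def maxGrade : Formula P A X → ℕ
  | tt | ff | prop _ | nprop _ | var _ => 0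
  | or φ ψ | and φ ψ => max φ.maxGrade ψ.maxGrade
  | dia n _ φ | box n _ φ => max n φ.maxGrade
  | mu _ φ | nu _ φ => φ.maxGrade

/-- `φ` counts up to `b`: the largest integer in its graded modalities is `b - 1`. -/
def CountsUpTo (φ : Formula P A X) (b : ℕ) : Prop := φ.maxGrade + 1 = b

/-- The atomic programs that occur in a formula, themselves or through their inverse. -/
def progs : Formula P A X → Set A
  | tt | ff | prop _ | nprop _ | var _ => ∅
  | or φ ψ | and φ ψ => φ.progs ∪ ψ.progs
  | dia _ α φ | box _ α φ => insert α.base φ.progs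
  | mu _ φ | nu _ φ => φ.progs

end Formula

/-- A Kripke structure with set of states `W`. -/
structure Kripke (P A W : Type) where
  nonempty : Nonempty W
  R : A → W → W → Prop
  L : P → Set W

namespace Kripke

variable {P A X W : Type}

/-- The accessibility relation of a program. -/
def rel (K : Kripke P A W) : Prg A → W → W → Prop
  | .fwd a => fun v w => K.R a v w
  | .bwd a => fun v w => K.R a w v

open Classical in
/-- The set of states that satisfy a formula under a valuation. -/
noncomputable def sem (K : Kripke P A W) : Formula P A X → (X → Set W) → Set W
  | .tt, _ => univ
  | .ff, _ => ∅
  | .prop p, _ => K.L p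
  | .nprop p, _ => (K.L p)ᶜ
  | .var x, val => val x
  | .or φ ψ, val => K.sem φ val ∪ K.sem ψ val
  | .and φ ψ, val => K.sem φ val ∩ K.sem ψ val
  | .dia n α φ, val => {w | (n : ℕ∞) < {w' | K.rel α w w' ∧ w' ∈ K.sem φ val}.encard}
  | .box n α φ, val => {w | {w' | K.rel α w w' ∧ w' ∉ K.sem φ val}.encard ≤ (n : ℕ∞)}
  | .mu y φ, val => ⋂₀ {U | K.sem φ (Function.update val y U) ⊆ U}
  | .nu y φ, val => ⋃₀ {U | U ⊆ K.sem φ (Function.update val y U)}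

/-- `K, w ⊨ φ`, for a sentence `φ` (the valuation is then irrelevant). -/
def Holds (K : Kripke P A W) (w : W) (φ : Formula P A X) : Prop :=
  w ∈ K.sem φ (fun _ => ∅)

end Kripke

/-! ### Trees, tree models and their encodings -/

/-- A (nonempty) tree: a set of nonempty words over `ℕ` that is closed under nonempty initial
segments and whose words all start with the same letter. -/
structure NTree where
  nodes : Set (List ℕ)
  root : ℕ
  root_mem : [root] ∈ nodes
  head_eq : ∀ x ∈ nodes, ∃ y, x = root :: y
  closed : ∀ x c, x ≠ [] → x ++ [c] ∈ nodes → x ∈ nodes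

namespace NTree

/-- The root as a node. -/
def rootNode (T : NTree) : T.nodes := ⟨[T.root], T.root_mem⟩

/-- `y` is a successor of `x` (and `x` is the predecessor of `y`). -/
def Succ (T : NTree) (x y : T.nodes) : Prop := ∃ c : ℕ, y.1 = x.1 ++ [c]

end NTree

variable {P A X : Type}

/-- A tree structure: a Kripke structure on the nodes of a tree where the edges of all programs
together are exactly the pairs of neighbours. -/
def IsTreeStructure {T : NTree} (K : Kripke P A T.nodes) : Prop :=
  ∀ v w : T.nodes, (∃ α : Prg A, K.rel α v w) ↔ (T.Succ v w ∨ T.Succ w v)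

/-- A tree model of a sentence: a tree structure in which the sentence holds at the root. -/
def IsTreeModel {T : NTree} (K : Kripke P A T.nodes) (φ : Formula P A X) : Prop :=
  IsTreeStructure K ∧ K.Holds T.rootNode φ

/-- Atomic propositions together with a proposition `p_α` (written `edge α`) for each program. -/
inductive Letter (P A : Type) : Type
  | prop (p : P)
  | edge (α : Prg A)

/-- The set `Γ(φ)`: all atomic propositions, and `p_a`, `p_{a⁻}` for the programs occurring
in `φ`. -/
def Gam (φ : Formula P A X) : Set (Letter P A) :=
  {g | match g with
    | .prop _ => True
    | .edge α => α.base ∈ φ.progs}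

/-- The encoding of a tree structure as a `2^Γ(φ)`-labeled tree: `p_α` is put at `w` if the edge
from the predecessor of `w` to `w` is an `α`-edge. -/
def encoding (φ : Formula P A X) {T : NTree} (K : Kripke P A T.nodes) : T.nodes → Set (Gam φ) :=
  fun w => {g | match g.1 with
    | .prop p => w ∈ K.L p
    | .edge α => ∃ v, T.Succ v w ∧ K.rel α v w}

/-! ### Two-way graded alternating parity tree automata -/

/-- Positive Boolean formulas over `Y`. -/
inductive PosBool (Y : Type) : Type
  | tt
  | ff
  | atom (y : Y)
  | and (θ η : PosBool Y)
  | or (θ η : PosBool Y)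

/-- The set `S` satisfies the positive Boolean formula. -/
def PosBool.Sat {Y : Type} (S : Set Y) : PosBool Y → Prop
  | .tt => True
  | .ff => False
  | .atom y => y ∈ S
  | .and θ η => θ.Sat S ∧ η.Sat S
  | .or θ η => θ.Sat S ∨ η.Sat S

/-- The directions `-1`, `ε`, `⟨n⟩`, `[n]` with `0 ≤ n ≤ b`. -/
inductive Dir (b : ℕ) : Type
  | up
  | stay
  | dia (n : Fin (b + 1))
  | box (n : Fin (b + 1))

/-- A two-way graded alternating parity tree automaton with input alphabet `S`, with parity
condition `F 1 ⊆ F 2 ⊆ ⋯ ⊆ F index = Q` (the values of `F` outside `1, …, index` are irrelevant). -/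
structure TwoGAPT (S : Type) where
  bound : ℕ
  bound_pos : 0 < bound
  Q : Type
  fintypeQ : Fintype Q
  δ : Q → S → PosBool (Dir bound × Q)
  q₀ : Q
  index : ℕ
  index_pos : 1 ≤ index
  F : ℕ → Set Q
  F_mono : ∀ i j, 1 ≤ i → i ≤ j → j ≤ index → F i ⊆ F j
  F_last : F index = univ

namespace TwoGAPT

variable {S : Type}

/-- The number of states. -/
def numStates (M : TwoGAPT S) : ℕ := @Fintype.card M.Q M.fintypeQ

/-- The requirement that an atom `(d, s)`, used at the node `x`, puts on a set `C` of pairs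
(the labels of the children of the current node of the run). For `[n]`, the state `s` has to be
sent to all successors but at most `n`. -/
def AtomOK {T : NTree} {Q : Type} {b : ℕ} (C : Set (T.nodes × Q)) (x : T.nodes) :
    Dir b × Q → Prop
  | (.up, s) => ∃ z, T.Succ z x ∧ (z, s) ∈ C
  | (.stay, s) => (x, s) ∈ C
  | (.dia n, s) => ∃ M : Finset T.nodes, M.card = n.1 + 1 ∧ ∀ z ∈ M, T.Succ x z ∧ (z, s) ∈ C
  | (.box n, s) => ∃ M : Finset T.nodes, M.card ≤ n.1 ∧ (∀ z ∈ M, T.Succ x z) ∧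
      ∀ z, T.Succ x z → z ∉ M → (z, s) ∈ C

/-- `(Tr, r)` is a run on the labeled tree `(T, V)`. -/
def IsRun (M : TwoGAPT S) (T : NTree) (V : T.nodes → S) (Tr : NTree)
    (r : Tr.nodes → T.nodes × M.Q) : Prop :=
  r Tr.rootNode = (T.rootNode, M.q₀) ∧
  ∀ y : Tr.nodes, ∃ U : Set (Dir M.bound × M.Q),
    (M.δ (r y).2 (V (r y).1)).Sat U ∧
    ∀ d ∈ U, AtomOK {c | ∃ y', Tr.Succ y y' ∧ r y' = c} (r y).1 d

/-- A set of states satisfies the parity condition: the least `i` such that `F i` meets it is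
even. -/
def Parity (M : TwoGAPT S) (I : Set M.Q) : Prop :=
  ∃ i, 1 ≤ i ∧ i ≤ M.index ∧ Even i ∧ (I ∩ M.F i).Nonempty ∧
    ∀ j, 1 ≤ j → j < i → I ∩ M.F j = ∅

/-- The run is accepting: on every infinite path, the set of states seen infinitely often satisfies
the parity condition. -/
def IsAccepting (M : TwoGAPT S) {T : NTree} (Tr : NTree) (r : Tr.nodes → T.nodes × M.Q) : Prop :=
  ∀ π : ℕ → Tr.nodes, π 0 = Tr.rootNode → (∀ i, Tr.Succ (π i) (π (i + 1))) →
    M.Parity {q | ∃ᶠ i in atTop, (r (π i)).2 = q}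

/-- The automaton accepts the labeled tree. -/
def Accepts (M : TwoGAPT S) (T : NTree) (V : T.nodes → S) : Prop :=
  ∃ (Tr : NTree) (r : Tr.nodes → T.nodes × M.Q), M.IsRun T V Tr r ∧ M.IsAccepting Tr r

end TwoGAPT

/-! ### Explicit descriptions of automata over the alphabet `2^G`

The alphabet is exponential in `G`, so a transition function is presented symbolically: for each
state one positive Boolean formula whose atoms are moves `(d, q)` and tests `g ∈ σ`, `g ∉ σ` of the
letter `σ` that is read. The parity condition is presented by giving, for each state, the number of
the first set to which it belongs. -/

/-- Atoms of symbolic transitions. -/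
inductive SymAtom (G : Type) (b N : ℕ) : Type
  | pos (g : G)
  | neg (g : G)
  | move (d : Dir b) (q : Fin N)

open Classical in
/-- The transition for the letter `σ`: tests are replaced by their truth values. -/
noncomputable def instantiate {G : Type} {b N : ℕ} (σ : Set G) :
    PosBool (SymAtom G b N) → PosBool (Dir b × Fin N)
  | .tt => .tt
  | .ff => .ff
  | .atom (.pos g) => if g ∈ σ then .tt else .ff
  | .atom (.neg g) => if g ∈ σ then .ff else .tt
  | .atom (.move d q) => .atom (d, q)
  | .and θ η => .and (instantiate σ θ) (instantiate σ η)
  | .or θ η => .or (instantiate σ θ) (instantiate σ η)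

/-- A symbolic description of an automaton with states `0, …, numStates - 1`. -/
structure SymAut (G : Type) where
  bound : ℕ
  bound_pos : 0 < bound
  numStates : ℕ
  index : ℕ
  init : Fin numStates
  trans : Fin numStates → PosBool (SymAtom G bound numStates)
  rank : Fin numStates → ℕ
  rank_pos : ∀ q, 1 ≤ rank q
  rank_le : ∀ q, rank q ≤ index

/-- The automaton that is described. -/
noncomputable def SymAut.toTwoGAPT {G : Type} (D : SymAut G) : TwoGAPT (Set G) where
  bound := D.bound
  bound_pos := D.bound_pos
  Q := Fin D.numStates
  fintypeQ := inferInstance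
  δ := fun q σ => instantiate σ (D.trans q)
  q₀ := D.init
  index := D.index
  index_pos := (D.rank_pos D.init).trans (D.rank_le D.init)
  F := fun i => {q | D.rank q ≤ i}
  F_mono := fun _ _ _ hij _ _ hq => le_trans hq hij
  F_last := Set.eq_univ_of_forall D.rank_le

/-! ### Codes: formulas and descriptions as words of natural numbers -/

/-- Binary code of a number: the bits, least significant first, then the end marker `2`. -/
def codeNat (n : ℕ) : List ℕ := (Nat.bits n).map Bool.toNat ++ [2]

/-- Code of a program. -/
def codePrg {r : ℕ} : Prg (Fin r) → List ℕ
  | .fwd a => [0, a.1]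
  | .bwd a => [1, a.1]

/-- Code of a formula in Polish notation. -/
def codeFormula {m r v : ℕ} : Formula (Fin m) (Fin r) (Fin v) → List ℕ
  | .tt => [0]
  | .ff => [1]
  | .prop p => [2, p.1]
  | .nprop p => [3, p.1]
  | .var x => [4, x.1]
  | .or φ ψ => 5 :: (codeFormula φ ++ codeFormula ψ)
  | .and φ ψ => 6 :: (codeFormula φ ++ codeFormula ψ)
  | .dia n α φ => 7 :: (codePrg α ++ codeNat n ++ codeFormula φ)
  | .box n α φ => 8 :: (codePrg α ++ codeNat n ++ codeFormula φ)
  | .mu y φ => 9 :: y.1 :: codeFormula φ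
  | .nu y φ => 10 :: y.1 :: codeFormula φ

/-- The input for a formula: the sizes of the sets of atomic propositions, atomic programs and
variables, followed by the formula. -/
def inputCode {m r v : ℕ} (φ : Formula (Fin m) (Fin r) (Fin v)) : List ℕ :=
  m :: r :: v :: codeFormula φ

/-- Code of an element of `Γ(φ)`. -/
def codeLetter {m r : ℕ} : Letter (Fin m) (Fin r) → List ℕ
  | .prop p => [0, p.1]
  | .edge (.fwd a) => [1, a.1]
  | .edge (.bwd a) => [2, a.1]

/-- Code of a direction. -/
def codeDir {b : ℕ} : Dir b → List ℕ
  | .up => [0]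
  | .stay => [1]
  | .dia n => 2 :: codeNat n.1
  | .box n => 3 :: codeNat n.1

/-- Code of a symbolic transition in Polish notation. -/
def codeTrans {m r : ℕ} {G : Set (Letter (Fin m) (Fin r))} {b N : ℕ} :
    PosBool (SymAtom G b N) → List ℕ
  | .tt => [0]
  | .ff => [1]
  | .atom (.pos g) => 2 :: codeLetter g.1
  | .atom (.neg g) => 3 :: codeLetter g.1
  | .atom (.move d q) => 4 :: (codeDir d ++ [q.1])
  | .and θ η => 5 :: (codeTrans θ ++ codeTrans η)
  | .or θ η => 6 :: (codeTrans θ ++ codeTrans η)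

/-- Code of a description: the counting bound in binary, the number of states, the index, the
initial state, and for each state in turn its rank and its transition. -/
def SymAut.code {m r : ℕ} {G : Set (Letter (Fin m) (Fin r))} (D : SymAut G) : List ℕ :=
  codeNat D.bound ++ [D.numStates, D.index, D.init.1] ++
    (List.ofFn fun q => D.rank q :: codeTrans (D.trans q)).flatten

/-! ### A random access machine with unit cost

The store consists of arrays `0, 1, 2, …` of natural numbers; a program mentions finitely many of
them. The only arithmetic is adding and subtracting `1`, so that the numbers stay of logarithmic
length and unit cost is justified. Programs consist of recursive procedures without parameters. -/

namespace RAM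

/-- `s a i` is the content of cell `i` of array `a`. -/
abbrev Store := ℕ → ℕ → ℕ

/-- Expressions. -/
inductive Expr : Type
  | lit (n : ℕ)
  | get (a : ℕ) (i : Expr)
  | succ (e : Expr)
  | pred (e : Expr)

/-- Value of an expression. -/
def Expr.eval (s : Store) : Expr → ℕ
  | .lit n => n
  | .get a i => s a (i.eval s)
  | .succ e => e.eval s + 1
  | .pred e => e.eval s - 1

/-- One step for each operation. -/
def Expr.cost : Expr → ℕ
  | .lit _ => 1
  | .get _ i => 1 + i.cost
  | .succ e => 1 + e.cost
  | .pred e => 1 + e.cost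

/-- Tests. -/
inductive Test : Type
  | eq (e f : Expr)
  | ne (e f : Expr)
  | lt (e f : Expr)

/-- The test succeeds. -/
def Test.Holds (s : Store) : Test → Prop
  | .eq e f => e.eval s = f.eval s
  | .ne e f => e.eval s ≠ f.eval s
  | .lt e f => e.eval s < f.eval s

/-- Number of steps of a test. -/
def Test.cost : Test → ℕ
  | .eq e f | .ne e f | .lt e f => 1 + e.cost + f.cost

/-- Commands; `set a i e` writes the value of `e` into cell `i` of array `a`. -/
inductive Cmd : Type
  | skip
  | set (a : ℕ) (i e : Expr)
  | seq (c d : Cmd)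
  | ite (b : Test) (c d : Cmd)
  | loop (b : Test) (c : Cmd)
  | call (j : ℕ)

/-- A program is a list of procedures; execution starts with procedure `0`. -/
abbrev Program := List Cmd

/-- `Exec p c s s' t`: in the program `p`, the command `c` started on the store `s` terminates
after exactly `t` steps with the store `s'`. -/
inductive Exec (p : Program) : Cmd → Store → Store → ℕ → Prop
  | skip (s : Store) : Exec p .skip s s 1
  | set (a : ℕ) (i e : Expr) (s : Store) :
      Exec p (.set a i e) s
        (Function.update s a (Function.update (s a) (i.eval s) (e.eval s))) (1 + i.cost + e.cost)
  | seq {c d : Cmd} {s s' s'' : Store} {t t' : ℕ} :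
      Exec p c s s' t → Exec p d s' s'' t' → Exec p (.seq c d) s s'' (1 + t + t')
  | ite_true {b : Test} {c d : Cmd} {s s' : Store} {t : ℕ} :
      b.Holds s → Exec p c s s' t → Exec p (.ite b c d) s s' (1 + b.cost + t)
  | ite_false {b : Test} {c d : Cmd} {s s' : Store} {t : ℕ} :
      ¬ b.Holds s → Exec p d s s' t → Exec p (.ite b c d) s s' (1 + b.cost + t)
  | loop_true {b : Test} {c : Cmd} {s s' s'' : Store} {t t' : ℕ} :
      b.Holds s → Exec p c s s' t → Exec p (.loop b c) s' s'' t' →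
        Exec p (.loop b c) s s'' (1 + b.cost + t + t')
  | loop_false {b : Test} {c : Cmd} {s : Store} :
      ¬ b.Holds s → Exec p (.loop b c) s s (1 + b.cost)
  | call {j : ℕ} {c : Cmd} {s s' : Store} {t : ℕ} :
      p[j]? = some c → Exec p c s s' t → Exec p (.call j) s s' (1 + t)

/-- The initial store: the input word in array `0`, and `0` everywhere else. -/
def initStore (input : List ℕ) : Store :=
  fun a i => if a = 0 then input.getD i 0 else 0

/-- On the given input, the program terminates within `t` steps, with the given output word at the
beginning of array `1`. -/
def ComputesIn (p : Program) (input output : List ℕ) (t : ℕ) : Prop :=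
  ∃ s' t', t' ≤ t ∧ Exec p (.call 0) (initStore input) s' t' ∧
    ∀ i (h : i < output.length), s' 1 i = output[i]

end RAM

end FullGraded

/-! Model checking on a tree is a parity game on pairs of a node and a state, and the automaton is
this game written as a table. Each node of the syntax tree of the sentence owns two consecutive
states `q` and `q + 1` with `q` even. State `q` claims the formula. For a modality, state `q + 1`
tests whether the edge from the predecessor carries the program and whether the subformula holds.
The neighbours of a tree node are its successors and at most one predecessor, so a graded modality
is a Boolean combination of a label test, a move up, and downward moves with the grades `n` and `n -
1`. A variable jumps back to the state of its binder. States are numbered in preorder and ranks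
follow them (`q + 1` for `μ`, `q + 2` for `ν`), so the outermost fixed point that is unfolded
infinitely often decides the parity condition.

Both directions of correctness are inductions on the formula, and neither needs determinacy of
parity games. In `wins_of_sem`, truth yields positional strategies, assembled with the closure
properties of `Wins` (sequential composition, arbitrary unions, loops through a state of even rank);
a `μ` is handled as the least prefixed point and a `ν` through its postfixed points. In
`mem_sem_of_run`, an arbitrary fair run yields truth: a failing `μ` would produce a path on which
its odd rank is the least recurring one. Two extra states `0` and `1` check that a labeling is an
encoding: no edge letter at the root, and some edge letter at every other node unless a program
absent from the sentence can supply the edge (`decode_spec`).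

The table is written in linear time by two recursive passes over the input. `scan_spec` counts
states, collects the programs and computes the largest grade, charging each comparison to the digits
of the grade just read. `emit_spec` writes the rows; the one forward reference, the state of a
second subformula, is patched into the output afterwards. `translator_spec` combines the passes. -/

namespace FullGraded

/-! ### The transition table of a formula and the calculus of winning sets. -/

/-! ### Untyped transition tables -/

/-- Directions without a counting bound. -/
inductive RDir : Type
  | up
  | stay
  | dia (n : ℕ)
  | box (n : ℕ)

/-- Atoms of symbolic transitions whose states are arbitrary numbers. -/
inductive RAtom (P A : Type) : Type
  | pos (g : Letter P A)
  | neg (g : Letter P A)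
  | move (d : RDir) (q : ℕ)

/-- A row of a table: the rank of a state and its transition. -/
abbrev Row (P A : Type) := ℕ × PosBool (RAtom P A)

/-- The word `L` is written in `f` from `o` on. -/
def Seg {β : Type} (f : ℕ → β) : ℕ → List β → Prop
  | _, [] => True
  | o, a :: L => f o = a ∧ Seg f (o + 1) L

theorem Seg_append {β : Type} {f : ℕ → β} (L M : List β) (o : ℕ) :
    Seg f o (L ++ M) ↔ Seg f o L ∧ Seg f (o + L.length) M := by
  induction L generalizing o with
  | nil => simp [Seg]
  | cons a L ih =>
    simp only [List.cons_append, Seg, ih, List.length_cons, and_assoc]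
    rw [show o + 1 + L.length = o + (L.length + 1) by omega]

theorem Seg_iff {β : Type} {f : ℕ → β} (L : List β) (o : ℕ) :
    Seg f o L ↔ ∀ i (h : i < L.length), f (o + i) = L[i] := by
  induction L generalizing o with
  | nil => simp [Seg]
  | cons a L ih =>
    simp only [Seg, ih, List.length_cons]
    constructor
    · rintro ⟨h0, h⟩ i hi
      cases i with
      | zero => simpa using h0
      | succ i =>
        have := h i (by omega)
        rw [show o + 1 + i = o + (i + 1) by omega] at this
        simpa using this
    · intro h
      refine ⟨by simpa using h 0 (by omega), fun i hi => ?_⟩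
      have := h (i + 1) (by omega)
      rw [show o + 1 + i = o + (i + 1) by omega]
      simpa using this

theorem Seg.congr {β : Type} {f g : ℕ → β} {L : List β} {o : ℕ} (h : Seg f o L)
    (hfg : ∀ j, o ≤ j → j < o + L.length → g j = f j) : Seg g o L := by
  rw [Seg_iff] at h ⊢
  intro i hi
  rw [hfg _ (by omega) (by omega), h i hi]

/-- The inverse program. -/
def Prg.inv {A : Type} : Prg A → Prg A
  | .fwd a => .bwd a
  | .bwd a => .fwd a

theorem Prg.inv_base {A : Type} (α : Prg A) : α.inv.base = α.base := by cases α <;> rfl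

variable {P A X : Type}

/-- The number of states used for a formula: two for each of its nodes. -/
def Formula.st : Formula P A X → ℕ
  | .tt | .ff | .prop _ | .nprop _ | .var _ => 2
  | .or φ ψ | .and φ ψ => 2 + φ.st + ψ.st
  | .dia _ _ φ | .box _ _ φ => 2 + φ.st
  | .mu _ φ | .nu _ φ => 2 + φ.st

/-- A move as a transition. -/
def mv (d : RDir) (q : ℕ) : PosBool (RAtom P A) := .atom (.move d q)

/-- The transition for `⟨n, α⟩φ` at the state `q`, where the state `q + 1` checks that its node is an
`α`-successor at which the state `q + 2` succeeds. -/
def diaTrans (n : ℕ) (α : Prg A) (q : ℕ) : PosBool (RAtom P A) :=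
  .or (.and (.and (.atom (.pos (.edge α.inv))) (mv .up (q + 2)))
    -- A predecessor that counts replaces one successor: more than `n - 1` further ones suffice, and
    -- none at all are needed if `n = 0`.
    (match n with
      | 0 => .tt
      | k + 1 => mv (.dia k) (q + 1))) (mv (.dia n) (q + 1))

/-- The transition for `[n, α]φ`, dual to `diaTrans`. -/
def boxTrans (n : ℕ) (α : Prg A) (q : ℕ) : PosBool (RAtom P A) :=
  .and (.or (.or (.atom (.neg (.edge α.inv))) (mv .up (q + 2)))
    -- A predecessor that violates the subformula uses up one of the `n` allowed exceptions; if `n =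
    -- 0` there is none to use.
    (match n with
      | 0 => .ff
      | k + 1 => mv (.box k) (q + 1))) (mv (.box n) (q + 1))

/-- The rows for a formula whose first state is `q`; the state of a variable is given by `env`. -/
def table [DecidableEq X] (env : X → ℕ) (q : ℕ) : Formula P A X → List (Row P A)
  -- Only the second row of a modality is ever the target of a move. The other second rows are
  -- padding that keeps the first state of every subformula even.
  | .tt => [(q + 1, .tt), (q + 2, .tt)]
  | .ff => [(q + 1, .ff), (q + 2, .tt)]
  | .prop p => [(q + 1, .atom (.pos (.prop p))), (q + 2, .tt)]
  | .nprop p => [(q + 1, .atom (.neg (.prop p))), (q + 2, .tt)]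
  | .var x => [(q + 1, mv .stay (env x)), (q + 2, .tt)]
  | .or φ ψ => (q + 1, .or (mv .stay (q + 2)) (mv .stay (q + 2 + φ.st))) :: (q + 2, .tt) ::
      (table env (q + 2) φ ++ table env (q + 2 + φ.st) ψ)
  | .and φ ψ => (q + 1, .and (mv .stay (q + 2)) (mv .stay (q + 2 + φ.st))) :: (q + 2, .tt) ::
      (table env (q + 2) φ ++ table env (q + 2 + φ.st) ψ)
  | .dia n α φ => (q + 1, diaTrans n α q) ::
      (q + 2, .and (.atom (.pos (.edge α))) (mv .stay (q + 2))) :: table env (q + 2) φ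
  | .box n α φ => (q + 1, boxTrans n α q) ::
      (q + 2, .or (.atom (.neg (.edge α))) (mv .stay (q + 2))) :: table env (q + 2) φ
  | .mu y φ => (q + 1, mv .stay (q + 2)) :: (q + 2, .tt) ::
      table (Function.update env y q) (q + 2) φ
  -- As `q` is even, this is the only kind of node whose first state has an even rank. All states of
  -- the subformula still have larger ranks.
  | .nu y φ => (q + 2, mv .stay (q + 2)) :: (q + 2, .tt) ::
      table (Function.update env y q) (q + 2) φ

theorem table_length [DecidableEq X] (env : X → ℕ) (q : ℕ) (ψ : Formula P A X) :
    (table env q ψ).length = ψ.st := by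
  induction ψ generalizing env q <;> simp [table, Formula.st, *] <;> omega

theorem Formula.two_le_st (ψ : Formula P A X) : 2 ≤ ψ.st := by
  cases ψ <;> simp only [Formula.st] <;> omega

theorem Formula.even_st (ψ : Formula P A X) : Even ψ.st := by
  induction ψ <;> simp only [Formula.st] <;> grind

theorem Formula.st_le (ψ : Formula P A X) : ψ.st ≤ 2 * ψ.length := by
  induction ψ <;> simp only [Formula.st, Formula.length] <;> omega

/-- The ranks grow with the states. -/
theorem lt_rank_of_table [DecidableEq X] {rows : ℕ → Row P A} (ψ : Formula P A X) (env : X → ℕ)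
    (q : ℕ) (h : Seg rows q (table env q ψ)) (p : ℕ) (h1 : q ≤ p)
    (h2 : p < q + ψ.st) : q < (rows p).1 := by
  have key : ∀ (ψ : Formula P A X) (env : X → ℕ) (q : ℕ), ∀ i (h : i < (table env q ψ).length),
      q < (table env q ψ)[i].1 := by
    intro ψ
    induction ψ with
    | or φ ψ ih1 ih2 | and φ ψ ih1 ih2 =>
      intro env q i hi
      rcases i with _ | _ | i
      · simp [table]
      · simp [table]
      · simp only [table, List.getElem_cons_succ, List.getElem_append]
        split
        · exact lt_trans (by omega) (ih1 _ _ _ _)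
        · exact lt_trans (by omega) (ih2 _ _ _ _)
    | dia n α φ ih | box n α φ ih | mu y φ ih | nu y φ ih =>
      intro env q i hi
      rcases i with _ | _ | i
      · simp [table]
      · simp [table]
      · simp only [table, List.getElem_cons_succ]
        exact lt_trans (by omega) (ih _ _ _ _)
    | _ =>
      intro env q i hi
      rcases i with _ | _ | i
      · simp [table]
      · simp [table]
      · simp [table] at hi
  obtain ⟨i, rfl⟩ := Nat.exists_eq_add_of_le h1
  have hi : i < (table env q ψ).length := by rw [table_length]; omega
  rw [(Seg_iff _ _).1 h i hi]
  exact key _ _ _ _ _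

/-! ### The game on configurations -/

/-- The requirement that a move puts on a set of configurations. -/
def ROK {T : NTree} (C : Set (T.nodes × ℕ)) (x : T.nodes) : RDir → ℕ → Prop
  | .up, s => ∃ z, T.Succ z x ∧ (z, s) ∈ C
  | .stay, s => (x, s) ∈ C
  | .dia n, s => ∃ M : Finset T.nodes, M.card = n + 1 ∧ ∀ z ∈ M, T.Succ x z ∧ (z, s) ∈ C
  | .box n, s => ∃ M : Finset T.nodes, M.card ≤ n ∧ (∀ z ∈ M, T.Succ x z) ∧
      ∀ z, T.Succ x z → z ∉ M → (z, s) ∈ C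

/-- A set of configurations satisfies a transition at a node with letter `σ`. -/
def RSat {T : NTree} (σ : Set (Letter P A)) (C : Set (T.nodes × ℕ)) (x : T.nodes) :
    PosBool (RAtom P A) → Prop
  | .tt => True
  | .ff => False
  | .atom (.pos g) => g ∈ σ
  | .atom (.neg g) => g ∉ σ
  | .atom (.move d q) => ROK C x d q
  | .and θ η => RSat σ C x θ ∧ RSat σ C x η
  | .or θ η => RSat σ C x θ ∨ RSat σ C x η

theorem ROK.mono {T : NTree} {C D : Set (T.nodes × ℕ)} (h : C ⊆ D) {x : T.nodes} {d : RDir}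
    {q : ℕ} (hC : ROK C x d q) : ROK D x d q := by
  cases d with
  | up => obtain ⟨z, h1, h2⟩ := hC; exact ⟨z, h1, h h2⟩
  | stay => exact h hC
  | dia n => obtain ⟨M, h1, h2⟩ := hC; exact ⟨M, h1, fun z hz => ⟨(h2 z hz).1, h (h2 z hz).2⟩⟩
  | box n =>
    obtain ⟨M, h1, h2, h3⟩ := hC
    exact ⟨M, h1, h2, fun z hz hM => h (h3 z hz hM)⟩

theorem RSat.mono {T : NTree} {σ : Set (Letter P A)} {C D : Set (T.nodes × ℕ)} (h : C ⊆ D)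
    {x : T.nodes} {θ : PosBool (RAtom P A)} (hC : RSat σ C x θ) : RSat σ D x θ := by
  induction θ with
  | tt => trivial
  | ff => exact hC
  | atom y =>
    cases y with
    | pos g => exact hC
    | neg g => exact hC
    | move d q => exact ROK.mono h hC
  | and θ η ih1 ih2 => exact ⟨ih1 hC.1, ih2 hC.2⟩
  | or θ η ih1 ih2 => exact hC.imp ih1 ih2

/-- The least rank that occurs infinitely often is even. -/
def RPar (rk : ℕ → ℕ) (f : ℕ → ℕ) : Prop :=
  ∃ p, Even (rk p) ∧ (∃ᶠ i in atTop, f i = p) ∧ ∀ p', (∃ᶠ i in atTop, f i = p') → rk p ≤ rk p'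

theorem frequently_shift {p : ℕ → Prop} (k : ℕ) :
    (∃ᶠ i in atTop, p (i + k)) ↔ ∃ᶠ i in atTop, p i := by
  conv_rhs => rw [← map_add_atTop_eq_nat k, frequently_map]

theorem RPar_shift {rk f : ℕ → ℕ} (k : ℕ) : RPar rk (fun i => f (i + k)) ↔ RPar rk f := by
  unfold RPar
  simp only [fun p => frequently_shift (p := fun i => f i = p) k]

section Game

variable {T : NTree} (rows : ℕ → Row P A) (lab : T.nodes → Set (Letter P A))

/-- On the configurations in `D`, the positional strategy `E` respects the transitions and moves
to `D` or to exits in `X`; the infinite plays in `D` satisfy the parity condition. -/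
def Good (X D : Set (T.nodes × ℕ)) (E : T.nodes × ℕ → Set (T.nodes × ℕ)) : Prop :=
  Disjoint X D ∧ (∀ c ∈ D, E c ⊆ D ∪ X) ∧
  (∀ c ∈ D, RSat (lab c.1) (E c) c.1 (rows c.2).2) ∧
  ∀ π : ℕ → T.nodes × ℕ, (∀ i, π i ∈ D) → (∀ i, π (i + 1) ∈ E (π i)) →
    RPar (fun p => (rows p).1) (fun i => (π i).2)

/-- There is a good strategy on `D` with exits `X`. -/
def Wins (X D : Set (T.nodes × ℕ)) : Prop := ∃ E, Good rows lab X D E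

variable {rows lab}

theorem Wins.mono {X Y D : Set (T.nodes × ℕ)} (h : Wins rows lab X D) (hXY : X ⊆ Y)
    (hd : Disjoint Y D) : Wins rows lab Y D := by
  obtain ⟨E, -, h1, h2, h3⟩ := h
  exact ⟨E, hd, fun c hc => (h1 c hc).trans (union_subset_union_right _ hXY), h2, h3⟩

/-- Configurations that are won elsewhere can be treated as exits. This makes domains disjoint, as
`Wins.seq` requires. -/
theorem Wins.diff {X D : Set (T.nodes × ℕ)} (h : Wins rows lab X D) (Y : Set (T.nodes × ℕ)) :
    Wins rows lab (X ∪ Y) (D \ Y) := by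
  obtain ⟨E, h0, h1, h2, h3⟩ := h
  refine ⟨E, ?_, fun c hc d hd => ?_, fun c hc => h2 c hc.1, fun π hπ hs => h3 π (fun i => (hπ i).1) hs⟩
  · rw [Set.disjoint_left] at h0 ⊢
    rintro c (hc | hc) ⟨h, h'⟩
    · exact h0 hc h
    · exact h' hc
  · rcases h1 c hc.1 hd with h | h
    · by_cases hY : d ∈ Y
      · exact Or.inr (Or.inr hY)
      · exact Or.inl ⟨h, hY⟩
    · exact Or.inr (Or.inl h)

/-- Every move leaves `H` at once, so there are no infinite plays inside `H` to be checked. -/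
theorem Wins.step {X H : Set (T.nodes × ℕ)} (hd : Disjoint X H)
    (h : ∀ c ∈ H, RSat (lab c.1) X c.1 (rows c.2).2) : Wins rows lab X H := by
  refine ⟨fun _ => X, hd, fun _ _ => subset_union_right, h, fun π hπ hs => ?_⟩
  exact absurd (hπ 1) (Set.disjoint_left.1 hd (hs 0))

/-- The strategy of `D₁` takes precedence and never returns to `D₂`. A play that meets `D₁`
therefore has a tail in `D₁`, and any other play lies entirely in `D₂`. -/
theorem Wins.seq {X D₁ D₂ : Set (T.nodes × ℕ)} (h₁ : Wins rows lab X D₁)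
    (h₂ : Wins rows lab (X ∪ D₁) D₂) : Wins rows lab X (D₁ ∪ D₂) := by
  classical
  obtain ⟨E₁, a0, a1, a2, a3⟩ := h₁
  obtain ⟨E₂, b0, b1, b2, b3⟩ := h₂
  have hX : Disjoint X (D₁ ∪ D₂) :=
    Set.disjoint_union_right.2 ⟨a0, (Set.disjoint_union_left.1 b0).1⟩
  refine ⟨fun c => if c ∈ D₁ then E₁ c else E₂ c, hX, ?_, ?_, ?_⟩
  · intro c hc
    by_cases h : c ∈ D₁
    · simp only [h, if_true]
      exact (a1 c h).trans (by intro d; simp only [mem_union]; tauto)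
    · simp only [h, if_false]
      exact (b1 c (hc.resolve_left h)).trans (by intro d; simp only [mem_union]; tauto)
  · intro c hc
    by_cases h : c ∈ D₁
    · simp only [h, if_true]; exact a2 c h
    · simp only [h, if_false]; exact b2 c (hc.resolve_left h)
  · intro π hπ hs
    by_cases h : ∃ k, π k ∈ D₁
    · obtain ⟨k, hk⟩ := h
      have hall : ∀ i, π (i + k) ∈ D₁ := by
        intro i
        induction i with
        | zero => simpa using hk
        | succ i ih =>
          have := hs (i + k)
          simp only [ih, if_true] at this
          rw [show i + 1 + k = i + k + 1 by omega]
          rcases a1 _ ih this with h | h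
          · exact h
          · exact absurd (hπ _) (Set.disjoint_left.1 hX h)
      refine (RPar_shift k).1 (a3 (fun i => π (i + k)) hall fun i => ?_)
      have := hs (i + k)
      simp only [hall i, if_true] at this
      rw [show i + 1 + k = i + k + 1 by omega]
      exact this
    · push Not at h
      refine b3 π (fun i => (hπ i).resolve_left (h i)) fun i => ?_
      have := hs i
      simpa only [h i, if_false] using this

/-- The indices are well-ordered, and each configuration uses the strategy of the least index whose
domain contains it. Along a play this index never increases, so it is eventually constant and a tail
of the play follows a single strategy. -/
theorem Wins.iUnion {ι : Type} {X : Set (T.nodes × ℕ)} {D : ι → Set (T.nodes × ℕ)}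
    (h : ∀ i, Wins rows lab X (D i)) : Wins rows lab X (⋃ i, D i) := by
  classical
  rcases isEmpty_or_nonempty ι with hι | hι
  · refine ⟨fun _ => ∅, by simp, by simp, by simp, fun π hπ => ?_⟩
    simp at hπ
  choose E hE using h
  obtain ⟨_, hwf⟩ := exists_wellFoundedLT ι
  have hmin : ∀ c ∈ ⋃ i, D i, ∃ i, c ∈ D i ∧ ∀ j, c ∈ D j → i ≤ j := by
    intro c hc
    have hne : {i | c ∈ D i}.Nonempty := mem_iUnion.1 hc
    exact ⟨hwf.wf.min _ hne, hwf.wf.min_mem _ hne, fun j hj => hwf.wf.min_le hj⟩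
  choose! idx hidx hle using hmin
  have hX : Disjoint X (⋃ i, D i) := Set.disjoint_iUnion_right.2 fun i => (hE i).1
  refine ⟨fun c => E (idx c) c, hX, ?_, fun c hc => (hE _).2.2.1 c (hidx c hc), ?_⟩
  · intro c hc
    exact ((hE (idx c)).2.1 c (hidx c hc)).trans
      (union_subset_union_left _ (subset_iUnion D (idx c)))
  · intro π hπ hs
    have hstep : ∀ i, π (i + 1) ∈ D (idx (π i)) := by
      intro i
      rcases (hE _).2.1 _ (hidx _ (hπ i)) (hs i) with h | h
      · exact h
      · exact absurd (hπ _) (Set.disjoint_left.1 hX h)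
    have hanti : Antitone fun i => idx (π i) :=
      antitone_nat_of_succ_le fun i => hle _ (hπ _) _ (hstep i)
    have hne : (range fun i => idx (π i)).Nonempty := range_nonempty _
    obtain ⟨k, hk⟩ := hwf.wf.min_mem _ hne
    have hconst : ∀ i, idx (π (i + k)) = idx (π k) := fun i =>
      le_antisymm (hanti (by omega)) (by
        have := hwf.wf.min_le (s := range fun i => idx (π i)) (mem_range_self (i + k))
        exact le_of_eq_of_le hk this)
    refine (RPar_shift k).1 ((hE (idx (π k))).2.2.2 (fun i => π (i + k)) (fun i => ?_) fun i => ?_)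
    · rw [← hconst i]; exact hidx _ (hπ _)
    · have := hs (i + k)
      simp only [hconst i] at this
      rw [show i + 1 + k = i + k + 1 by omega]
      exact this

theorem Wins.union {X D₁ D₂ : Set (T.nodes × ℕ)} (h₁ : Wins rows lab X D₁)
    (h₂ : Wins rows lab X D₂) : Wins rows lab X (D₁ ∪ D₂) := by
  rw [union_eq_iUnion]
  exact Wins.iUnion fun b => by cases b <;> assumption

/-- Closing a loop through a state of even rank. -/
theorem Wins.loop {X D B : Set (T.nodes × ℕ)} {q : ℕ} (h : Wins rows lab (X ∪ B) D)
    (hX : Disjoint X B) (hB : ∀ c ∈ B, c.2 = q ∧ RSat (lab c.1) (D ∪ B ∪ X) c.1 (rows c.2).2)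
    (hq : Even (rows q).1) (hD : ∀ c ∈ D, (rows q).1 ≤ (rows c.2).1) :
    Wins rows lab X (D ∪ B) := by
  classical
  obtain ⟨E, h0, h1, h2, h3⟩ := h
  have hX' : Disjoint X (D ∪ B) :=
    Set.disjoint_union_right.2 ⟨(Set.disjoint_union_left.1 h0).1, hX⟩
  have hDB : ∀ c ∈ D, c ∉ B := fun c hc hcB =>
    Set.disjoint_left.1 h0 (Or.inr hcB) hc
  refine ⟨fun c => if c ∈ B then D ∪ B ∪ X else E c, hX', ?_, ?_, ?_⟩
  · intro c hc
    by_cases hcB : c ∈ B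
    · simp [hcB]
    · simp only [hcB, if_false]
      exact (h1 c (hc.resolve_right hcB)).trans (by intro d; simp only [mem_union]; tauto)
  · intro c hc
    by_cases hcB : c ∈ B
    · simp only [hcB, if_true]; exact (hB c hcB).2
    · simp only [hcB, if_false]; exact h2 c (hc.resolve_right hcB)
  · intro π hπ hs
    -- If `B` recurs, the even rank of `q` recurs and is a lower bound for all ranks met. Otherwise
    -- a tail of the play stays in `D` and follows `E`.
    by_cases hf : ∃ᶠ i in atTop, π i ∈ B
    · refine ⟨q, hq, hf.mono fun i hi => (hB _ hi).1, fun p' hp' => ?_⟩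
      obtain ⟨i, hi⟩ := hp'.exists
      rcases hπ i with h | h
      · rw [← hi]; exact hD _ h
      · simp only [← hi, (hB _ h).1, le_refl]
    · rw [not_frequently, eventually_atTop] at hf
      obtain ⟨k, hk⟩ := hf
      refine (RPar_shift k).1 (h3 (fun i => π (i + k)) (fun i => (hπ _).resolve_right (hk _ (by omega)))
        fun i => ?_)
      have := hs (i + k)
      simp only [hk (i + k) (by omega), if_false] at this
      rw [show i + 1 + k = i + k + 1 by omega]
      exact this

end Game

end FullGraded

/-! ### From truth in a tree structure to positional strategies. -/

namespace FullGraded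

variable {P A X : Type}

/-! ### Graded modalities on labeled trees -/

theorem NTree.Succ.eq {T : NTree} {y z x : T.nodes} (h : T.Succ y x) (h' : T.Succ z x) : y = z := by
  obtain ⟨c, hc⟩ := h
  obtain ⟨d, hd⟩ := h'
  rw [hc] at hd
  exact Subtype.ext (List.append_inj_left' hd rfl)

theorem NTree.Succ.asymm {T : NTree} {x y : T.nodes} (h : T.Succ x y) : ¬ T.Succ y x := by
  rintro ⟨d, hd⟩
  obtain ⟨c, hc⟩ := h
  have := congrArg List.length hd
  rw [hc] at this
  simp at this

/-- The labels `lab` describe the structure `K`, as far as the programs in `G` are concerned. -/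
structure Compat {T : NTree} (K : Kripke P A T.nodes) (lab : T.nodes → Set (Letter P A))
    (G : Set A) : Prop where
  prop : ∀ p x, x ∈ K.L p ↔ Letter.prop p ∈ lab x
  rel : ∀ α : Prg A, α.base ∈ G → ∀ x y, K.rel α x y ↔
    (T.Succ x y ∧ Letter.edge α ∈ lab y) ∨ (T.Succ y x ∧ Letter.edge α.inv ∈ lab x)
  pred : ∀ (α : Prg A) (x), α.base ∈ G → Letter.edge α ∈ lab x → ∃ z, T.Succ z x

theorem ROK_dia_iff {T : NTree} {C : Set (T.nodes × ℕ)} {x : T.nodes} {n s : ℕ} :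
    ROK C x (.dia n) s ↔ (n : ℕ∞) < {z | T.Succ x z ∧ (z, s) ∈ C}.encard := by
  constructor
  · rintro ⟨M, h1, h2⟩
    have : (M : Set T.nodes).encard ≤ {z | T.Succ x z ∧ (z, s) ∈ C}.encard :=
      encard_le_encard fun z hz => h2 z hz
    rw [encard_coe_eq_coe_finsetCard, h1] at this
    exact lt_of_lt_of_le (by exact_mod_cast Nat.lt_succ_self n) this
  · intro h
    have h' : ((n + 1 : ℕ) : ℕ∞) ≤ {z | T.Succ x z ∧ (z, s) ∈ C}.encard := by
      push_cast
      exact Order.add_one_le_of_lt h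
    obtain ⟨t, ht, hc⟩ := exists_subset_encard_eq h'
    have hfin : t.Finite := finite_of_encard_eq_coe hc
    refine ⟨hfin.toFinset, ?_, fun z hz => ht (hfin.mem_toFinset.1 hz)⟩
    rw [hfin.encard_eq_coe_toFinset_card] at hc
    exact_mod_cast hc

theorem ROK_box_iff {T : NTree} {C : Set (T.nodes × ℕ)} {x : T.nodes} {n s : ℕ} :
    ROK C x (.box n) s ↔ {z | T.Succ x z ∧ (z, s) ∉ C}.encard ≤ (n : ℕ∞) := by
  constructor
  · rintro ⟨M, h1, h2, h3⟩
    have : {z | T.Succ x z ∧ (z, s) ∉ C}.encard ≤ (M : Set T.nodes).encard :=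
      encard_le_encard fun z hz => by
        by_contra hM
        exact hz.2 (h3 z hz.1 hM)
    rw [encard_coe_eq_coe_finsetCard] at this
    exact this.trans (by exact_mod_cast h1)
  · intro h
    have hfin : {z | T.Succ x z ∧ (z, s) ∉ C}.Finite := finite_of_encard_le_coe h
    refine ⟨hfin.toFinset, ?_, fun z hz => ((hfin.mem_toFinset).1 hz).1, fun z hz hM => ?_⟩
    · rw [hfin.encard_eq_coe_toFinset_card] at h
      exact_mod_cast h
    · by_contra hC
      exact hM (hfin.mem_toFinset.2 ⟨hz, hC⟩)

section Modal

variable {T : NTree} {K : Kripke P A T.nodes} {lab : T.nodes → Set (Letter P A)} {G : Set A}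

/-- The `α`-neighbours of `x` in `S` are its `α`-successors in `S` together with at most one more
element, the predecessor. If the predecessor counts, it raises the cardinality by exactly one. -/
theorem Compat.lt_encard_iff (hK : Compat K lab G) {α : Prg A} (hα : α.base ∈ G) (n : ℕ)
    (S : Set T.nodes) (x : T.nodes) :
    (n : ℕ∞) < {y | K.rel α x y ∧ y ∈ S}.encard ↔
      ((Letter.edge α.inv ∈ lab x ∧ ∃ z, T.Succ z x ∧ z ∈ S) ∧
        ∀ k, n = k + 1 → (k : ℕ∞) < {y | T.Succ x y ∧ Letter.edge α ∈ lab y ∧ y ∈ S}.encard) ∨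
      (n : ℕ∞) < {y | T.Succ x y ∧ Letter.edge α ∈ lab y ∧ y ∈ S}.encard := by
  set B := {y | T.Succ x y ∧ Letter.edge α ∈ lab y ∧ y ∈ S} with hB
  by_cases hp : Letter.edge α.inv ∈ lab x ∧ ∃ z, T.Succ z x ∧ z ∈ S
  · obtain ⟨h1, z, hz, hzS⟩ := hp
    have hset : {y | K.rel α x y ∧ y ∈ S} = insert z B := by
      ext y
      simp only [mem_ofPred_eq, hK.rel α hα, mem_insert_iff, hB]
      constructor
      · rintro ⟨h | h, hS⟩
        · exact Or.inr ⟨h.1, h.2, hS⟩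
        · exact Or.inl (h.1.eq hz)
      · rintro (rfl | h)
        · exact ⟨Or.inr ⟨hz, h1⟩, hzS⟩
        · exact ⟨Or.inl ⟨h.1, h.2.1⟩, h.2.2⟩
    have hzB : z ∉ B := fun h => hz.asymm h.1
    rw [hset, encard_insert_of_notMem hzB]
    have hT : (Letter.edge α.inv ∈ lab x ∧ ∃ z, T.Succ z x ∧ z ∈ S) := ⟨h1, z, hz, hzS⟩
    simp only [hT, true_and]
    rcases n with _ | n
    · simp
    · have : (((n + 1 : ℕ) : ℕ∞) < B.encard + 1) ↔ (n : ℕ∞) < B.encard := by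
        push_cast
        exact ENat.add_lt_add_iff_right (by simp)
      rw [this]
      constructor
      · intro h
        refine Or.inl fun k hk => ?_
        obtain rfl : n = k := by omega
        exact h
      · rintro (h | h)
        · exact h n rfl
        · exact lt_trans (by exact_mod_cast Nat.lt_succ_self n) h
  · have hset : {y | K.rel α x y ∧ y ∈ S} = B := by
      ext y
      simp only [mem_ofPred_eq, hK.rel α hα, hB]
      constructor
      · rintro ⟨h | h, hS⟩
        · exact ⟨h.1, h.2, hS⟩
        · exact absurd ⟨h.2, y, h.1, hS⟩ hp
      · rintro h
        exact ⟨Or.inl ⟨h.1, h.2.1⟩, h.2.2⟩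
    rw [hset]
    simp only [hp, false_and, false_or]

theorem Compat.sat_dia (hK : Compat K lab G) {α : Prg A} (hα : α.base ∈ G) {n q : ℕ}
    {S : Set T.nodes} {C : Set (T.nodes × ℕ)}
    (h1 : ∀ z, (z, q + 1) ∈ C ↔ Letter.edge α ∈ lab z ∧ z ∈ S)
    (h2 : ∀ z, (z, q + 2) ∈ C ↔ z ∈ S) (x : T.nodes) :
    RSat (lab x) C x (diaTrans n α q) ↔ (n : ℕ∞) < {y | K.rel α x y ∧ y ∈ S}.encard := by
  rw [hK.lt_encard_iff hα]
  simp only [← h1]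
  rcases n with _ | n
  · simp only [diaTrans, RSat, mv, ROK_dia_iff]
    simp [ROK, h2]
  · simp only [diaTrans, RSat, mv, ROK_dia_iff]
    simp [ROK, h2]

/-- This is `Compat.lt_encard_iff` for the complement of `S`, negated. -/
theorem Compat.sat_box (hK : Compat K lab G) {α : Prg A} (hα : α.base ∈ G) {n q : ℕ}
    {S : Set T.nodes} {C : Set (T.nodes × ℕ)}
    (h1 : ∀ z, (z, q + 1) ∈ C ↔ Letter.edge α ∉ lab z ∨ z ∈ S)
    (h2 : ∀ z, (z, q + 2) ∈ C ↔ z ∈ S) (x : T.nodes) :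
    RSat (lab x) C x (boxTrans n α q) ↔ {y | K.rel α x y ∧ y ∉ S}.encard ≤ (n : ℕ∞) := by
  -- An upward move fails where there is no predecessor, so it is not its own dual. It becomes so
  -- once the edge letter at `x` guarantees a predecessor, which is then unique.
  have hup : (Letter.edge α.inv ∉ lab x ∨ ∃ z, T.Succ z x ∧ z ∈ S) ↔
      ¬ (Letter.edge α.inv ∈ lab x ∧ ∃ z, T.Succ z x ∧ z ∈ Sᶜ) := by
    by_cases he : Letter.edge α.inv ∈ lab x
    · obtain ⟨z, hz⟩ := hK.pred α.inv x (by rwa [Prg.inv_base]) he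
      have hu : ∀ S : Set T.nodes, (∃ z, T.Succ z x ∧ z ∈ S) ↔ z ∈ S := fun S =>
        ⟨fun ⟨y, hy, hS⟩ => by rwa [hz.eq hy], fun h => ⟨z, hz, h⟩⟩
      have hu' := hu Sᶜ
      simp only [mem_compl_iff] at hu'
      simp only [he, not_true, false_or, true_and, hu S, mem_compl_iff, hu', not_not]
    · simp [he]
  have hset : {z | T.Succ x z ∧ (z, q + 1) ∉ C} =
      {y | T.Succ x y ∧ Letter.edge α ∈ lab y ∧ y ∈ Sᶜ} := by
    ext z; simp [h1]
  have := hK.lt_encard_iff hα n Sᶜ x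
  rw [← not_iff_not, not_le]
  simp only [mem_compl_iff] at this
  rw [this]
  simp only [mem_compl_iff] at hset hup
  rcases n with _ | n
  · simp only [boxTrans, RSat, mv, ROK_box_iff]
    simp only [ROK, h2, hset, hup, or_false]
    rw [← not_le]
    have e : ∀ k : ℕ, 0 = k + 1 →
        (k : ℕ∞) < {y | T.Succ x y ∧ Letter.edge α ∈ lab y ∧ y ∉ S}.encard := by omega
    rw [and_iff_left e, not_and_or, not_not]
  · simp only [boxTrans, RSat, mv, ROK_box_iff]
    simp only [ROK, h2, hset, hup]
    have e : (∀ k, n + 1 = k + 1 →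
        (k : ℕ∞) < {y | T.Succ x y ∧ Letter.edge α ∈ lab y ∧ y ∉ S}.encard) ↔
        ¬ {y | T.Succ x y ∧ Letter.edge α ∈ lab y ∧ y ∉ S}.encard ≤ (n : ℕ∞) :=
      ⟨fun h => not_le.2 (h n rfl), fun h k hk => by
        obtain rfl : n = k := by omega
        exact not_le.1 h⟩
    rw [e, ← not_le]
    generalize ({y | T.Succ x y ∧ Letter.edge α ∈ lab y ∧ y ∉ S}.encard ≤ (n : ℕ∞)) = p
    generalize ({y | T.Succ x y ∧ Letter.edge α ∈ lab y ∧ y ∉ S}.encard ≤ ((n + 1 : ℕ) : ℕ∞)) = p'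
    generalize (Letter.edge α.inv ∈ lab x ∧ ∃ z, T.Succ z x ∧ z ∉ S) = p''
    clear e hup hset this h1 h2
    tauto

end Modal

/-! ### From truth to strategies -/

section Strategy

variable {T : NTree} {K : Kripke P A T.nodes} {rows : ℕ → Row P A}
  {lab : T.nodes → Set (Letter P A)} {G : Set A}

/-- Adding the two states of a formula node to a strategy. -/
theorem Wins.node {Y D : Set (T.nodes × ℕ)} {q e : ℕ} (hD : Wins rows lab Y D)
    (hr : ∀ c ∈ D, q + 2 ≤ c.2 ∧ c.2 < e) (hY : ∀ c ∈ Y, c.2 < q) (he : q + 2 ≤ e)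
    (F M : Set T.nodes)
    (hF : ∀ x ∈ F, RSat (lab x) D x (rows (q + 1)).2)
    (hM : ∀ x ∈ M, RSat (lab x) ({c | c.2 = q + 1 ∧ c.1 ∈ F} ∪ (D ∪ Y)) x (rows q).2) :
    ∃ D', Wins rows lab Y D' ∧ (∀ c ∈ D', q ≤ c.2 ∧ c.2 < e) ∧ ∀ x ∈ M, (x, q) ∈ D' := by
  have d1 : Disjoint (Y ∪ D) {c : T.nodes × ℕ | c.2 = q + 1 ∧ c.1 ∈ F} := by
    rw [Set.disjoint_left]
    rintro c (h | h) ⟨h', -⟩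
    · have := hY c h; omega
    · have := hr c h; omega
  -- The auxiliary state only needs the subformula, so it is added before the main state, which may
  -- use both.
  have w1 : Wins rows lab Y (D ∪ {c | c.2 = q + 1 ∧ c.1 ∈ F}) :=
    hD.seq (Wins.step d1 fun c hc => by
      rw [hc.1]; exact (hF _ hc.2).mono subset_union_right)
  have d2 : Disjoint (Y ∪ (D ∪ {c : T.nodes × ℕ | c.2 = q + 1 ∧ c.1 ∈ F}))
      {c : T.nodes × ℕ | c.2 = q ∧ c.1 ∈ M} := by
    rw [Set.disjoint_left]
    rintro c (h | h | h) ⟨h', -⟩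
    · have := hY c h; omega
    · have := hr c h; omega
    · have := h.1; omega
  refine ⟨_, w1.seq (Wins.step d2 fun c hc => by
    rw [hc.1]; exact (hM _ hc.2).mono (by intro d; simp only [mem_union]; tauto)), ?_, ?_⟩
  · rintro c ((h | h) | h)
    · have := hr c h; omega
    · have := h.1; omega
    · have := h.1; omega
  · intro x hx
    exact Or.inr ⟨rfl, hx⟩

theorem Wins.empty {Y : Set (T.nodes × ℕ)} : Wins rows lab Y ∅ :=
  Wins.step (by simp) (by simp)

/-- The exits for the free variables of a formula. -/
def exits (env : X → ℕ) (val : X → Set T.nodes) (ψ : Formula P A X) : Set (T.nodes × ℕ) :=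
  {c | ∃ x ∈ ψ.free, c.2 = env x ∧ c.1 ∈ val x}

/-- The domain stays within the block of states of `ψ` and exits only through the states of free
variables, at nodes where the valuation makes them true. This modular form lets a binder decide
afterwards what happens at its own variable: for `μ` the exits lead into sets already won, for `ν`
they are closed into a loop. -/
theorem wins_of_sem [hX : DecidableEq X] (hK : Compat K lab G) (ψ : Formula P A X) (env : X → ℕ)
    (val : X → Set T.nodes) (q : ℕ) (hq : Even q) (hG : ψ.progs ⊆ G)
    (henv : ∀ x ∈ ψ.free, env x < q) (hrows : Seg rows q (table env q ψ)) :
    ∃ D, Wins rows lab (exits env val ψ) D ∧ (∀ c ∈ D, q ≤ c.2 ∧ c.2 < q + ψ.st) ∧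
      ∀ w ∈ K.sem ψ val, (w, q) ∈ D := by
  classical
  -- The semantics updates valuations with classical decidable equality, so the given instance is
  -- replaced by that one.
  obtain rfl : hX = fun a b => Classical.propDecidable (a = b) := Subsingleton.elim _ _
  have hexits : ∀ {ψ : Formula P A X} {env : X → ℕ} {val : X → Set T.nodes} {q : ℕ},
      (∀ x ∈ ψ.free, env x < q) → ∀ c ∈ exits env val ψ, c.2 < q := by
    rintro ψ env val q h c ⟨x, hx, h1, -⟩
    rw [h1]; exact h x hx
  have hmono : ∀ {ψ ψ' : Formula P A X} {env : X → ℕ} {val : X → Set T.nodes} {q e : ℕ}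
      {D : Set (T.nodes × ℕ)}, ψ.free ⊆ ψ'.free → (∀ x ∈ ψ'.free, env x < q) →
      (∀ c ∈ D, q + 2 ≤ c.2 ∧ c.2 < e) →
      Wins rows lab (exits env val ψ) D → Wins rows lab (exits env val ψ') D := by
    intro ψ ψ' env val q e D hf he hD h
    refine h.mono (fun c ⟨x, hx, h1⟩ => ⟨x, hf hx, h1⟩) ?_
    rw [Set.disjoint_left]
    intro c hc hcD
    have := hexits he c hc
    have := hD c hcD
    omega
  induction ψ generalizing env val q with
  | tt | ff | prop p | nprop p =>
    refine Wins.node (M := K.sem _ val) Wins.empty (by simp) (hexits henv) (by simp [Formula.st]) ∅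
      (by simp) fun x hx => ?_
    rw [hrows.1]
    first | exact hx | trivial | exact (hK.prop _ _).1 hx | exact fun h => hx ((hK.prop _ _).2 h)
  | var x =>
    refine Wins.node (M := K.sem _ val) Wins.empty (by simp) (hexits henv) (by simp [Formula.st]) ∅
      (by simp) fun w hw => ?_
    rw [hrows.1]
    exact Or.inr (Or.inr ⟨x, rfl, rfl, hw⟩)
  | or φ ψ ih1 ih2 | and φ ψ ih1 ih2 =>
    obtain ⟨h1, -, h2⟩ := hrows
    rw [Seg_append, table_length] at h2
    obtain ⟨D1, w1, r1, s1⟩ := ih1 env val (q + 2) (by grind) (subset_union_left.trans hG)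
      (fun x hx => lt_trans (henv x (Or.inl hx)) (by omega)) h2.1
    obtain ⟨D2, w2, r2, s2⟩ := ih2 env val (q + 2 + φ.st) (by have := φ.even_st; grind)
      (subset_union_right.trans hG)
      (fun x hx => lt_trans (henv x (Or.inr hx)) (by omega)) h2.2
    have r1' : ∀ c ∈ D1, q + 2 ≤ c.2 ∧ c.2 < q + 2 + φ.st + ψ.st := fun c hc => by
      have := r1 c hc; omega
    have r2' : ∀ c ∈ D2, q + 2 ≤ c.2 ∧ c.2 < q + 2 + φ.st + ψ.st := fun c hc => by
      have := r2 c hc; omega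
    have w := (hmono (by simp [Formula.free]) henv r1' w1).union
      (hmono (by simp [Formula.free]) henv r2' w2)
    refine Wins.node (M := K.sem _ val) w ?_ (hexits henv) (by simp only [Formula.st]; omega) ∅
      (by simp) fun x hx => ?_
    · rintro c (hc | hc)
      · have := r1' c hc; simp only [Formula.st]; omega
      · have := r2' c hc; simp only [Formula.st]; omega
    · rw [h1]
      have t1 : x ∈ K.sem φ val → (x, q + 2) ∈ D1 := s1 x
      have t2 : x ∈ K.sem ψ val → (x, q + 2 + φ.st) ∈ D2 := s2 x
      simp only [Kripke.sem, mem_union, mem_inter_iff] at hx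
      simp only [RSat, mv, ROK, mem_union]
      tauto
  | dia n α φ ih =>
    obtain ⟨h1, h2, h3⟩ := hrows
    obtain ⟨D, w, r, s⟩ := ih env val (q + 2) (by grind) ((subset_insert _ _).trans hG)
      (fun x hx => lt_trans (henv x hx) (by omega)) h3
    have r' : ∀ c ∈ D, q + 2 ≤ c.2 ∧ c.2 < q + (Formula.dia n α φ).st := fun c hc => by
      have := r c hc; simp only [Formula.st]; omega
    refine Wins.node (M := K.sem _ val) (hmono subset_rfl henv r' w) r' (hexits henv)
      (by simp only [Formula.st]; omega) {z | Letter.edge α ∈ lab z ∧ z ∈ K.sem φ val} ?_ ?_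
    · intro x hx
      rw [h2]
      exact ⟨hx.1, s x hx.2⟩
    · intro x hx
      rw [h1]
      -- This is the smallest set with the two slices that `sat_dia` prescribes. The available moves
      -- contain it, and transitions are monotone.
      refine ((hK.sat_dia (C := {c | (c.2 = q + 1 ∧ Letter.edge α ∈ lab c.1 ∧ c.1 ∈ K.sem φ val) ∨
        (c.2 = q + 2 ∧ c.1 ∈ K.sem φ val)}) (hG (mem_insert _ _)) ?_ ?_ x).2 hx).mono ?_
      · simp
      · simp
      · rintro ⟨z, p⟩ (⟨hc, h⟩ | ⟨hc, h⟩)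
        · exact Or.inl ⟨hc, h⟩
        · simp only at hc
          subst hc
          exact Or.inr (Or.inl (s z h))
  | box n α φ ih =>
    obtain ⟨h1, h2, h3⟩ := hrows
    obtain ⟨D, w, r, s⟩ := ih env val (q + 2) (by grind) ((subset_insert _ _).trans hG)
      (fun x hx => lt_trans (henv x hx) (by omega)) h3
    have r' : ∀ c ∈ D, q + 2 ≤ c.2 ∧ c.2 < q + (Formula.box n α φ).st := fun c hc => by
      have := r c hc; simp only [Formula.st]; omega
    refine Wins.node (M := K.sem _ val) (hmono subset_rfl henv r' w) r' (hexits henv)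
      (by simp only [Formula.st]; omega) {z | Letter.edge α ∉ lab z ∨ z ∈ K.sem φ val} ?_ ?_
    · intro x hx
      rw [h2]
      exact hx.imp id (s x)
    · intro x hx
      rw [h1]
      refine ((hK.sat_box (C := {c | (c.2 = q + 1 ∧ (Letter.edge α ∉ lab c.1 ∨ c.1 ∈ K.sem φ val)) ∨
        (c.2 = q + 2 ∧ c.1 ∈ K.sem φ val)}) (hG (mem_insert _ _)) ?_ ?_ x).2 hx).mono ?_
      · simp
      · simp
      · rintro ⟨z, p⟩ (⟨hc, h⟩ | ⟨hc, h⟩)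
        · exact Or.inl ⟨hc, h⟩
        · simp only at hc
          subst hc
          exact Or.inr (Or.inl (s z h))
  | mu y φ ih =>
    obtain ⟨h1, -, h3⟩ := hrows
    have henv' : ∀ x ∈ φ.free, Function.update env y q x < q + 2 := by
      intro x hx
      by_cases hxy : x = y
      · subst hxy; simp
      · rw [Function.update_of_ne hxy]
        exact lt_trans (henv x ⟨hx, hxy⟩) (by omega)
    set Y := exits env val (Formula.mu y φ) with hYdef
    have hY : ∀ c ∈ Y, c.2 < q := hexits henv
    -- All winning domains inside the block are united. The nodes that the union contains with state
    -- `q` form a prefixed point and therefore include the least fixed point.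
    set I := {D : Set (T.nodes × ℕ) | Wins rows lab Y D ∧
      ∀ c ∈ D, q ≤ c.2 ∧ c.2 < q + (Formula.mu y φ).st}
    have hU : Wins rows lab Y (⋃ D : I, D.1) := Wins.iUnion fun D => D.2.1
    have hr : ∀ c ∈ ⋃ D : I, D.1, q ≤ c.2 ∧ c.2 < q + (Formula.mu y φ).st := by
      intro c hc
      obtain ⟨D, hD⟩ := mem_iUnion.1 hc
      exact D.2.2 c hD
    refine ⟨_, hU, hr, fun w hw => ?_⟩
    refine hw {u | (u, q) ∈ ⋃ D : I, D.1} fun w hw => ?_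
    obtain ⟨D, v, r, s⟩ := ih (Function.update env y q)
      (Function.update val y {u | (u, q) ∈ ⋃ D : I, D.1}) (q + 2) (by grind) hG henv' h3
    have hD : ∀ c ∈ D, q + 2 ≤ c.2 ∧ c.2 < q + (Formula.mu y φ).st := fun c hc => by
      have := r c hc; simp only [Formula.st]; omega
    -- Occurrences of the variable now lead into the union. Subtracting the union from `D` makes the
    -- two parts composable.
    have v' := v.diff (⋃ D : I, D.1)
    have v2 : Wins rows lab (Y ∪ ⋃ D : I, D.1) (D \ ⋃ D : I, D.1) := by
      refine v'.mono ?_ ?_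
      · rintro ⟨u, p⟩ (⟨x, hx, hc1, hc2⟩ | hc)
        · by_cases hxy : x = y
          · subst hxy
            simp only [Function.update_self] at hc1 hc2
            subst hc1
            exact Or.inr hc2
          · simp only [Function.update_of_ne hxy] at hc1 hc2
            exact Or.inl ⟨x, ⟨hx, hxy⟩, hc1, hc2⟩
        · exact Or.inr hc
      · rw [Set.disjoint_left]
        rintro c (hc | hc) hcD
        · have := hY c hc
          have := hD c hcD.1
          omega
        · exact hcD.2 hc
    have v3 := hU.seq v2
    by_cases hwU : (w, q) ∈ ⋃ D : I, D.1
    · exact hwU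
    -- Adding `(w, q)` gives another winning domain of the family, so `(w, q)` was in the union all
    -- along.
    have v4 : Wins rows lab Y _ := v3.seq (D₂ := {(w, q)}) (Wins.step (by
      rw [Set.disjoint_singleton_right]
      rintro (hc | hc | hc)
      · exact absurd (hY _ hc) (lt_irrefl _)
      · exact hwU hc
      · have := (hD _ hc.1).1
        simp at this) (by
      rintro c rfl
      simp only [h1]
      have := s w hw
      by_cases hh : (w, q + 2) ∈ ⋃ D : I, D.1
      · exact Or.inr (Or.inl hh)
      · exact Or.inr (Or.inr ⟨this, hh⟩)))
    refine mem_iUnion.2 ⟨⟨_, v4, ?_⟩, Or.inr rfl⟩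
    rintro c ((hc | hc) | rfl)
    · exact hr c hc
    · have := hD c hc.1
      omega
    · simp [Formula.st]
  | nu y φ ih =>
    have hrank := fun p => lt_rank_of_table (Formula.nu y φ) env q hrows p
    obtain ⟨h1, -, h3⟩ := hrows
    have henv' : ∀ x ∈ φ.free, Function.update env y q x < q + 2 := by
      intro x hx
      by_cases hxy : x = y
      · subst hxy; simp
      · rw [Function.update_of_ne hxy]
        exact lt_trans (henv x ⟨hx, hxy⟩) (by omega)
    set Y := exits env val (Formula.nu y φ) with hYdef
    have hY : ∀ c ∈ Y, c.2 < q := hexits henv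
    -- For a postfixed point `Z`, the exits through the variable at nodes of `Z` are looped back to
    -- state `q`, whose rank `q + 2` is even and below all ranks of the subformula. The domains for
    -- all `Z` are united afterwards.
    have key : ∀ Z : Set T.nodes, Z ⊆ K.sem φ (Function.update val y Z) →
        ∃ D, Wins rows lab Y D ∧ (∀ c ∈ D, q ≤ c.2 ∧ c.2 < q + (Formula.nu y φ).st) ∧
          ∀ w ∈ Z, (w, q) ∈ D := by
      intro Z hpost
      obtain ⟨D, v, r, s⟩ := ih (Function.update env y q) (Function.update val y Z) (q + 2)
        (by grind) hG henv' h3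
      have hD : ∀ c ∈ D, q + 2 ≤ c.2 ∧ c.2 < q + (Formula.nu y φ).st := fun c hc => by
        have := r c hc; simp only [Formula.st]; omega
      have v2 : Wins rows lab (Y ∪ {c | c.2 = q ∧ c.1 ∈ Z}) D := by
        refine v.mono ?_ ?_
        · rintro ⟨u, p⟩ ⟨x, hx, hc1, hc2⟩
          by_cases hxy : x = y
          · subst hxy
            simp only [Function.update_self] at hc1 hc2
            exact Or.inr ⟨hc1, hc2⟩
          · simp only [Function.update_of_ne hxy] at hc1 hc2
            exact Or.inl ⟨x, ⟨hx, hxy⟩, hc1, hc2⟩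
        · rw [Set.disjoint_left]
          rintro c (hc | hc) hcD
          · have := hY c hc
            have := hD c hcD
            omega
          · have := hc.1
            have := hD c hcD
            omega
      refine ⟨_, v2.loop (q := q) ?_ ?_ ?_ ?_, ?_, ?_⟩
      · rw [Set.disjoint_left]
        intro c hc hc'
        have := hY c hc
        have := hc'.1
        omega
      · rintro ⟨u, p⟩ ⟨hc, hu⟩
        simp only at hc hu
        subst hc
        refine ⟨rfl, ?_⟩
        simp only [h1]
        exact Or.inl (Or.inl (s u (hpost hu)))
      · rw [h1]; simp only; grind
      · intro c hc
        rw [h1]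
        have h4 := hD c hc
        have := lt_rank_of_table φ _ _ h3 c.2 h4.1 (by simp only [Formula.st] at h4; omega)
        simp only
        omega
      · rintro c (hc | hc)
        · have := hD c hc; omega
        · have := hc.1
          simp only [Formula.st]
          omega
      · intro w hw
        exact Or.inr ⟨rfl, hw⟩
    choose D hw hr hD using key
    refine ⟨⋃ Z : {Z : Set T.nodes // Z ⊆ K.sem φ (Function.update val y Z)}, D Z.1 Z.2,
      Wins.iUnion fun Z => hw Z.1 Z.2, fun c hc => ?_, fun w ⟨Z, hZ, hwZ⟩ =>
        mem_iUnion.2 ⟨⟨Z, hZ⟩, hD Z hZ w hwZ⟩⟩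
    obtain ⟨Z, hZ⟩ := mem_iUnion.1 hc
    exact hr Z.1 Z.2 c hZ

end Strategy

end FullGraded

/-! ### From fair runs back to truth. -/

namespace FullGraded

variable {P A X : Type}

/-! ### From runs to truth -/

/-- If every element of `B` reaches another one, then some infinite path meets `B` infinitely
often. -/
theorem exists_path_frequently {Y : Type} {R : Y → Y → Prop} {B : Set Y}
    (hB : ∀ b ∈ B, ∃ b' ∈ B, Relation.TransGen R b b') {b : Y} (hb : b ∈ B) :
    ∃ π : ℕ → Y, π 0 = b ∧ (∀ i, R (π i) (π (i + 1))) ∧ ∃ᶠ i in atTop, π i ∈ B := by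
  -- `Near n y` says that `B` can be reached from `y` in exactly `n` steps. The path being built
  -- carries this `n` as a counter.
  let Near : ℕ → Y → Prop := fun n => Nat.rec (motive := fun _ => Y → Prop) (fun y => y ∈ B)
    (fun _ D y => ∃ z, R y z ∧ D z) n
  have hnear : ∀ y, ∀ b' ∈ B, Relation.TransGen R y b' → ∃ n z, R y z ∧ Near n z := by
    intro y b' hb' h
    induction h using Relation.TransGen.head_induction_on with
    | single h => exact ⟨0, b', h, hb'⟩
    | head h _ ih =>
      obtain ⟨n, z, hz⟩ := ih
      exact ⟨n + 1, _, h, z, hz⟩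
  -- The counter decreases until it is `0`. The path is then in `B` and a new target is chosen, so
  -- `B` is met again and again.
  have hnext : ∀ p : {p : Y × ℕ // Near p.2 p.1}, ∃ p' : {p : Y × ℕ // Near p.2 p.1},
      R p.1.1 p'.1.1 ∧ (p.1.1 ∈ B ∨ p'.1.2 < p.1.2) := by
    rintro ⟨⟨y, n⟩, h⟩
    cases n with
    | zero =>
      obtain ⟨b', hb', ht⟩ := hB y h
      obtain ⟨n, z, h1, h2⟩ := hnear _ _ hb' ht
      exact ⟨⟨(z, n), h2⟩, h1, Or.inl h⟩
    | succ n =>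
      obtain ⟨z, h1, h2⟩ := h
      exact ⟨⟨(z, n), h2⟩, h1, Or.inr (Nat.lt_succ_self n)⟩
  choose next hR hd using hnext
  let s : ℕ → {p : Y × ℕ // Near p.2 p.1} := fun i => next^[i] ⟨(b, 0), hb⟩
  have hs : ∀ i, s (i + 1) = next (s i) := fun i => Function.iterate_succ_apply' _ _ _
  refine ⟨fun i => (s i).1.1, rfl, fun i => ?_, ?_⟩
  · simp only [hs i]
    exact hR _
  · rw [frequently_atTop]
    intro a
    have : ∀ n a, (s a).1.2 = n → ∃ i ≥ a, (s i).1.1 ∈ B := by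
      intro n
      induction n using Nat.strong_induction_on with
      | _ n ih =>
        intro a ha
        rcases hd (s a) with h | h
        · exact ⟨a, le_rfl, h⟩
        · rw [← hs] at h
          obtain ⟨i, hi, hB⟩ := ih _ (ha ▸ h) (a + 1) rfl
          exact ⟨i, by omega, hB⟩
    exact this _ a rfl

section Run

variable {T : NTree} {K : Kripke P A T.nodes} {rows : ℕ → Row P A}
  {lab : T.nodes → Set (Letter P A)} {G : Set A} {Y : Type} {step : Y → Y → Prop}
  {ℓ : Y → T.nodes × ℕ}

/-- A step of a run from a node whose state is in the given interval. -/
def StepIn (step : Y → Y → Prop) (ℓ : Y → T.nodes × ℕ) (lo hi : ℕ) (y y' : Y) : Prop :=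
  step y y' ∧ lo ≤ (ℓ y).2 ∧ (ℓ y).2 < hi

/-- From `y`, the run leaves the states of `ψ` through a free variable at a node where this variable
is false. -/
def Escapes (step : Y → Y → Prop) (ℓ : Y → T.nodes × ℕ) (env : X → ℕ) (val : X → Set T.nodes)
    (q : ℕ) (ψ : Formula P A X) (y : Y) : Prop :=
  ∃ y', Relation.TransGen (StepIn step ℓ q (q + ψ.st)) y y' ∧
    ∃ x ∈ ψ.free, (ℓ y').2 = env x ∧ (ℓ y').1 ∉ val x

theorem StepIn.transGen_mono {lo lo' hi hi' : ℕ} (h1 : lo ≤ lo') (h2 : hi' ≤ hi) {y y' : Y}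
    (h : Relation.TransGen (StepIn step ℓ lo' hi') y y') :
    Relation.TransGen (StepIn step ℓ lo hi) y y' :=
  Relation.TransGen.mono (fun _ _ h => ⟨h.1, h1.trans h.2.1, h.2.2.trans_le h2⟩) _ _ h

/-- The absence of escapes replaces an assumption on the valuation: whenever the run uses a free
variable of `ψ`, that variable is true there. The run need not be positional; only its local
condition and the parity of its infinite paths are used. -/
theorem mem_sem_of_run [hX : DecidableEq X] (hK : Compat K lab G)
    (hok : ∀ y, RSat (lab (ℓ y).1) {c | ∃ y', step y y' ∧ ℓ y' = c} (ℓ y).1 (rows (ℓ y).2).2)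
    (hfair : ∀ π : ℕ → Y, (∀ i, step (π i) (π (i + 1))) →
      RPar (fun p => (rows p).1) (fun i => (ℓ (π i)).2))
    (ψ : Formula P A X) (env : X → ℕ) (val : X → Set T.nodes) (q : ℕ) (hq : Even q)
    (hG : ψ.progs ⊆ G) (y : Y) (w : T.nodes) (hy : ℓ y = (w, q))
    (hesc : ¬ Escapes step ℓ env val q ψ y) (hrows : Seg rows q (table env q ψ)) : w ∈ K.sem ψ val := by
  classical
  obtain rfl : hX = fun a b => Classical.propDecidable (a = b) := Subsingleton.elim _ _
  have hok' : ∀ {y w q}, ℓ y = (w, q) →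
      RSat (lab w) {c | ∃ y', step y y' ∧ ℓ y' = c} w (rows q).2 := by
    intro y w q h
    have := hok y
    rwa [h] at this
  have hsub : ∀ {ψ ψ' : Formula P A X} {env : X → ℕ} {val : X → Set T.nodes} {q q' : ℕ} {y z : Y}
      {w : T.nodes} {p : ℕ},
      ℓ y = (w, p) → step y z → q ≤ p → p < q + ψ'.st → q ≤ q' → q' + ψ.st ≤ q + ψ'.st →
      ψ.free ⊆ ψ'.free → Escapes step ℓ env val q' ψ z → Escapes step ℓ env val q ψ' y := by
    rintro ψ ψ' env val q q' y z w p hy hs hp hp' hq1 hq2 hf ⟨y', h1, x, hx, h2⟩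
    refine ⟨y', (StepIn.transGen_mono hq1 hq2 h1).head ⟨hs, ?_, ?_⟩, x, hf hx, h2⟩ <;> rw [hy]
    · exact hp
    · exact hp'
  have hcomp : ∀ {ψ : Formula P A X} {env : X → ℕ} {val : X → Set T.nodes} {q : ℕ} {y z : Y}
      {w : T.nodes} {p : ℕ},
      ℓ y = (w, p) → step y z → q ≤ p → p < q + ψ.st →
      Escapes step ℓ env val q ψ z → Escapes step ℓ env val q ψ y := by
    rintro ψ env val q y z w p hy hs hp hp' ⟨y', h1, h2⟩
    refine ⟨y', h1.head ⟨hs, ?_, ?_⟩, h2⟩ <;> rw [hy]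
    · exact hp
    · exact hp'
  induction ψ generalizing env val q y w with
  | tt | ff | prop p | nprop p =>
    have := hok' hy
    rw [hrows.1] at this
    first
    | exact this
    | trivial
    | exact (hK.prop _ _).2 this
    | exact fun h => this ((hK.prop _ _).1 h)
  | var x =>
    have := hok' hy
    rw [hrows.1] at this
    obtain ⟨y', h1, h2⟩ := this
    by_contra hw
    refine hesc ⟨y', .single ⟨h1, ?_, ?_⟩, x, rfl, ?_, ?_⟩
    · rw [hy]
    · rw [hy]; simp [Formula.st]
    · rw [h2]
    · rw [h2]; exact hw
  | or φ ψ ih1 ih2 | and φ ψ ih1 ih2 =>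
    obtain ⟨h1, -, h2⟩ := hrows
    rw [Seg_append, table_length] at h2
    have := hok' hy
    rw [h1] at this
    have i1 : (∃ y', step y y' ∧ ℓ y' = (w, q + 2)) → w ∈ K.sem φ val := by
      rintro ⟨z, hz, hz'⟩
      exact ih1 env val (q + 2) (by grind) (subset_union_left.trans hG) z w hz'
        (fun h => hesc (hsub hy hz le_rfl (by simp only [Formula.st]; omega) (by omega)
          (by simp only [Formula.st]; omega) subset_union_left h)) h2.1
    have i2 : (∃ y', step y y' ∧ ℓ y' = (w, q + 2 + φ.st)) → w ∈ K.sem ψ val := by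
      rintro ⟨z, hz, hz'⟩
      exact ih2 env val (q + 2 + φ.st) (by have := φ.even_st; grind) (subset_union_right.trans hG)
        z w hz'
        (fun h => hesc (hsub hy hz le_rfl (by simp only [Formula.st]; omega) (by omega)
          (by simp only [Formula.st]; omega) subset_union_right h)) h2.2
    simp only [Kripke.sem, mem_union, mem_inter_iff]
    first | exact this.imp i1 i2
  | dia n α φ ih | box n α φ ih =>
    obtain ⟨h1, h2, h3⟩ := hrows
    have ha := hok' hy
    rw [h1] at ha
    -- The subformula's state is entered directly by a move up, or through the auxiliary state `q +
    -- 1` after a move down.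
    have i1 : ∀ {z z'} {p : ℕ} , step y z' ∨ (∃ y', step y y' ∧ (ℓ y').2 = q + 1 ∧ step y' z') →
        ℓ z' = (z, q + 2) → z ∈ K.sem φ val := by
      intro z z' p hstep hz
      refine ih env val (q + 2) (by grind) ((subset_insert _ _).trans hG) z' z hz (fun h => hesc ?_) h3
      rcases hstep with hs | ⟨y', hs, hq1, hs'⟩
      · exact hsub (q' := q + 2) (ψ := φ) hy hs le_rfl (by simp only [Formula.st]; omega) (by omega)
          (by simp only [Formula.st]; omega) subset_rfl h
      · exact hcomp hy hs le_rfl (by simp only [Formula.st]; omega)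
          (hsub (q' := q + 2) (ψ := φ) (w := (ℓ y').1) (p := q + 1) (by rw [← hq1]) hs' (by omega)
            (by simp only [Formula.st]; omega) (by omega)
            (by simp only [Formula.st]; omega) subset_rfl h)
    have i2 : ∀ {z}, (∃ y', step y y' ∧ ℓ y' = (z, q + 2)) → z ∈ K.sem φ val :=
      fun ⟨y', hs, hz⟩ => i1 (p := 0) (Or.inl hs) hz
    first
    -- Here the largest set with the two prescribed slices is taken, so that it contains the labels
    -- of all children of `y`.
    | refine (hK.sat_dia (C := {c | (c.2 = q + 1 → Letter.edge α ∈ lab c.1 ∧ c.1 ∈ K.sem φ val) ∧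
        (c.2 = q + 2 → c.1 ∈ K.sem φ val)}) (hG (mem_insert _ _)) (by simp) (by simp) w).1 (ha.mono ?_)
    | refine (hK.sat_box (C := {c | (c.2 = q + 1 → Letter.edge α ∉ lab c.1 ∨ c.1 ∈ K.sem φ val) ∧
        (c.2 = q + 2 → c.1 ∈ K.sem φ val)}) (hG (mem_insert _ _)) (by simp) (by simp) w).1 (ha.mono ?_)
    all_goals
      rintro ⟨z, p⟩ ⟨y', hs, hz⟩
      refine ⟨fun hp => ?_, fun hp => ?_⟩
      · simp only at hp
        subst hp
        have hb := hok' hz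
        rw [h2] at hb
        have i3 : (z, q + 2) ∈ {c | ∃ z', step y' z' ∧ ℓ z' = c} → z ∈ K.sem φ val :=
          fun ⟨z', hs', hz'⟩ => i1 (p := 0) (Or.inr ⟨y', hs, by rw [hz], hs'⟩) hz'
        first
        | exact ⟨hb.1, i3 hb.2⟩
        | exact hb.imp id i3
      · simp only at hp
        subst hp
        exact i2 ⟨y', hs, hz⟩
  | mu x φ ih =>
    have hrank := lt_rank_of_table (Formula.mu x φ) env q hrows
    obtain ⟨h1, -, h3⟩ := hrows
    intro U hU
    by_contra hw
    set R := StepIn step ℓ q (q + (Formula.mu x φ).st) with hR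
    -- These are the reachable unfoldings of the fixed point at nodes outside the prefixed point
    -- `U`.
    set B : Set Y := {b | (ℓ b).2 = q ∧ (ℓ b).1 ∉ U ∧ Relation.ReflTransGen R y b}
    have hB : ∀ b ∈ B, ∃ b' ∈ B, Relation.TransGen R b b' := by
      rintro b ⟨hb1, hb2, hb3⟩
      have hb : ℓ b = ((ℓ b).1, q) := by rw [← hb1]
      have := hok' hb
      rw [h1] at this
      obtain ⟨z, hs, hz⟩ := this
      have hRz : R b z := ⟨hs, by rw [hb1], by rw [hb1]; simp [Formula.st]⟩
      -- If no further element of `B` were reachable, the run from `z` would not escape when the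
      -- variable means `U`. Induction and `hU` would then put the node of `b` into `U`.
      by_contra hno
      refine hb2 (hU (ih (Function.update env x q) (Function.update val x U) (q + 2) (by grind) hG z _
        hz ?_ h3))
      rintro ⟨y', ht, x', hx', he, hv⟩
      have ht' : Relation.TransGen R b y' :=
        (StepIn.transGen_mono (by omega) (by simp only [Formula.st]; omega) ht).head hRz
      by_cases hxx : x' = x
      · subst hxx
        simp only [Function.update_self] at he hv
        exact hno ⟨y', ⟨he, hv, hb3.trans ht'.to_reflTransGen⟩, ht'⟩
      · simp only [Function.update_of_ne hxx] at he hv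
        exact hesc ⟨y', ht'.trans_right hb3, x', ⟨hx', hxx⟩, he, hv⟩
    obtain ⟨π, -, hπ, hf⟩ := exists_path_frequently hB
      (show y ∈ B from ⟨by rw [hy], by rw [hy]; exact hw, .refl⟩)
    obtain ⟨p, hp1, hp2, hp3⟩ := hfair π fun i => (hπ i).1
    -- State `q` recurs with rank `q + 1`, while every rank in the block exceeds `q`. The least
    -- recurring rank is therefore `q + 1`, which is odd.
    have h5 := hp3 q (hf.mono fun i hi => hi.1)
    obtain ⟨i, hi⟩ := hp2.exists
    have h4 := hπ i
    have h6 := hrank p (by rw [← hi]; exact h4.2.1) (by rw [← hi]; exact h4.2.2)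
    simp only [h1] at h5 hp1
    have : (rows p).1 = q + 1 := by omega
    rw [this] at hp1
    grind
  | nu x φ ih =>
    obtain ⟨h1, -, h3⟩ := hrows
    set R := StepIn step ℓ q (q + (Formula.nu x φ).st) with hR
    -- The nodes at which the run unfolds the fixed point form a postfixed point: every use of the
    -- variable is itself such an unfolding.
    refine ⟨{u | ∃ y', Relation.ReflTransGen R y y' ∧ ℓ y' = (u, q)}, ?_, y, .refl, hy⟩
    rintro u ⟨b, hb3, hb⟩
    have := hok' hb
    rw [h1] at this
    obtain ⟨z, hs, hz⟩ := this
    have hRz : R b z := ⟨hs, by rw [hb], by rw [hb]; simp [Formula.st]⟩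
    refine ih (Function.update env x q) (Function.update val x _) (q + 2) (by grind) hG z _
      hz ?_ h3
    rintro ⟨y', ht, x', hx', he, hv⟩
    have ht' : Relation.TransGen R b y' :=
      (StepIn.transGen_mono (by omega) (by simp only [Formula.st]; omega) ht).head hRz
    by_cases hxx : x' = x
    · subst hxx
      simp only [Function.update_self] at he hv
      exact hv ⟨y', hb3.trans ht'.to_reflTransGen, by rw [← he]⟩
    · simp only [Function.update_of_ne hxx] at he hv
      exact hesc ⟨y', ht'.trans_right hb3, x', ⟨hx', hxx⟩, he, hv⟩

end Run

end FullGraded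

/-! ### Run trees, and the passage between tables and typed automata. -/

namespace FullGraded

variable {P A X : Type}

/-! ### Trees -/

theorem NTree.not_succ_root {T : NTree} (z : T.nodes) : ¬ T.Succ z T.rootNode := by
  rintro ⟨c, hc⟩
  obtain ⟨y, hy⟩ := T.head_eq z.1 z.2
  rw [hy] at hc
  have := congrArg List.length hc
  simp [NTree.rootNode] at this

theorem NTree.exists_pred {T : NTree} {x : T.nodes} (hx : x ≠ T.rootNode) : ∃ z, T.Succ z x := by
  obtain ⟨y, hy⟩ := T.head_eq x.1 x.2
  rcases List.eq_nil_or_concat y with rfl | ⟨z, c, rfl⟩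
  · exact absurd (Subtype.ext hy) hx
  · have hm : T.root :: z ∈ T.nodes := by
      refine T.closed (T.root :: z) c (by simp) ?_
      have := x.2
      rw [hy] at this
      simpa using this
    exact ⟨⟨_, hm⟩, c, by rw [hy]; simp⟩

/-- Acceptance only constrains paths that start at the root. Prolonging a path back to the root
extends the parity condition to all paths, since it ignores finite prefixes. -/
theorem NTree.exists_path_from_root {Tr : NTree} (π : ℕ → Tr.nodes)
    (hπ : ∀ i, Tr.Succ (π i) (π (i + 1))) :
    ∃ (k : ℕ) (π' : ℕ → Tr.nodes), π' 0 = Tr.rootNode ∧ (∀ i, Tr.Succ (π' i) (π' (i + 1))) ∧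
      ∀ i, π' (i + k) = π i := by
  induction hn : (π 0).1.length using Nat.strong_induction_on generalizing π with
  | _ n ih =>
    by_cases h0 : π 0 = Tr.rootNode
    · exact ⟨0, π, h0, hπ, fun i => rfl⟩
    · obtain ⟨z, hz⟩ := Tr.exists_pred h0
      obtain ⟨k, π', h1, h2, h3⟩ := ih z.1.length (by
        obtain ⟨c, hc⟩ := hz
        rw [← hn, hc]; simp) (fun i => Nat.casesOn i z π) (by
        intro i
        cases i with
        | zero => exact hz
        | succ i => exact hπ i) rfl
      refine ⟨k + 1, π', h1, h2, fun i => ?_⟩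
      have := h3 (i + 1)
      rwa [show i + 1 + k = i + (k + 1) by omega] at this

/-! ### Runs from positional strategies -/

/-- The words that code the plays of a positional strategy, with the last configuration. -/
inductive Unravel {β : Type} (E : β → Set β) (f : β → ℕ) (c₀ : β) : List ℕ → β → Prop
  | root : Unravel E f c₀ [f c₀] c₀
  | step {l : List ℕ} {c c' : β} : Unravel E f c₀ l c → c' ∈ E c → Unravel E f c₀ (l ++ [f c']) c'

theorem Unravel.getLast? {β : Type} {E : β → Set β} {f : β → ℕ} {c₀ c : β} {l : List ℕ}
    (h : Unravel E f c₀ l c) : l.getLast? = some (f c) := by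
  cases h <;> simp

/-- The run is the tree of histories of the strategy. Run trees consist of words over `ℕ`, so the
countably many configurations are numbered injectively; the last letter of a history then determines
its last configuration, and the children of a run node realize exactly the set prescribed by `E`. -/
theorem TwoGAPT.accepts_of_strategy {S : Type} (M : TwoGAPT S) (T : NTree) (V : T.nodes → S)
    (D : Set (T.nodes × M.Q)) (E : T.nodes × M.Q → Set (T.nodes × M.Q))
    (h0 : (T.rootNode, M.q₀) ∈ D) (hE : ∀ c ∈ D, E c ⊆ D)
    (hloc : ∀ c ∈ D, ∃ U : Set (Dir M.bound × M.Q), (M.δ c.2 (V c.1)).Sat U ∧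
      ∀ d ∈ U, TwoGAPT.AtomOK (E c) c.1 d)
    (hpar : ∀ π : ℕ → T.nodes × M.Q, π 0 = (T.rootNode, M.q₀) → (∀ i, π (i + 1) ∈ E (π i)) →
      M.Parity {q | ∃ᶠ i in atTop, (π i).2 = q}) : M.Accepts T V := by
  have := M.fintypeQ
  obtain ⟨f, hf⟩ := Countable.exists_injective_nat (T.nodes × M.Q)
  set c₀ : T.nodes × M.Q := (T.rootNode, M.q₀)
  have hD : ∀ {l c}, Unravel E f c₀ l c → c ∈ D := by
    intro l c h
    induction h with
    | root => exact h0
    | step _ h ih => exact hE _ ih h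
  have huniq : ∀ {l c c'}, Unravel E f c₀ l c → Unravel E f c₀ l c' → c = c' := by
    intro l c c' h h'
    have := h.getLast?
    rw [h'.getLast?] at this
    exact (hf (Option.some.inj this)).symm
  have hclosed : ∀ x c, x ≠ [] → (∃ d, Unravel E f c₀ (x ++ [c]) d) → ∃ d, Unravel E f c₀ x d := by
    rintro x c hx ⟨d, hd⟩
    generalize hl : x ++ [c] = l at hd
    cases hd with
    | root =>
      cases x with
      | nil => exact absurd rfl hx
      | cons a x => simp at hl
    | step h _ =>
      obtain rfl := List.append_inj_left' hl rfl
      exact ⟨_, h⟩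
  let Tr : NTree :=
    { nodes := {l | ∃ c, Unravel E f c₀ l c}
      root := f c₀
      root_mem := ⟨_, .root⟩
      head_eq := by
        rintro x ⟨c, hc⟩
        induction hc with
        | root => exact ⟨[], rfl⟩
        | step _ _ ih =>
          obtain ⟨y, rfl⟩ := ih
          exact ⟨_, List.cons_append⟩
      closed := hclosed }
  let r : Tr.nodes → T.nodes × M.Q := fun y => y.2.choose
  have hr : ∀ y : Tr.nodes, Unravel E f c₀ y.1 (r y) := fun y => y.2.choose_spec
  have hroot : r Tr.rootNode = c₀ := huniq (hr _) .root
  have hchild : ∀ y : Tr.nodes, {c | ∃ y', Tr.Succ y y' ∧ r y' = c} = E (r y) := by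
    intro y
    ext c
    constructor
    · rintro ⟨y', ⟨a, ha⟩, rfl⟩
      have h := hr y'
      have hy := hr y
      rw [ha] at h
      generalize r y' = e at h
      generalize hl : y.1 ++ [a] = l at h
      cases h with
      | root =>
        cases hyl : y.1 with
        | nil =>
          have h2 := hy.getLast?
          rw [hyl] at h2
          simp at h2
        | cons a x => rw [hyl] at hl; simp at hl
      | step h h' =>
        have := List.append_inj_left' hl rfl
        rw [this] at hy
        rwa [huniq hy h]
    · intro hc
      exact ⟨⟨_, _, (hr y).step hc⟩, ⟨_, rfl⟩, huniq (hr _) ((hr y).step hc)⟩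
  refine ⟨Tr, r, ⟨hroot, fun y => ?_⟩, fun π h1 h2 => ?_⟩
  · rw [hchild]
    exact hloc _ (hD (hr y))
  · refine hpar (fun i => r (π i)) (by simp only [h1, hroot]) fun i => ?_
    rw [← hchild]
    exact ⟨_, h2 i, rfl⟩

/-! ### Typed automata from tables -/

theorem PosBool.Sat.mono {Y : Type} {S S' : Set Y} (h : S ⊆ S') {θ : PosBool Y} (hS : θ.Sat S) :
    θ.Sat S' := by
  induction θ with
  | tt => trivial
  | ff => exact hS
  | atom y => exact h hS
  | and θ η ih1 ih2 => exact ⟨ih1 hS.1, ih2 hS.2⟩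
  | or θ η ih1 ih2 => exact hS.imp ih1 ih2

/-- Positive formulas are monotone, so the set of all admissible atoms is the best choice of `U`. -/
theorem PosBool.exists_sat_iff {Y : Type} {ok : Y → Prop} {θ : PosBool Y} :
    (∃ U : Set Y, θ.Sat U ∧ ∀ d ∈ U, ok d) ↔ θ.Sat {d | ok d} :=
  ⟨fun ⟨_, h1, h2⟩ => h1.mono h2, fun h => ⟨_, h, fun _ hd => hd⟩⟩

/-- A direction with its number cut off at the bound. -/
def RDir.toDir (b : ℕ) : RDir → Dir b
  | .up => .up
  | .stay => .stay
  | .dia n => .dia ⟨min n b, by omega⟩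
  | .box n => .box ⟨min n b, by omega⟩

/-- The number of a direction respects the bound. -/
def RDir.Valid (b : ℕ) : RDir → Prop
  | .up | .stay => True
  | .dia n | .box n => n ≤ b

/-- The letters, states and numbers of a transition are in the given ranges. -/
def PosBool.Valid (G : Set (Letter P A)) (b N : ℕ) : PosBool (RAtom P A) → Prop
  | .tt | .ff => True
  | .atom (.pos g) | .atom (.neg g) => g ∈ G
  | .atom (.move d q) => d.Valid b ∧ q < N
  | .and θ η | .or θ η => θ.Valid G b N ∧ η.Valid G b N

open Classical in
/-- A valid transition as a symbolic transition. -/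
noncomputable def toSym (G : Set (Letter P A)) (b N : ℕ) :
    PosBool (RAtom P A) → PosBool (SymAtom G b N)
  | .tt => .tt
  | .ff => .ff
  | .atom (.pos g) => if h : g ∈ G then .atom (.pos ⟨g, h⟩) else .tt
  | .atom (.neg g) => if h : g ∈ G then .atom (.neg ⟨g, h⟩) else .tt
  | .atom (.move d q) => if h : q < N then .atom (.move (d.toDir b) ⟨q, h⟩) else .tt
  | .and θ η => .and (toSym G b N θ) (toSym G b N η)
  | .or θ η => .or (toSym G b N θ) (toSym G b N η)

theorem atomOK_iff {T : NTree} {b N : ℕ} {C : Set (T.nodes × Fin N)} {x : T.nodes} {d : RDir}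
    {q : ℕ} (hd : d.Valid b) (hq : q < N) :
    TwoGAPT.AtomOK C x (d.toDir b, (⟨q, hq⟩ : Fin N)) ↔
      ROK {c | ∃ h : c.2 < N, (c.1, (⟨c.2, h⟩ : Fin N)) ∈ C} x d q := by
  cases d with
  | up => simp [RDir.toDir, TwoGAPT.AtomOK, ROK, hq]
  | stay => simp [RDir.toDir, TwoGAPT.AtomOK, ROK, hq]
  | dia n =>
    have : min n b = n := min_eq_left hd
    simp [RDir.toDir, TwoGAPT.AtomOK, ROK, hq, this]
  | box n =>
    have : min n b = n := min_eq_left hd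
    simp [RDir.toDir, TwoGAPT.AtomOK, ROK, hq, this]

/-- A letter of `2^G` as a set of letters. -/
def rawLetter {G : Set (Letter P A)} (σ : Set G) : Set (Letter P A) := {g | ∃ h : g ∈ G, ⟨g, h⟩ ∈ σ}

theorem exists_sat_iff_rsat {T : NTree} {G : Set (Letter P A)} {b N : ℕ} {σ : Set G}
    {C : Set (T.nodes × Fin N)} {x : T.nodes} {θ : PosBool (RAtom P A)} (hθ : θ.Valid G b N) :
    (∃ U, (instantiate σ (toSym G b N θ)).Sat U ∧ ∀ d ∈ U, TwoGAPT.AtomOK C x d) ↔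
      RSat (rawLetter σ) {c | ∃ h : c.2 < N, (c.1, (⟨c.2, h⟩ : Fin N)) ∈ C} x θ := by
  rw [PosBool.exists_sat_iff]
  induction θ with
  | tt => exact Iff.rfl
  | ff => exact Iff.rfl
  | atom y =>
    cases y with
    | pos g =>
      have hg : g ∈ G := hθ
      by_cases h : (⟨g, hg⟩ : G) ∈ σ <;> simp [toSym, hg, instantiate, h, RSat, PosBool.Sat, rawLetter]
    | neg g =>
      have hg : g ∈ G := hθ
      by_cases h : (⟨g, hg⟩ : G) ∈ σ <;> simp [toSym, hg, instantiate, h, RSat, PosBool.Sat, rawLetter]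
    | move d q =>
      have hd : d.Valid b := hθ.1
      have hq : q < N := hθ.2
      simp only [toSym, hq, dif_pos, instantiate, PosBool.Sat, RSat]
      exact atomOK_iff hd hq
  | and θ η ih1 ih2 => exact and_congr (ih1 hθ.1) (ih2 hθ.2)
  | or θ η ih1 ih2 => exact or_congr (ih1 hθ.1) (ih2 hθ.2)

/-- The automaton given by a table. -/
noncomputable def tableAut (G : Set (Letter P A)) (b : ℕ) (hb : 0 < b) (rows : List (Row P A))
    (h0 : 0 < rows.length) (h1 : ∀ i (h : i < rows.length), 1 ≤ rows[i].1)
    (h2 : ∀ i (h : i < rows.length), rows[i].1 ≤ rows.length) : SymAut G where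
  bound := b
  bound_pos := hb
  numStates := rows.length
  index := rows.length
  init := ⟨0, h0⟩
  trans q := toSym G b _ rows[q].2
  rank q := rows[q].1
  rank_pos q := h1 _ q.2
  rank_le q := h2 _ q.2

section TableAut

variable {G : Set (Letter P A)} {b : ℕ} {hb : 0 < b} {rows : List (Row P A)}
    {h0 : 0 < rows.length} {h1 : ∀ i (h : i < rows.length), 1 ≤ rows[i].1}
    {h2 : ∀ i (h : i < rows.length), rows[i].1 ≤ rows.length} {rf : ℕ → Row P A}

/-- The sets of the parity condition are the sublevel sets of the rank, and all ranks lie between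
`1` and the index. The first set that is met thus has the least recurring rank as its number. -/
theorem tableAut_parity_iff (hrf : Seg rf 0 rows) (f : ℕ → Fin rows.length) :
    (tableAut G b hb rows h0 h1 h2).toTwoGAPT.Parity {q : Fin rows.length | ∃ᶠ i in atTop, f i = q} ↔
      RPar (fun p => (rf p).1) (fun i => (f i).1) := by
  have hr : ∀ q : Fin rows.length, (rf q.1).1 = rows[q].1 := by
    intro q
    have := (Seg_iff _ _).1 hrf q.1 q.2
    rw [zero_add] at this
    rw [this]; rfl
  have hF : ∀ i, (tableAut G b hb rows h0 h1 h2).toTwoGAPT.F i =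
      {q : Fin rows.length | (rf q.1).1 ≤ i} := by
    intro i; ext q; simp only [hr]; rfl
  have hmem : ∀ q : Fin rows.length, 1 ≤ (rf q.1).1 ∧ (rf q.1).1 ≤ rows.length := fun q => by
    rw [hr]; exact ⟨h1 _ q.2, h2 _ q.2⟩
  unfold TwoGAPT.Parity RPar
  simp only [hF]
  constructor
  · rintro ⟨i, hi1, -, hev, ⟨q, hq, hqi⟩, hmin⟩
    have hle : ∀ q' : Fin rows.length, (∃ᶠ i in atTop, f i = q') → i ≤ (rf q'.1).1 := by
      intro q' hq'
      by_contra hlt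
      have := hmin _ (hmem q').1 (not_le.1 hlt)
      exact (this ▸ (⟨hq', le_refl (rf q'.1).1⟩ : q' ∈ _ ∩ {q : Fin rows.length | (rf q.1).1 ≤ (rf q'.1).1}) :
        q' ∈ (∅ : Set (Fin rows.length)))
    have hi : (rf q.1).1 = i := le_antisymm hqi (hle q hq)
    refine ⟨q.1, by simpa only [hi] using hev, hq.mono fun i hi => by rw [hi], fun p' hp' => ?_⟩
    obtain ⟨j, hj⟩ := hp'.exists
    subst hj
    simp only [hi]
    exact hle (f j) (hp'.mono fun i hi => Fin.ext hi)
  · rintro ⟨p, hp, hf, hmin⟩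
    obtain ⟨j, hj⟩ := hf.exists
    subst hj
    refine ⟨(rf (f j).1).1, (hmem _).1, (hmem _).2, hp,
      ⟨f j, hf.mono fun i hi => Fin.ext hi, le_refl (rf (f j).1).1⟩, fun k _ hk => ?_⟩
    rw [eq_empty_iff_forall_notMem]
    rintro q ⟨hq, hqk⟩
    have := hmin q.1 (hq.mono fun i hi => by rw [hi])
    have hqk' : (rf q.1).1 ≤ k := hqk
    omega

theorem tableAut_accepts_of_wins (hrf : Seg rf 0 rows)
    (hv : ∀ i (h : i < rows.length), rows[i].2.Valid G b rows.length) {T : NTree}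
    {V : T.nodes → Set G} {D : Set (T.nodes × ℕ)} (hD : Wins rf (fun x => rawLetter (V x)) ∅ D)
    (hDN : ∀ c ∈ D, c.2 < rows.length) (hroot : (T.rootNode, 0) ∈ D) :
    (tableAut G b hb rows h0 h1 h2).toTwoGAPT.Accepts T V := by
  obtain ⟨E, -, hE, hsat, hpar⟩ := hD
  simp only [union_empty] at hE
  refine TwoGAPT.accepts_of_strategy _ T V
    {c : T.nodes × Fin rows.length | (c.1, c.2.1) ∈ D}
    (fun c : T.nodes × Fin rows.length =>
      {c' : T.nodes × Fin rows.length | (c'.1, c'.2.1) ∈ E (c.1, c.2.1)}) hroot ?_ ?_ ?_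
  · intro c hc c' hc'
    exact hE _ hc hc'
  · rintro ⟨x, q⟩ hc
    refine (exists_sat_iff_rsat (hv q.1 q.2)).2 ?_
    have := hsat _ hc
    have hq := (Seg_iff _ _).1 hrf q.1 q.2
    rw [zero_add] at hq
    simp only [hq] at this
    refine this.mono fun c' hc' => ?_
    exact ⟨hDN _ (hE _ hc hc'), hc'⟩
  · intro π h0 hπ
    refine (tableAut_parity_iff hrf fun i => (π i).2).2 ?_
    refine hpar (fun i => ((π i).1, (π i).2.1)) (fun i => ?_) hπ
    induction i with
    | zero => rw [h0]; exact hroot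
    | succ i ih => exact hE _ ih (hπ i)

theorem tableAut_run (hrf : Seg rf 0 rows)
    (hv : ∀ i (h : i < rows.length), rows[i].2.Valid G b rows.length) {T : NTree}
    {V : T.nodes → Set G} (h : (tableAut G b hb rows h0 h1 h2).toTwoGAPT.Accepts T V) :
    ∃ (Y : Type) (step : Y → Y → Prop) (ℓ : Y → T.nodes × ℕ) (y₀ : Y), ℓ y₀ = (T.rootNode, 0) ∧
      (∀ y, RSat (rawLetter (V (ℓ y).1)) {c | ∃ y', step y y' ∧ ℓ y' = c} (ℓ y).1 (rf (ℓ y).2).2) ∧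
      ∀ π : ℕ → Y, (∀ i, step (π i) (π (i + 1))) →
        RPar (fun p => (rf p).1) (fun i => (ℓ (π i)).2) := by
  obtain ⟨Tr, r, ⟨hroot, hrun⟩, hacc⟩ := h
  change Tr.nodes → T.nodes × Fin rows.length at r
  refine ⟨Tr.nodes, Tr.Succ, fun y => ((r y).1, (r y).2.1), Tr.rootNode, ?_, fun y => ?_,
    fun π hπ => ?_⟩
  · exact congrArg (fun c : T.nodes × Fin rows.length => (c.1, c.2.1)) hroot
  · have := (exists_sat_iff_rsat (hv (r y).2.1 (r y).2.2)).1 (hrun y)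
    have hq := (Seg_iff _ _).1 hrf (r y).2.1 (r y).2.2
    rw [zero_add] at hq
    simp only [hq]
    refine this.mono ?_
    rintro ⟨z, q⟩ ⟨hq, y', hy, hr⟩
    exact ⟨y', hy, by rw [hr]⟩
  · obtain ⟨k, π', p1, p2, p3⟩ := Tr.exists_path_from_root π hπ
    have := (tableAut_parity_iff hrf fun i => (r (π' i)).2).1 (hacc π' p1 p2)
    have := (RPar_shift k).2 this
    simpa only [p3] using this

end TableAut

end FullGraded

/-! ### The automaton of a sentence accepts exactly the encodings of tree models. -/

namespace FullGraded

variable {P A X : Type}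

/-! ### The automaton of a sentence -/

/-- The initial transition: no program occurs in the label of the root, `φ` holds there, and the other
nodes are checked. -/
def rootTrans (L : List A) : PosBool (RAtom P A) :=
  L.foldr (fun a θ => .and (.atom (.neg (.edge (.fwd a)))) (.and (.atom (.neg (.edge (.bwd a)))) θ))
    (.and (mv .stay 2) (mv (.box 0) 1))

/-- The transition that checks that each node but the root has a program in its label; this is not
required (`all` is `false`) if some program does not occur in the formula. -/
def nodeTrans (L : List A) (all : Bool) : PosBool (RAtom P A) :=
  .and (mv (.box 0) 1) (L.foldr
    (fun a θ => .or (.atom (.pos (.edge (.fwd a)))) (.or (.atom (.pos (.edge (.bwd a)))) θ))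
    (bif all then .ff else .tt))

/-- The table of a sentence. -/
def topTable [DecidableEq X] (L : List A) (all : Bool) (φ : Formula P A X) : List (Row P A) :=
  (1, rootTrans L) :: (2, nodeTrans L all) :: table (fun _ => 0) 2 φ

theorem topTable_length [DecidableEq X] (L : List A) (all : Bool) (φ : Formula P A X) :
    (topTable L all φ).length = φ.st + 2 := by simp [topTable, table_length]

theorem forall_prg {p : Prg A → Prop} : (∀ α, p α) ↔ ∀ a, p (.fwd a) ∧ p (.bwd a) :=
  ⟨fun h a => ⟨h _, h _⟩, fun h α => by cases α with
    | fwd a => exact (h a).1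
    | bwd a => exact (h a).2⟩

theorem rsat_rootTrans {T : NTree} {σ : Set (Letter P A)} {C : Set (T.nodes × ℕ)} {x : T.nodes}
    (L : List A) : RSat σ C x (rootTrans L) ↔
      (∀ α : Prg A, α.base ∈ L → Letter.edge α ∉ σ) ∧ (x, 2) ∈ C ∧ ∀ z, T.Succ x z → (z, 1) ∈ C := by
  simp only [forall_prg, Prg.base]
  induction L with
  | nil => simp [rootTrans, RSat, mv, ROK]
  | cons a L ih =>
    have : (rootTrans (a :: L) : PosBool (RAtom P A)) = .and (.atom (.neg (.edge (.fwd a))))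
      (.and (.atom (.neg (.edge (.bwd a)))) (rootTrans L)) := rfl
    simp only [this, RSat, ih, List.mem_cons]
    grind

theorem rsat_nodeTrans {T : NTree} {σ : Set (Letter P A)} {C : Set (T.nodes × ℕ)} {x : T.nodes}
    (L : List A) (all : Bool) : RSat σ C x (nodeTrans L all) ↔
      (∀ z, T.Succ x z → (z, 1) ∈ C) ∧
        (all = true → ∃ α : Prg A, α.base ∈ L ∧ Letter.edge α ∈ σ) := by
  have h0 : ROK C x (.box 0) 1 ↔ ∀ z, T.Succ x z → (z, 1) ∈ C := by
    simp [ROK]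
  simp only [nodeTrans, RSat, mv, h0]
  refine and_congr_right fun _ => ?_
  induction L with
  | nil => cases all <;> simp [RSat]
  | cons a L ih =>
    simp only [List.foldr_cons, RSat, ih, List.mem_cons]
    constructor
    · rintro (h | h | h) hall
      · exact ⟨.fwd a, Or.inl rfl, h⟩
      · exact ⟨.bwd a, Or.inl rfl, h⟩
      · obtain ⟨α, h1, h2⟩ := h hall
        exact ⟨α, Or.inr h1, h2⟩
    · intro h
      by_cases hall : all = true
      · obtain ⟨α, h1 | h1, h2⟩ := h hall
        · cases α with
          | fwd a => obtain rfl := h1; exact Or.inl h2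
          | bwd a => obtain rfl := h1; exact Or.inr (Or.inl h2)
        · exact Or.inr (Or.inr fun _ => ⟨α, h1, h2⟩)
      · exact Or.inr (Or.inr fun h => absurd h hall)

section Top

variable {T : NTree} {lab : T.nodes → Set (Letter P A)} {L : List A} {all : Bool}
  {rf : ℕ → Row P A} {φ : Formula P A X}

theorem wins_topTable [DecidableEq X] {K : Kripke P A T.nodes} (hrf : Seg rf 0 (topTable L all φ))
    (hφ : φ.IsSentence) (hK : Compat K lab φ.progs)
    (hroot : ∀ α : Prg A, α.base ∈ L → Letter.edge α ∉ lab T.rootNode)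
    (hnode : ∀ x, x ≠ T.rootNode → all = true → ∃ α : Prg A, α.base ∈ L ∧ Letter.edge α ∈ lab x)
    (hsem : K.Holds T.rootNode φ) :
    ∃ D, Wins rf lab ∅ D ∧ (∀ c ∈ D, c.2 < (topTable L all φ).length) ∧ (T.rootNode, 0) ∈ D := by
  obtain ⟨r0, r1, r2⟩ := hrf
  obtain ⟨D, w, hr, hs⟩ := wins_of_sem hK φ (fun _ => 0) (fun _ => ∅) 2 (by decide) subset_rfl
    (by intro x _; omega) r2
  have hex : exits (fun _ => 0) (fun _ => ∅) φ = (∅ : Set (T.nodes × ℕ)) := by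
    rw [eq_empty_iff_forall_notMem]
    rintro c ⟨x, hx, -⟩
    rw [Formula.IsSentence] at hφ
    rw [hφ] at hx
    exact hx
  rw [hex] at w
  -- State `1` walks down the tree for ever, which is allowed because its rank is `2`. It is a loop
  -- over the empty domain, and it never visits the root because the root is nobody's successor.
  have w1 : Wins rf lab ∅ {c : T.nodes × ℕ | c.2 = 1 ∧ c.1 ≠ T.rootNode} := by
    have := (Wins.empty (rows := rf) (lab := lab)
      (Y := ∅ ∪ {c : T.nodes × ℕ | c.2 = 1 ∧ c.1 ≠ T.rootNode})).loop
      (X := ∅) (q := 1) (by simp) ?_ ?_ (by simp)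
    · simpa using this
    · rintro ⟨x, p⟩ ⟨hp, hx⟩
      simp only at hp hx
      subst hp
      refine ⟨rfl, ?_⟩
      simp only [r1]
      refine (rsat_nodeTrans _ _).2 ⟨fun z hz => ?_, hnode x hx⟩
      refine Or.inl (Or.inr ⟨rfl, ?_⟩)
      rintro rfl
      exact NTree.not_succ_root _ hz
    · rw [r1]; exact even_two
  have w2 := (w.union w1).seq (D₂ := {(T.rootNode, 0)}) (Wins.step (by
    rw [Set.disjoint_singleton_right]
    rintro (hc | hc | hc)
    · exact hc
    · have := (hr _ hc).1
      simp at this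
    · have := hc.1
      simp at this) (by
    rintro c rfl
    simp only [r0]
    refine (rsat_rootTrans _).2 ⟨hroot, Or.inr (Or.inl (hs _ hsem)), fun z hz => ?_⟩
    refine Or.inr (Or.inr ⟨rfl, ?_⟩)
    rintro rfl
    exact NTree.not_succ_root _ hz))
  refine ⟨_, w2, ?_, Or.inr rfl⟩
  rw [topTable_length]
  rintro c ((hc | hc) | rfl)
  · have := hr c hc; omega
  · have := hc.1; omega
  · simp

theorem run_topTable [DecidableEq X] (hrf : Seg rf 0 (topTable L all φ)) (hφ : φ.IsSentence)
    {Y : Type} {step : Y → Y → Prop} {ℓ : Y → T.nodes × ℕ} {y₀ : Y} (h0 : ℓ y₀ = (T.rootNode, 0))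
    (hok : ∀ y, RSat (lab (ℓ y).1) {c | ∃ y', step y y' ∧ ℓ y' = c} (ℓ y).1 (rf (ℓ y).2).2)
    (hfair : ∀ π : ℕ → Y, (∀ i, step (π i) (π (i + 1))) →
      RPar (fun p => (rf p).1) (fun i => (ℓ (π i)).2)) :
    (∀ α : Prg A, α.base ∈ L → Letter.edge α ∉ lab T.rootNode) ∧
    (∀ x, x ≠ T.rootNode → all = true → ∃ α : Prg A, α.base ∈ L ∧ Letter.edge α ∈ lab x) ∧
    ∀ K : Kripke P A T.nodes, Compat K lab φ.progs → K.Holds T.rootNode φ := by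
  obtain ⟨r0, r1, r2⟩ := hrf
  have hr := hok y₀
  rw [h0] at hr
  simp only [r0] at hr
  rw [rsat_rootTrans] at hr
  obtain ⟨ha, ⟨y₁, -, hy₁⟩, hc⟩ := hr
  have hnode : ∀ x, x ≠ T.rootNode → ∃ y, ℓ y = (x, 1) := by
    intro x
    induction hn : x.1.length using Nat.strong_induction_on generalizing x with
    | _ n ih =>
      intro hx
      obtain ⟨z, hz⟩ := NTree.exists_pred hx
      by_cases hzr : z = T.rootNode
      · subst hzr
        obtain ⟨y, -, hy⟩ := hc x hz
        exact ⟨y, hy⟩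
      · obtain ⟨y, hy⟩ := ih z.1.length (by
          obtain ⟨c, hc⟩ := hz
          rw [← hn, hc]; simp) z rfl hzr
        have := hok y
        rw [hy] at this
        simp only [r1] at this
        rw [rsat_nodeTrans] at this
        obtain ⟨y', -, hy'⟩ := this.1 x hz
        exact ⟨y', hy'⟩
  refine ⟨ha, fun x hx => ?_, fun K hK => ?_⟩
  · obtain ⟨y, hy⟩ := hnode x hx
    have := hok y
    rw [hy] at this
    simp only [r1] at this
    rw [rsat_nodeTrans] at this
    exact this.2
  · refine mem_sem_of_run hK hok hfair φ (fun _ => 0) (fun _ => ∅) 2 (by decide) subset_rfl y₁ _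
      hy₁ ?_ r2
    rintro ⟨y', -, x, hx, -⟩
    rw [Formula.IsSentence] at hφ
    rw [hφ] at hx
    exact hx

end Top

/-! ### Encodings -/

section Encoding

variable {T : NTree} {φ : Formula P A X}

/-- An edge is recorded only at its lower end. An upward `α`-edge is the same as a downward edge of
the inverse program, whose letter stands at the lower node. -/
theorem compat_encoding {K : Kripke P A T.nodes} (hK : IsTreeStructure K) :
    Compat K (fun x => rawLetter (encoding φ K x)) φ.progs where
  prop p x := ⟨fun h => ⟨trivial, h⟩, fun h => h.2⟩
  rel α hα x y := by
    have hinv : ∀ x y, K.rel α.inv y x ↔ K.rel α x y := by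
      intro x y; cases α <;> rfl
    constructor
    · intro h
      rcases (hK x y).1 ⟨α, h⟩ with hs | hs
      · exact Or.inl ⟨hs, hα, x, hs, h⟩
      · exact Or.inr ⟨hs, (show α.inv.base ∈ φ.progs by rw [Prg.inv_base]; exact hα), y, hs, (hinv x y).2 h⟩
    · rintro (⟨hs, -, v, hv, h⟩ | ⟨hs, -, v, hv, h⟩)
      · rwa [← hv.eq hs]
      · rw [hv.eq hs] at h
        exact (hinv x y).1 h
  pred α x _ h := by
    obtain ⟨-, v, hv, -⟩ := h
    exact ⟨v, hv⟩

theorem encoding_root_not_mem {K : Kripke P A T.nodes} (α : Prg A) :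
    Letter.edge α ∉ rawLetter (encoding φ K T.rootNode) := by
  rintro ⟨-, v, hv, -⟩
  exact NTree.not_succ_root _ hv

theorem exists_edge_of_encoding {K : Kripke P A T.nodes} (hK : IsTreeStructure K)
    (hall : ∀ a, a ∈ φ.progs) {x : T.nodes} (hx : x ≠ T.rootNode) :
    ∃ α : Prg A, α.base ∈ φ.progs ∧ Letter.edge α ∈ rawLetter (encoding φ K x) := by
  obtain ⟨z, hz⟩ := NTree.exists_pred hx
  obtain ⟨α, hα⟩ := (hK z x).2 (Or.inl hz)
  exact ⟨α, hall _, hall _, z, hz, hα⟩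

/-- The structure described by a labeling; the programs that do not occur in `φ` connect all
neighbours. -/
def decode (φ : Formula P A X) (V : T.nodes → Set (Gam φ)) : Kripke P A T.nodes where
  nonempty := ⟨T.rootNode⟩
  R a x y := (T.Succ x y ∧ (a ∈ φ.progs → Letter.edge (.fwd a) ∈ rawLetter (V y))) ∨
    (T.Succ y x ∧ (a ∈ φ.progs → Letter.edge (.bwd a) ∈ rawLetter (V x)))
  L p := {x | Letter.prop p ∈ rawLetter (V x)}

theorem decode_rel (V : T.nodes → Set (Gam φ)) (α : Prg A) (x y : T.nodes) :
    (decode φ V).rel α x y ↔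
      (T.Succ x y ∧ (α.base ∈ φ.progs → Letter.edge α ∈ rawLetter (V y))) ∨
      (T.Succ y x ∧ (α.base ∈ φ.progs → Letter.edge α.inv ∈ rawLetter (V x))) := by
  cases α with
  | fwd a => exact Iff.rfl
  | bwd a => exact or_comm

/-- Every pair of neighbours needs some edge. If all programs occur in `φ`, a letter must provide
it; otherwise a program outside `φ` does, because `decode` lets it connect all neighbours and the
alphabet has no letter for it. A letter at the root would have no edge to describe, hence `hroot`.
-/
theorem decode_spec {V : T.nodes → Set (Gam φ)}
    (hroot : ∀ α : Prg A, α.base ∈ φ.progs → Letter.edge α ∉ rawLetter (V T.rootNode))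
    (hnode : ∀ x, x ≠ T.rootNode → (∀ a, a ∈ φ.progs) →
      ∃ α : Prg A, α.base ∈ φ.progs ∧ Letter.edge α ∈ rawLetter (V x)) :
    IsTreeStructure (decode φ V) ∧ encoding φ (decode φ V) = V := by
  have hedge : ∀ v w, T.Succ v w → ∃ α : Prg A, α.base ∈ φ.progs → Letter.edge α ∈ rawLetter (V w) := by
    intro v w h
    by_cases hall : ∀ a, a ∈ φ.progs
    · obtain ⟨α, -, h⟩ := hnode w (by rintro rfl; exact NTree.not_succ_root _ h) hall
      exact ⟨α, fun _ => h⟩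
    · push Not at hall
      obtain ⟨a, ha⟩ := hall
      exact ⟨.fwd a, fun h => absurd h ha⟩
  refine ⟨fun v w => ⟨?_, ?_⟩, ?_⟩
  · rintro ⟨α, h⟩
    rw [decode_rel] at h
    exact h.imp And.left And.left
  · rintro (h | h)
    · obtain ⟨α, hα⟩ := hedge v w h
      exact ⟨α, (decode_rel _ _ _ _).2 (Or.inl ⟨h, hα⟩)⟩
    · obtain ⟨α, hα⟩ := hedge w v h
      refine ⟨α.inv, (decode_rel _ _ _ _).2 (Or.inr ⟨h, ?_⟩)⟩
      rw [Prg.inv_base]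
      have : α.inv.inv = α := by cases α <;> rfl
      rwa [this]
  · funext w
    ext ⟨g, hg⟩
    cases g with
    | prop p => exact ⟨fun h => h.2, fun h => ⟨hg, h⟩⟩
    | edge α =>
      constructor
      · rintro ⟨v, hv, h⟩
        rw [decode_rel] at h
        rcases h with h | h
        · exact (h.2 hg).2
        · exact absurd h.1 hv.asymm
      · intro h
        have hw : w ≠ T.rootNode := by
          rintro rfl
          exact hroot α hg ⟨hg, h⟩
        obtain ⟨v, hv⟩ := NTree.exists_pred hw
        exact ⟨v, hv, (decode_rel _ _ _ _).2 (Or.inl ⟨hv, fun _ => ⟨hg, h⟩⟩)⟩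

end Encoding

/-! ### Validity of the table -/

theorem table_valid [DecidableEq X] {G : Set (Letter P A)} {b N : ℕ} (ψ : Formula P A X)
    (env : X → ℕ) (q : ℕ) (henv : ∀ x, env x < N) (hN : q + ψ.st ≤ N)
    (hG : ∀ α : Prg A, α.base ∈ ψ.progs → Letter.edge α ∈ G) (hP : ∀ p, Letter.prop p ∈ G)
    (hb : ψ.maxGrade ≤ b) :
    ∀ row ∈ table env q ψ, 1 ≤ row.1 ∧ row.1 ≤ N ∧ row.2.Valid G b N := by
  induction ψ generalizing env q with
  | tt | ff | prop p | nprop p | var x =>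
    simp only [Formula.st] at hN
    simp [table, PosBool.Valid, mv, RDir.Valid, hP, henv]
    omega
  | or φ ψ ih1 ih2 | and φ ψ ih1 ih2 =>
    simp only [Formula.st] at hN
    have := φ.two_le_st
    have := ψ.two_le_st
    simp only [Formula.maxGrade] at hb
    have i1 := ih1 env (q + 2) henv (by omega) (fun α h => hG α (Or.inl h)) (by omega)
    have i2 := ih2 env (q + 2 + φ.st) henv (by omega) (fun α h => hG α (Or.inr h)) (by omega)
    simp only [table, List.mem_cons, List.mem_append]
    rintro row (rfl | rfl | h | h)
    · simp [PosBool.Valid, mv, RDir.Valid]; omega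
    · simp [PosBool.Valid]; omega
    · exact i1 row h
    · exact i2 row h
  | dia n α φ ih | box n α φ ih =>
    simp only [Formula.st] at hN
    have := φ.two_le_st
    simp only [Formula.maxGrade] at hb
    have i1 := ih env (q + 2) henv (by omega) (fun α h => hG α (Or.inr h)) (by omega)
    have e1 := hG α (Or.inl rfl)
    have e2 := hG α.inv (Or.inl (Prg.inv_base α))
    simp only [table, List.mem_cons]
    rintro row (rfl | rfl | h)
    · refine ⟨by simp, by simp; omega, ?_⟩
      rcases n with _ | n
      · simp [PosBool.Valid, mv, RDir.Valid, diaTrans, boxTrans, e2]; omega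
      · simp [PosBool.Valid, mv, RDir.Valid, diaTrans, boxTrans, e2]; omega
    · simp [PosBool.Valid, mv, RDir.Valid, e1]; omega
    · exact i1 row h
  | mu y φ ih | nu y φ ih =>
    simp only [Formula.st] at hN
    have := φ.two_le_st
    have i1 := ih (Function.update env y q) (q + 2) (fun x => by
      by_cases h : x = y
      · subst h; simp; omega
      · rw [Function.update_of_ne h]; exact henv x) (by omega) hG hb
    simp only [table, List.mem_cons]
    rintro row (rfl | rfl | h)
    · simp [PosBool.Valid, mv, RDir.Valid]; omega
    · simp [PosBool.Valid]; omega
    · exact i1 row h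

theorem topTable_valid [DecidableEq X] {b : ℕ} {L : List A} {all : Bool} {φ : Formula P A X}
    (hL : ∀ a ∈ L, a ∈ φ.progs) (hb : φ.maxGrade ≤ b) :
    ∀ row ∈ topTable L all φ, 1 ≤ row.1 ∧ row.1 ≤ (topTable L all φ).length ∧
      row.2.Valid (Gam φ) b (topTable L all φ).length := by
  rw [topTable_length]
  have h2 := φ.two_le_st
  have ht := table_valid (G := Gam φ) (b := b) (N := φ.st + 2) φ (fun _ => 0) 2 (by omega) (by omega)
    (fun α h => h) (fun p => trivial) hb
  simp only [topTable, List.mem_cons]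
  rintro row (rfl | rfl | h)
  · refine ⟨le_rfl, by simp, ?_⟩
    clear ht
    induction L with
    | nil => simp [rootTrans, PosBool.Valid, mv, RDir.Valid]; omega
    | cons a L ih =>
      have ha := hL a (by simp)
      exact ⟨ha, ha, ih fun a h => hL a (by simp [h])⟩
  · refine ⟨by simp, by simp, ?_⟩
    clear ht
    refine ⟨⟨by simp [RDir.Valid], by simp⟩, ?_⟩
    induction L with
    | nil => cases all <;> trivial
    | cons a L ih =>
      have ha := hL a (by simp)
      exact ⟨ha, ha, ih fun a h => hL a (by simp [h])⟩
  · exact ht row h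

/-- The automaton of a sentence with maximal grade below `b`. -/
noncomputable def sentenceAut [DecidableEq X] {L : List A} (all : Bool) {φ : Formula P A X} {b : ℕ}
    (hL : ∀ a ∈ L, a ∈ φ.progs) (hb : φ.CountsUpTo b) : SymAut (Gam φ) :=
  tableAut (Gam φ) b (hb ▸ Nat.succ_pos _) (topTable L all φ) (by simp [topTable])
    (fun _ _ => (topTable_valid hL (Nat.le_of_succ_le hb.le) _ (List.getElem_mem _)).1)
    (fun _ _ => (topTable_valid hL (Nat.le_of_succ_le hb.le) _ (List.getElem_mem _)).2.1)

/-- An accepted labeling is decoded, and the run shows that `φ` holds in the decoded structure. For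
a tree model, truth at the root gives a winning domain for the whole table. -/
theorem sentenceAut_accepts_iff [DecidableEq X] {L : List A} {all : Bool} {φ : Formula P A X} {b : ℕ}
    (hφ : φ.IsSentence) (hL : ∀ a ∈ L, a ∈ φ.progs) (hL' : ∀ a ∈ φ.progs, a ∈ L)
    (hall : all = true ↔ ∀ a, a ∈ φ.progs) (hb : φ.CountsUpTo b) (T : NTree)
    (V : T.nodes → Set (Gam φ)) :
    (sentenceAut all hL hb).toTwoGAPT.Accepts T V ↔
      ∃ K : Kripke P A T.nodes, IsTreeModel K φ ∧ encoding φ K = V := by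
  have hv : ∀ i (h : i < (topTable L all φ).length),
      (topTable L all φ)[i].2.Valid (Gam φ) b (topTable L all φ).length := fun _ _ =>
    (topTable_valid hL (Nat.le_of_succ_le hb.le) _ (List.getElem_mem _)).2.2
  have hrf : Seg (fun i => (topTable L all φ).getD i (0, .tt)) 0 (topTable L all φ) := by
    rw [Seg_iff]
    intro i hi
    simp [hi]
  constructor
  · intro h
    obtain ⟨Y, step, ℓ, y₀, h0, hok, hfair⟩ := tableAut_run hrf hv h
    obtain ⟨h1, h2, h3⟩ := run_topTable (lab := fun x => rawLetter (V x)) hrf hφ h0 hok hfair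
    obtain ⟨h4, h5⟩ := decode_spec (V := V) (fun α hα => h1 α (hL' _ hα)) (fun x hx hx' => by
      obtain ⟨α, hα, hα'⟩ := h2 x hx (hall.2 hx')
      exact ⟨α, hL _ hα, hα'⟩)
    refine ⟨decode φ V, ⟨h4, h3 _ ?_⟩, h5⟩
    have := compat_encoding (φ := φ) h4
    rwa [h5] at this
  · rintro ⟨K, ⟨h1, h2⟩, rfl⟩
    obtain ⟨D, w, hD, hr⟩ := wins_topTable (L := L) (all := all) hrf hφ (compat_encoding h1)
      (fun α _ => encoding_root_not_mem α) (fun x hx ha => by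
        obtain ⟨α, hα, hα'⟩ := exists_edge_of_encoding h1 (hall.1 ha) hx
        exact ⟨α, hL' _ hα, hα'⟩) h2
    exact tableAut_accepts_of_wins hrf hv w hD hr

end FullGraded

/-! ### A program logic with running times, and binary codes. -/

namespace FullGraded

/-! ### A program logic for the random access machine -/

namespace RAM

/-- From `s`, the command terminates, with a store and a number of steps that satisfy `Q`. -/
def W (p : Program) (c : Cmd) (s : Store) (Q : Store → ℕ → Prop) : Prop :=
  ∃ s' t, Exec p c s s' t ∧ Q s' t

/-- Writing a cell. -/
def upd (s : Store) (a i v : ℕ) : Store := Function.update s a (Function.update (s a) i v)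

@[simp] theorem upd_same (s : Store) (a i v : ℕ) : upd s a i v a i = v := by simp [upd]

theorem upd_array (s : Store) (a i v : ℕ) : upd s a i v a = Function.update (s a) i v := by
  simp [upd]

theorem upd_of_ne (s : Store) {a b : ℕ} (i v : ℕ) (h : b ≠ a) : upd s a i v b = s b := by
  simp [upd, h]

/-- The arrays outside `A` are unchanged. -/
def Fr (A : List ℕ) (s s' : Store) : Prop := ∀ a, a ∉ A → s' a = s a

theorem Fr.trans {A B C : List ℕ} {s s' s'' : Store} (h : Fr A s s') (h' : Fr B s' s'')
    (hA : A ⊆ C) (hB : B ⊆ C) : Fr C s s'' := fun a ha =>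
  (h' a fun h => ha (hB h)).trans (h a fun h => ha (hA h))

theorem Fr.mono {A B : List ℕ} {s s' : Store} (h : Fr A s s') (hA : A ⊆ B) : Fr B s s' :=
  fun a ha => h a fun h => ha (hA h)

theorem Fr.refl (A : List ℕ) (s : Store) : Fr A s s := fun _ _ => rfl

theorem Fr.upd {A : List ℕ} {s s' : Store} (h : Fr A s s') {a : ℕ} (i v : ℕ) (ha : a ∈ A) :
    Fr A s (upd s' a i v) := fun b hb => by
  rw [upd_of_ne _ _ _ (by rintro rfl; exact hb ha), h b hb]

variable {p : Program}

theorem W.mono {c : Cmd} {s : Store} {Q Q' : Store → ℕ → Prop} (h : W p c s Q)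
    (hQ : ∀ s' t, Q s' t → Q' s' t) : W p c s Q' := by
  obtain ⟨s', t, h1, h2⟩ := h
  exact ⟨s', t, h1, hQ _ _ h2⟩

theorem W.skip {s : Store} {Q : Store → ℕ → Prop} (h : Q s 1) : W p .skip s Q :=
  ⟨s, 1, .skip s, h⟩

theorem W.set {a : ℕ} {i e : Expr} {s : Store} {Q : Store → ℕ → Prop}
    (h : Q (upd s a (i.eval s) (e.eval s)) (1 + i.cost + e.cost)) : W p (.set a i e) s Q :=
  ⟨_, _, .set a i e s, h⟩

theorem W.seq {c d : Cmd} {s : Store} {Q : Store → ℕ → Prop}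
    (h : W p c s fun s' t => W p d s' fun s'' t' => Q s'' (1 + t + t')) : W p (.seq c d) s Q := by
  obtain ⟨s', t, h1, s'', t', h2, h3⟩ := h
  exact ⟨s'', _, .seq h1 h2, h3⟩

theorem W.ite_true {b : Test} {c d : Cmd} {s : Store} {Q : Store → ℕ → Prop} (hb : b.Holds s)
    (h : W p c s fun s' t => Q s' (1 + b.cost + t)) : W p (.ite b c d) s Q := by
  obtain ⟨s', t, h1, h2⟩ := h
  exact ⟨s', _, .ite_true hb h1, h2⟩

theorem W.ite_false {b : Test} {c d : Cmd} {s : Store} {Q : Store → ℕ → Prop} (hb : ¬ b.Holds s)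
    (h : W p d s fun s' t => Q s' (1 + b.cost + t)) : W p (.ite b c d) s Q := by
  obtain ⟨s', t, h1, h2⟩ := h
  exact ⟨s', _, .ite_false hb h1, h2⟩

theorem W.call {j : ℕ} {c : Cmd} {s : Store} {Q : Store → ℕ → Prop} (hj : p[j]? = some c)
    (h : W p c s fun s' t => Q s' (1 + t)) : W p (.call j) s Q := by
  obtain ⟨s', t, h1, h2⟩ := h
  exact ⟨s', _, .call hj h1, h2⟩

/-- A loop that runs `k` times. -/
theorem W.loop {b : Test} {c : Cmd} (Inv : ℕ → Store → Prop) (k T : ℕ) {s : Store}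
    (h0 : Inv 0 s)
    (hstep : ∀ i s, i < k → Inv i s → b.Holds s ∧ W p c s fun s' t => Inv (i + 1) s' ∧ t ≤ T)
    (hend : ∀ s, Inv k s → ¬ b.Holds s) :
    W p (.loop b c) s fun s' t => Inv k s' ∧ t ≤ k * (1 + b.cost + T) + (1 + b.cost) := by
  have : ∀ j i s, i + j = k → Inv i s →
      W p (.loop b c) s fun s' t => Inv k s' ∧ t ≤ j * (1 + b.cost + T) + (1 + b.cost) := by
    intro j
    induction j with
    | zero =>
      intro i s hi h
      obtain rfl : i = k := by omega
      exact ⟨s, _, .loop_false (hend s h), h, by omega⟩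
    | succ j ih =>
      intro i s hi h
      obtain ⟨hb, s', t, h1, h2, h3⟩ := hstep i s (by omega) h
      obtain ⟨s'', t', h4, h5, h6⟩ := ih (i + 1) s' (by omega) h2
      refine ⟨s'', _, .loop_true hb h1 h4, h5, ?_⟩
      rw [Nat.succ_mul]
      omega
  exact this k 0 s (by omega) h0

/-! ### Output -/

/-- The scalar variable `a`. -/
def v (a : ℕ) : Expr := .get a (.lit 0)

/-- Assignment to a scalar variable. -/
def setv (a : ℕ) (e : Expr) : Cmd := .set a (.lit 0) e

/-- Increasing a scalar variable. -/
def incr (a : ℕ) : Cmd := setv a (.succ (v a))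

@[simp] theorem v_eval (a : ℕ) (s : Store) : (v a).eval s = s a 0 := rfl

@[simp] theorem v_cost (a : ℕ) : (v a).cost = 2 := rfl

theorem W.setv {a : ℕ} {e : Expr} {s : Store} {Q : Store → ℕ → Prop}
    (h : Q (upd s a 0 (e.eval s)) (2 + e.cost)) : W p (setv a e) s Q := W.set h

theorem W.incr {a : ℕ} {s : Store} {Q : Store → ℕ → Prop}
    (h : Q (upd s a 0 (s a 0 + 1)) 5) : W p (incr a) s Q := W.set h

/-- The word `L` has been appended to the output, the end of which is kept in the variable `5`. -/
def Emits (s s' : Store) (L : List ℕ) : Prop :=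
  s' 5 0 = s 5 0 + L.length ∧ (∀ j < s 5 0, s' 1 j = s 1 j) ∧ Seg (s' 1) (s 5 0) L

theorem Emits.trans {s s' s'' : Store} {L M : List ℕ} (h : Emits s s' L) (h' : Emits s' s'' M) :
    Emits s s'' (L ++ M) := by
  obtain ⟨a1, a2, a3⟩ := h
  obtain ⟨b1, b2, b3⟩ := h'
  refine ⟨by rw [b1, a1, List.length_append]; omega, fun j hj => ?_, ?_⟩
  · rw [b2 j (by omega), a2 j hj]
  · rw [Seg_append, ← a1]
    exact ⟨a3.congr fun j _ hj => b2 j (by omega), b3⟩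

theorem Emits.congr {s t s' t' : Store} {L : List ℕ} (h : Emits s s' L) (h1 : t 1 = s 1)
    (h5 : t 5 = s 5) (h1' : t' 1 = s' 1) (h5' : t' 5 = s' 5) : Emits t t' L := by
  unfold Emits
  rw [h1, h5, h1', h5']
  exact h

theorem Emits.refl (s : Store) : Emits s s [] := ⟨rfl, fun _ _ => rfl, trivial⟩

/-- Overwriting an output cell. -/
theorem Emits.patch {s s₁ s₂ : Store} {A B : List ℕ} {x : ℕ} (h : Emits s s₁ A)
    (h' : Emits s₁ s₂ (x :: B)) (y : ℕ) : Emits s (upd s₂ 1 (s₁ 5 0) y) (A ++ y :: B) := by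
  obtain ⟨a1, a2, a3⟩ := h
  obtain ⟨b1, b2, b3, b4⟩ := h'
  unfold Emits
  rw [upd_of_ne _ _ _ (by decide), upd_array]
  refine ⟨?_, fun j hj => ?_, ?_⟩
  · rw [b1, a1]; simp only [List.length_append, List.length_cons]; omega
  · rw [Function.update_of_ne (by omega), b2 j (by omega), a2 j hj]
  · rw [Seg_append, ← a1]
    refine ⟨a3.congr fun j _ hj => ?_, Function.update_self .., b4.congr fun j hj _ => ?_⟩
    · rw [Function.update_of_ne (by omega), b2 j (by omega)]
    · rw [Function.update_of_ne (by omega)]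

/-- The expression does not mention the output. -/
def Expr.safe : Expr → Bool
  | .lit _ => true
  | .get a i => a != 1 && a != 5 && i.safe
  | .succ e | .pred e => e.safe

theorem Expr.eval_congr {e : Expr} (he : e.safe) {s s' : Store} (h : Fr [1, 5] s s') :
    e.eval s' = e.eval s := by
  induction e with
  | lit n => rfl
  | get a i ih =>
    simp only [Expr.safe, Bool.and_eq_true, bne_iff_ne, ne_eq] at he
    simp only [Expr.eval, ih he.2]
    rw [h a (by simp [he.1])]
  | succ e ih => simp only [Expr.eval, ih he]
  | pred e ih => simp only [Expr.eval, ih he]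

/-- Appending the values of expressions to the output. -/
def emits : List Expr → Cmd
  | [] => .skip
  | e :: es => .seq (.set 1 (v 5) e) (.seq (incr 5) (emits es))

/-- Number of steps of `emits`. -/
def ecost : List Expr → ℕ
  | [] => 1
  | e :: es => e.cost + 10 + ecost es

/-- The expressions do not read the output or its end pointer, so all of them may be evaluated in
the initial store. -/
theorem W.emits {es : List Expr} (hes : es.all Expr.safe = true) {s : Store}
    {Q : Store → ℕ → Prop}
    (h : ∀ s', Emits s s' (es.map (Expr.eval s)) → Fr [1, 5] s s' → Q s' (ecost es)) :
    W p (emits es) s Q := by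
  induction es generalizing s Q with
  | nil => exact W.skip (h s (Emits.refl s) (Fr.refl _ _))
  | cons e es ih =>
    simp only [List.all_cons, Bool.and_eq_true] at hes
    refine W.seq (W.set (W.seq (W.incr (ih hes.2 fun s' h1 h2 => ?_))))
    set s₁ := upd (upd s 1 ((v 5).eval s) (e.eval s)) 5 0
      (upd s 1 ((v 5).eval s) (e.eval s) 5 0 + 1) with hs₁
    have hf : Fr [1, 5] s s₁ := ((Fr.refl _ s).upd _ _ (by simp)).upd _ _ (by simp)
    have hE : Emits s s₁ [e.eval s] := by
      have h5 : s₁ 5 0 = s 5 0 + 1 := by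
        rw [hs₁, upd_same, upd_of_ne _ _ _ (by decide)]
      have h1 : s₁ 1 = Function.update (s 1) (s 5 0) (e.eval s) := by
        rw [hs₁, upd_of_ne _ _ _ (by decide), upd_array]; rfl
      refine ⟨h5, fun j hj => ?_, ?_, trivial⟩
      · rw [h1, Function.update_of_ne (by omega)]
      · rw [h1, Function.update_self]
    have := h s' (by
      have h3 := hE.trans h1
      rwa [List.map_congr_left (g := Expr.eval s) fun e' he' =>
        Expr.eval_congr (List.all_eq_true.1 hes.2 e' he') hf] at h3)
      (hf.trans h2 (by simp) (by simp))
    convert this using 1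
    simp only [ecost, v_cost]
    omega

/-- A loop that writes a word in each round and advances a pointer. -/
theorem W.emitLoop {b : Test} {es : List Expr} {ptr : ℕ} (h1 : ptr ≠ 1) (h5 : ptr ≠ 5)
    (hes : es.all Expr.safe = true) {s : Store} (Ls : List (List ℕ))
    (hstep : ∀ j (h : j < Ls.length) s', Fr [1, 5, ptr] s s' → s' ptr 0 = s ptr 0 + j →
      b.Holds s' ∧ es.map (Expr.eval s') = Ls[j])
    (hend : ∀ s', Fr [1, 5, ptr] s s' → s' ptr 0 = s ptr 0 + Ls.length → ¬ b.Holds s')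
    {Q : Store → ℕ → Prop}
    (hQ : ∀ s' t, Emits s s' Ls.flatten → Fr [1, 5, ptr] s s' → s' ptr 0 = s ptr 0 + Ls.length →
      t ≤ (Ls.length + 1) * (b.cost + ecost es + 7) → Q s' t) :
    W p (.loop b (.seq (RAM.emits es) (RAM.incr ptr))) s Q := by
  refine (W.loop (fun j s' => Emits s s' (Ls.take j).flatten ∧ Fr [1, 5, ptr] s s' ∧
    s' ptr 0 = s ptr 0 + j) Ls.length (ecost es + 6) ⟨Emits.refl s, Fr.refl _ _, rfl⟩ ?_ ?_).mono ?_
  · rintro j s' hj ⟨hE, hF, hp⟩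
    obtain ⟨hb, he⟩ := hstep j hj s' hF hp
    refine ⟨hb, W.seq (W.emits hes fun s₁ e1 f1 => W.incr ⟨⟨?_, ?_, ?_⟩, by omega⟩)⟩
    · rw [List.take_succ_eq_append_getElem hj, List.flatten_append]
      simp only [List.flatten_cons, List.flatten_nil, List.append_nil]
      have h3 := hE.trans (he ▸ e1)
      exact h3.congr rfl rfl (upd_of_ne _ _ _ h1.symm) (upd_of_ne _ _ _ h5.symm)
    · exact (hF.trans f1 (C := [1, 5, ptr]) (by simp) (by simp)).upd _ _ (by simp)
    · rw [upd_same, f1 ptr (by simp [h1, h5]), hp]; omega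
  · rintro s' ⟨-, hF, hp⟩
    exact hend s' hF hp
  · rintro s' t ⟨⟨hE, hF, hp⟩, ht⟩
    rw [List.take_length] at hE
    refine hQ s' t hE hF hp (ht.trans ?_)
    rw [Nat.succ_mul]
    have : 1 + b.cost + (ecost es + 6) = b.cost + ecost es + 7 := by omega
    rw [this]
    omega

end RAM

/-! ### Binary codes -/

theorem codeNat_zero : codeNat 0 = [2] := rfl

theorem codeNat_two_mul {m : ℕ} (hm : m ≠ 0) : codeNat (2 * m) = 0 :: codeNat m := by
  simp [codeNat, Nat.bit0_bits m hm]

theorem codeNat_two_mul_add_one (m : ℕ) : codeNat (2 * m + 1) = 1 :: codeNat m := by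
  simp [codeNat, Nat.bit1_bits]

theorem codeNat_length (n : ℕ) : (codeNat n).length = n.size + 1 := by
  simp [codeNat, Nat.size_eq_bits_len]

/-- This is the carry: adding one turns the `k` trailing ones into zeros and the next zero into a
one. Writing the rest of `n` as `2 * m` covers `m = 0` too, where that next zero is not a digit of
the code. -/
theorem codeNat_succ (n : ℕ) : ∃ k m, codeNat (n + 1) = List.replicate k 0 ++ 1 :: codeNat m ∧
    codeNat n = List.replicate k 1 ++ codeNat (2 * m) := by
  induction n using Nat.strong_induction_on with
  | _ n ih =>
    rcases Nat.even_or_odd' n with ⟨m, rfl | rfl⟩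
    · exact ⟨0, m, by simp [codeNat_two_mul_add_one], by simp⟩
    · obtain ⟨k, j, h1, h2⟩ := ih m (by omega)
      refine ⟨k + 1, j, ?_, ?_⟩
      · rw [show 2 * m + 1 + 1 = 2 * (m + 1) by ring, codeNat_two_mul (by omega), h1]
        rfl
      · rw [codeNat_two_mul_add_one, h2]
        rfl

theorem Seg_codeNat {f : ℕ → ℕ} {o n : ℕ} : Seg f o (codeNat n) ↔
    (∀ j < n.size, f (o + j) = (n.testBit j).toNat) ∧ f (o + n.size) = 2 := by
  induction n using Nat.strong_induction_on generalizing o with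
  | _ n ih =>
    rcases Nat.even_or_odd' n with ⟨m, rfl | rfl⟩
    · rcases Nat.eq_zero_or_pos m with rfl | hm
      · simp [codeNat_zero, Seg]
      · have hs : (2 * m).size = m.size + 1 := by
          have := codeNat_length (2 * m)
          rw [codeNat_two_mul hm.ne', List.length_cons, codeNat_length] at this
          omega
        rw [codeNat_two_mul hm.ne', Seg, ih m (by omega), hs]
        constructor
        · rintro ⟨h0, h1, h2⟩
          refine ⟨fun j hj => ?_, by rw [← h2]; congr 1; omega⟩
          cases j with
          | zero => simp [h0]
          | succ j =>
            rw [show o + (j + 1) = o + 1 + j by omega, h1 j (by omega), Nat.testBit_succ]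
            simp
        · rintro ⟨h1, h2⟩
          refine ⟨by simpa using h1 0 (by omega), fun j hj => ?_, by rw [← h2]; congr 1; omega⟩
          have := h1 (j + 1) (by omega)
          rw [show o + (j + 1) = o + 1 + j by omega, Nat.testBit_succ] at this
          simpa using this
    · have hs : (2 * m + 1).size = m.size + 1 := by
        have := codeNat_length (2 * m + 1)
        rw [codeNat_two_mul_add_one, List.length_cons, codeNat_length] at this
        omega
      have hd : (2 * m + 1) / 2 = m := by omega
      rw [codeNat_two_mul_add_one, Seg, ih m (by omega), hs]
      constructor
      · rintro ⟨h0, h1, h2⟩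
        refine ⟨fun j hj => ?_, by rw [← h2]; congr 1; omega⟩
        cases j with
        | zero => simp [h0]
        | succ j =>
          rw [show o + (j + 1) = o + 1 + j by omega, h1 j (by omega), Nat.testBit_succ, hd]
      · rintro ⟨h1, h2⟩
        refine ⟨by simpa using h1 0 (by omega), fun j hj => ?_, by rw [← h2]; congr 1; omega⟩
        have := h1 (j + 1) (by omega)
        rwa [show o + (j + 1) = o + 1 + j by omega, Nat.testBit_succ, hd] at this

end FullGraded

/-! ### Copying, incrementing, decrementing and comparing binary numbers in linear time. -/

namespace FullGraded

namespace RAM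

/-! ### Binary numbers on the machine -/

variable {p : Program}

/-- Copying the binary number at the pointer `ptr` into the array `src` to the output. -/
def copyNat (src ptr : ℕ) : Cmd :=
  .seq (.loop (.lt (.get src (v ptr)) (.lit 2)) (.seq (emits [.get src (v ptr)]) (incr ptr)))
    (emits [.lit 2])

/-- Writing `n` to the output if `n + 1` is given. -/
def decNat (src ptr : ℕ) : Cmd :=
  .seq (.loop (.eq (.get src (v ptr)) (.lit 0)) (.seq (emits [.lit 1]) (incr ptr)))
    -- The leading one of a power of two disappears: the `0` that replaces it is written only if
    -- more digits follow.
    (.seq (incr ptr) (.seq (.ite (.lt (.get src (v ptr)) (.lit 2)) (emits [.lit 0]) .skip)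
      (copyNat src ptr)))

/-- Writing `n + 1` to the output if `n` is given. -/
def incNat (src ptr : ℕ) : Cmd :=
  .seq (.loop (.eq (.get src (v ptr)) (.lit 1)) (.seq (emits [.lit 0]) (incr ptr)))
    -- If all digits were ones, the pointer is already at the end marker and there is no zero to
    -- skip.
    (.seq (emits [.lit 1]) (.seq (.ite (.eq (.get src (v ptr)) (.lit 0)) (incr ptr) .skip)
      (copyNat src ptr)))

theorem copyNat_spec {src ptr n : ℕ} (h1 : src ≠ 1) (h5 : src ≠ 5) (h2 : src ≠ ptr) (p1 : ptr ≠ 1)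
    (p5 : ptr ≠ 5) {s : Store} (hs : Seg (s src) (s ptr 0) (codeNat n)) {Q : Store → ℕ → Prop}
    (hQ : ∀ s' t, Emits s s' (codeNat n) → Fr [1, 5, ptr] s s' → s' ptr 0 = s ptr 0 + n.size →
      t ≤ 40 * (n.size + 1) → Q s' t) : W p (copyNat src ptr) s Q := by
  set L := (Nat.bits n).map Bool.toNat with hL
  have hlen : L.length = n.size := by simp [hL, Nat.size_eq_bits_len]
  have hlt : ∀ x ∈ L, x < 2 := by
    intro x hx
    obtain ⟨b, -, rfl⟩ := List.mem_map.1 hx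
    exact Bool.toNat_lt b
  have hc : codeNat n = L ++ [2] := rfl
  rw [hc] at hs
  obtain ⟨hs1, hs2, -⟩ := (Seg_append _ _ _).1 hs
  rw [Seg_iff] at hs1
  refine W.seq (W.emitLoop p1 p5 (by simp [Expr.safe, h1, h5, v, p1, p5]) (L.map fun x => [x])
    ?_ ?_ ?_)
  · intro j hj s' hF hp
    have hj' : j < L.length := by simpa using hj
    have := hs1 j hj'
    have hsrc : s' src = s src := hF src (by simp [h1, h5, h2])
    simp only [Test.Holds, Expr.eval, v_eval, hp, hsrc, this, List.map_cons, List.map_nil,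
      List.getElem_map, and_true]
    exact hlt _ (List.getElem_mem _)
  · intro s' hF hp
    have hsrc : s' src = s src := hF src (by simp [h1, h5, h2])
    rw [List.length_map] at hp
    simp [Test.Holds, Expr.eval, hp, hsrc, hs2]
  · intro s' t hE hF hp ht
    refine W.emits (by decide) fun s'' e2 f2 => hQ s'' _ ?_ ?_ ?_ ?_
    · rw [hc]
      have : (L.map fun x => [x]).flatten = L := by
        rw [← List.flatMap_def]; simp
      rw [this] at hE
      exact hE.trans e2
    · exact hF.trans f2 (by simp) (by simp)
    · rw [f2 ptr (by simp [p1, p5]), hp, List.length_map, hlen]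
    · simp only [List.length_map, hlen, Test.cost, Expr.cost, v_cost, ecost] at ht ⊢
      omega

theorem decNat_spec {src ptr n : ℕ} (h1 : src ≠ 1) (h5 : src ≠ 5) (h2 : src ≠ ptr) (p1 : ptr ≠ 1)
    (p5 : ptr ≠ 5) {s : Store} (hs : Seg (s src) (s ptr 0) (codeNat (n + 1))) {Q : Store → ℕ → Prop}
    (hQ : ∀ s' t, Emits s s' (codeNat n) → Fr [1, 5, ptr] s s' →
      t ≤ 100 * ((n + 1).size + 1) → Q s' t) : W p (decNat src ptr) s Q := by
  obtain ⟨k, m, c1, c2⟩ := codeNat_succ n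
  have hsize : (n + 1).size = k + 1 + m.size := by
    have := congrArg List.length c1
    simp only [codeNat_length, List.length_append, List.length_replicate, List.length_cons] at this
    omega
  rw [c1] at hs
  obtain ⟨hs1, hs2, hs3⟩ := (Seg_append _ _ _).1 hs
  rw [List.length_replicate] at hs2 hs3
  rw [Seg_iff] at hs1
  refine W.seq (W.emitLoop p1 p5 (by decide) (List.replicate k [1]) ?_ ?_ ?_)
  · intro j hj s' hF hp
    have hj' : j < k := by simpa using hj
    have := hs1 j (by simpa using hj')
    have hsrc : s' src = s src := hF src (by simp [h1, h5, h2])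
    simp [Test.Holds, Expr.eval, hp, hsrc, this]
  · intro s' hF hp
    have hsrc : s' src = s src := hF src (by simp [h1, h5, h2])
    rw [List.length_replicate] at hp
    simp [Test.Holds, Expr.eval, hp, hsrc, hs2]
  · intro s₁ t₁ e1 f1 q1 ht
    rw [List.length_replicate] at q1
    refine W.seq (W.incr (W.seq ?_))
    set s₂ := upd s₁ ptr 0 (s₁ ptr 0 + 1) with hs₂
    have f2 : Fr [1, 5, ptr] s s₂ := f1.upd _ _ (by simp)
    have q2 : s₂ ptr 0 = s ptr 0 + k + 1 := by rw [hs₂, upd_same, q1]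
    have e2 : Emits s s₂ (List.replicate k 1) := by
      have := e1.congr rfl rfl (t' := s₂) (upd_of_ne _ _ _ p1.symm) (upd_of_ne _ _ _ p5.symm)
      simpa using this
    have src2 : s₂ src = s src := f2 src (by simp [h1, h5, h2])
    simp only [List.length_replicate, Test.cost, Expr.cost, v_cost, ecost] at ht
    rcases Nat.eq_zero_or_pos m with rfl | hm
    · refine W.ite_false (by
        simp only [Test.Holds, Expr.eval, v_eval, src2, q2]
        rw [codeNat_zero] at hs3
        rw [hs3.1]; decide) (W.skip ?_)
      refine copyNat_spec (n := 0) h1 h5 h2 p1 p5 (by rw [src2, q2]; exact hs3)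
        fun s' t e3 f3 _ ht' => hQ s' _ ?_ (f2.trans f3 (by simp) (by simp)) ?_
      · rw [c2]; exact e2.trans e3
      · simp only [Test.cost, Expr.cost, v_cost]
        simp only [Nat.size_zero] at ht' hsize
        omega
    · refine W.ite_true (by
        simp only [Test.Holds, Expr.eval, v_eval, src2, q2]
        obtain ⟨j, hj⟩ := Nat.even_or_odd' m
        rcases hj with hj | hj
        · rw [hj, codeNat_two_mul (by omega)] at hs3
          rw [hs3.1]; decide
        · rw [hj, codeNat_two_mul_add_one] at hs3
          rw [hs3.1]; decide) (W.emits (by decide) fun s₃ e3 f3 => ?_)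
      have f3' : Fr [1, 5, ptr] s s₃ := f2.trans f3 (by simp) (by simp)
      refine copyNat_spec (n := m) h1 h5 h2 p1 p5 (by
        rw [f3' src (by simp [h1, h5, h2]), f3 ptr (by simp [p1, p5]), q2]; exact hs3)
        fun s' t e4 f4 _ ht' => hQ s' _ ?_ (f3'.trans f4 (by simp) (by simp)) ?_
      · rw [c2, codeNat_two_mul hm.ne']
        exact (e2.trans (e3.trans e4))
      · simp only [Test.cost, Expr.cost, v_cost, ecost]
        omega

theorem incNat_spec {src ptr n : ℕ} (h1 : src ≠ 1) (h5 : src ≠ 5) (h2 : src ≠ ptr) (p1 : ptr ≠ 1)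
    (p5 : ptr ≠ 5) {s : Store} (hs : Seg (s src) (s ptr 0) (codeNat n)) {Q : Store → ℕ → Prop}
    (hQ : ∀ s' t, Emits s s' (codeNat (n + 1)) → Fr [1, 5, ptr] s s' →
      t ≤ 100 * (n.size + 2) → Q s' t) : W p (incNat src ptr) s Q := by
  obtain ⟨k, m, c1, c2⟩ := codeNat_succ n
  rw [c2] at hs
  obtain ⟨hs1, hs2⟩ := (Seg_append _ _ _).1 hs
  rw [List.length_replicate] at hs2
  rw [Seg_iff] at hs1
  refine W.seq (W.emitLoop p1 p5 (by decide) (List.replicate k [0]) ?_ ?_ ?_)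
  · intro j hj s' hF hp
    have hj' : j < k := by simpa using hj
    have := hs1 j (by simpa using hj')
    have hsrc : s' src = s src := hF src (by simp [h1, h5, h2])
    simp [Test.Holds, Expr.eval, hp, hsrc, this]
  · intro s' hF hp
    have hsrc : s' src = s src := hF src (by simp [h1, h5, h2])
    rw [List.length_replicate] at hp
    simp only [Test.Holds, Expr.eval, v_eval, hp, hsrc]
    rcases Nat.eq_zero_or_pos m with rfl | hm
    · rw [Nat.mul_zero, codeNat_zero] at hs2
      rw [hs2.1]; decide
    · rw [codeNat_two_mul hm.ne'] at hs2
      rw [hs2.1]; decide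
  · intro s₁ t₁ e1 f1 q1 ht
    rw [List.length_replicate] at q1
    refine W.seq (W.emits (by decide) fun s₂ e2' f2' => W.seq ?_)
    have f2 : Fr [1, 5, ptr] s s₂ := f1.trans f2' (by simp) (by simp)
    have q2 : s₂ ptr 0 = s ptr 0 + k := by rw [f2' ptr (by simp [p1, p5]), q1]
    have e2 : Emits s s₂ (List.replicate k 0 ++ [1]) := by
      have := e1.trans e2'
      simpa [Expr.eval] using this
    have src2 : s₂ src = s src := f2 src (by simp [h1, h5, h2])
    simp only [List.length_replicate, Test.cost, Expr.cost, v_cost, ecost] at ht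
    have hlen := congrArg List.length c2
    simp only [codeNat_length, List.length_append, List.length_replicate] at hlen
    rcases Nat.eq_zero_or_pos m with rfl | hm
    · rw [Nat.mul_zero] at hs2
      refine W.ite_false (by
        simp only [Test.Holds, Expr.eval, v_eval, src2, q2]
        rw [codeNat_zero] at hs2
        rw [hs2.1]; decide) (W.skip ?_)
      refine copyNat_spec (n := 0) h1 h5 h2 p1 p5 (by rw [src2, q2]; exact hs2)
        fun s' t e3 f3 _ ht' => hQ s' _ ?_ (f2.trans f3 (by simp) (by simp)) ?_
      · rw [c1]
        have := e2.trans e3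
        simpa using this
      · simp only [Test.cost, Expr.cost, v_cost, ecost]
        simp only [Nat.mul_zero, Nat.size_zero] at ht' hlen
        omega
    · have hsz : (2 * m).size = m.size + 1 := by
        have := codeNat_length (2 * m)
        rw [codeNat_two_mul hm.ne', List.length_cons, codeNat_length] at this
        omega
      rw [codeNat_two_mul hm.ne'] at hs2
      refine W.ite_true (by
        simp only [Test.Holds, Expr.eval, v_eval, src2, q2]
        rw [hs2.1]) (W.incr ?_)
      have f3 : Fr [1, 5, ptr] s (upd s₂ ptr 0 (s₂ ptr 0 + 1)) := f2.upd _ _ (by simp)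
      refine copyNat_spec (n := m) h1 h5 h2 p1 p5 (by
        rw [f3 src (by simp [h1, h5, h2]), upd_same, q2]; exact hs2.2)
        fun s' t e4 f4 _ ht' => hQ s' _ ?_ (f3.trans f4 (by simp) (by simp)) ?_
      · rw [c1]
        have := (e2.congr rfl rfl (upd_of_ne _ 0 (s₂ ptr 0 + 1) p1.symm)
          (upd_of_ne _ _ _ p5.symm)).trans e4
        simpa using this
      · simp only [Test.cost, Expr.cost, v_cost, ecost]
        omega

/-! ### Maximum of binary numbers -/

/-- Array `13` contains the bits of `M`, and the variable `14` their number. -/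
def GradeInv (s : Store) (M : ℕ) : Prop := (∀ j, s 13 j = (M.testBit j).toNat) ∧ s 14 0 = M.size

/-- Replacing the number in array `13` by its maximum with the number at the input pointer. -/
def gradeMax : Cmd :=
  .seq (setv 16 (.lit 0)) (.seq (setv 17 (v 2)) (.seq (setv 15 (.lit 0))
  (.seq (.loop (.lt (.get 0 (v 17)) (.lit 2))
    (.seq (.ite (.lt (.get 13 (v 16)) (.get 0 (v 17))) (setv 15 (.lit 1))
      (.ite (.lt (.get 0 (v 17)) (.get 13 (v 16))) (setv 15 (.lit 0)) .skip))
    (.seq (incr 16) (incr 17))))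
  -- The comparison saw only as many digits of the stored number as the new number has. A stored
  -- number with more digits is larger in any case.
  (.seq (.ite (.eq (v 15) (.lit 1)) (.ite (.lt (v 16) (v 14)) .skip
    (.seq (setv 16 (.lit 0)) (.seq (setv 17 (v 2))
      (.seq (.loop (.lt (.get 0 (v 17)) (.lit 2))
        (.seq (.set 13 (v 16) (.get 0 (v 17))) (.seq (incr 16) (incr 17))))
      (setv 14 (v 16)))))) .skip)
  (setv 2 (.succ (v 17)))))))

/-- Digits arrive with the least significant first, so the latest differing digit overrules all
earlier ones. -/
theorem mod_lt_mod_succ_iff (M n i : ℕ) : (M % 2 ^ (i + 1) < n % 2 ^ (i + 1)) ↔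
    ((M.testBit i).toNat < (n.testBit i).toNat ∨
      ((M.testBit i).toNat = (n.testBit i).toNat ∧ M % 2 ^ i < n % 2 ^ i)) := by
  rw [Nat.mod_pow_succ, Nat.mod_pow_succ, ← Nat.toNat_testBit, ← Nat.toNat_testBit]
  have h1 := Nat.mod_lt M (Nat.two_pow_pos i)
  have h2 := Nat.mod_lt n (Nat.two_pow_pos i)
  cases M.testBit i <;> cases n.testBit i <;> simp <;> omega

theorem compare_spec {n M : ℕ} {s : Store} {o : ℕ} (hs : Seg (s 0) o (codeNat n))
    (hM : GradeInv s M) (h15 : s 15 0 = 0) (h16 : s 16 0 = 0) (h17 : s 17 0 = o) :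
    W p (.loop (.lt (.get 0 (v 17)) (.lit 2))
      (.seq (.ite (.lt (.get 13 (v 16)) (.get 0 (v 17))) (setv 15 (.lit 1))
        (.ite (.lt (.get 0 (v 17)) (.get 13 (v 16))) (setv 15 (.lit 0)) .skip))
      (.seq (incr 16) (incr 17)))) s fun s' t =>
      (Fr [15, 16, 17] s s' ∧ s' 16 0 = n.size ∧ s' 17 0 = o + n.size ∧
        (s' 15 0 = 1 ↔ M % 2 ^ n.size < n % 2 ^ n.size)) ∧ t ≤ 60 * (n.size + 1) := by
  obtain ⟨hs1, hs2⟩ := Seg_codeNat.1 hs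
  refine (W.loop (fun i s' => Fr [15, 16, 17] s s' ∧ s' 16 0 = i ∧ s' 17 0 = o + i ∧
    (s' 15 0 = 1 ↔ M % 2 ^ i < n % 2 ^ i)) n.size 40
    ⟨Fr.refl _ _, h16, h17, by simp [h15, Nat.mod_one]⟩ ?_ ?_).mono ?_
  · rintro i s' hi ⟨hF, h16, h17, h15⟩
    have a0 : s' 0 (s' 17 0) = (n.testBit i).toNat := by
      rw [hF 0 (by decide), h17, hs1 i hi]
    have a13 : s' 13 (s' 16 0) = (M.testBit i).toNat := by
      rw [hF 13 (by decide), h16, hM.1]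
    refine ⟨?_, W.seq ?_⟩
    · simp only [Test.Holds, Expr.eval, v_eval, a0]
      exact Bool.toNat_lt _
    -- The three outcomes of the digit comparison share this tail, with `x` the resulting flag.
    · have fin : ∀ x t, t ≤ 25 → (x = 1 ↔ M % 2 ^ (i + 1) < n % 2 ^ (i + 1)) →
          ∀ s'', Fr [15] s' s'' → s'' 15 0 = x →
          W p (.seq (incr 16) (incr 17)) s'' fun s''' t' => (Fr [15, 16, 17] s s''' ∧
            s''' 16 0 = i + 1 ∧ s''' 17 0 = o + (i + 1) ∧
            (s''' 15 0 = 1 ↔ M % 2 ^ (i + 1) < n % 2 ^ (i + 1))) ∧ 1 + t + t' ≤ 40 := by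
        intro x t ht hx s'' hF' h15'
        refine W.seq (W.incr (W.incr ⟨⟨?_, ?_, ?_, ?_⟩, ?_⟩))
        · exact ((hF.trans hF' (by simp) (by simp)).upd _ _ (by simp)).upd _ _ (by simp)
        · rw [upd_of_ne _ _ _ (by decide), upd_same, hF' 16 (by decide), h16]
        · rw [upd_same, upd_of_ne _ _ _ (by decide), hF' 17 (by decide), h17]; omega
        · rw [upd_of_ne _ _ _ (by decide), upd_of_ne _ _ _ (by decide), h15', hx]
        · omega
      by_cases c1 : (M.testBit i).toNat < (n.testBit i).toNat
      · refine W.ite_true ?_ (W.setv (fin 1 _ ?_ ?_ _ ((Fr.refl _ _).upd _ _ ?_) (upd_same ..)))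
        · simpa only [Test.Holds, Expr.eval, v_eval, a0, a13] using c1
        · simp [Test.cost, Expr.cost]
        · simp [mod_lt_mod_succ_iff, c1]
        · simp
      · refine W.ite_false ?_ ?_
        · simpa only [Test.Holds, Expr.eval, v_eval, a0, a13] using c1
        · by_cases c2 : (n.testBit i).toNat < (M.testBit i).toNat
          · refine W.ite_true ?_ (W.setv (fin 0 _ ?_ ?_ _ ((Fr.refl _ _).upd _ _ ?_) (upd_same ..)))
            · simpa only [Test.Holds, Expr.eval, v_eval, a0, a13] using c2
            · simp [Test.cost, Expr.cost]
            · have : (M.testBit i).toNat ≠ (n.testBit i).toNat := by omega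
              simp [mod_lt_mod_succ_iff, c1, this]
            · simp
          · refine W.ite_false ?_ (W.skip (fin (s' 15 0) _ ?_ ?_ _ (Fr.refl _ _) rfl))
            · simpa only [Test.Holds, Expr.eval, v_eval, a0, a13] using c2
            · simp [Test.cost, Expr.cost]
            · have : (M.testBit i).toNat = (n.testBit i).toNat := by omega
              simp [mod_lt_mod_succ_iff, this, h15]
  · rintro s' ⟨hF, -, h17, -⟩
    simp only [Test.Holds, Expr.eval, v_eval, h17, hF 0 (by decide), hs2]
    decide
  · rintro s' t ⟨h, ht⟩
    refine ⟨h, ht.trans ?_⟩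
    simp only [Test.cost, Expr.cost, v_cost]
    omega

/-- Cells beyond the digits of `n` keep the digits of `M`. These are zero because `M` has no more
digits than `n`, so nothing has to be cleared. -/
theorem copyGrade_spec {n M : ℕ} {s : Store} {o : ℕ} (hs : Seg (s 0) o (codeNat n))
    (hM : GradeInv s M) (hle : M.size ≤ n.size) (h16 : s 16 0 = 0) (h17 : s 17 0 = o) :
    W p (.seq (.loop (.lt (.get 0 (v 17)) (.lit 2))
        (.seq (.set 13 (v 16) (.get 0 (v 17))) (.seq (incr 16) (incr 17))))
      (setv 14 (v 16))) s fun s' t =>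
      (Fr [13, 14, 16, 17] s s' ∧ s' 17 0 = o + n.size ∧ GradeInv s' n) ∧ t ≤ 60 * (n.size + 1) := by
  obtain ⟨hs1, hs2⟩ := Seg_codeNat.1 hs
  refine W.seq ((W.loop (fun i s' => Fr [13, 16, 17] s s' ∧ s' 16 0 = i ∧ s' 17 0 = o + i ∧
    ∀ j, s' 13 j = if j < i then (n.testBit j).toNat else (M.testBit j).toNat) n.size 40
    ⟨Fr.refl _ _, h16, h17, by simp [hM.1]⟩ ?_ ?_).mono ?_)
  · rintro i s' hi ⟨hF, h16, h17, h13⟩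
    have a0 : s' 0 (s' 17 0) = (n.testBit i).toNat := by
      rw [hF 0 (by decide), h17, hs1 i hi]
    refine ⟨?_, W.seq (W.set (W.seq (W.incr (W.incr ⟨⟨?_, ?_, ?_, ?_⟩, ?_⟩))))⟩
    · simp only [Test.Holds, Expr.eval, v_eval, a0]
      exact Bool.toNat_lt _
    · exact ((hF.upd _ _ (by simp)).upd _ _ (by simp)).upd _ _ (by simp)
    · simp only [upd_of_ne, upd_same, ne_eq, Nat.reduceEqDiff, not_false_eq_true, h16]
    · simp only [upd_of_ne, upd_same, ne_eq, Nat.reduceEqDiff, not_false_eq_true, h17]; omega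
    · intro j
      simp only [upd_of_ne, ne_eq, Nat.reduceEqDiff, not_false_eq_true, upd_array, Expr.eval, v_eval,
        a0, h16, Function.update_apply, h13]
      split_ifs <;> first | rfl | omega | (congr; done) | (subst_vars; rfl)
    · simp [Expr.cost]
  · rintro s' ⟨hF, -, h17, -⟩
    simp only [Test.Holds, Expr.eval, v_eval, h17, hF 0 (by decide), hs2]
    decide
  · rintro s' t ⟨⟨hF, h16, h17, h13⟩, ht⟩
    refine W.setv ⟨⟨?_, ?_, ?_, ?_⟩, ?_⟩
    · exact (hF.mono (by simp)).upd _ _ (by simp)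
    · rw [upd_of_ne _ _ _ (by decide), h17]
    · intro j
      rw [upd_of_ne _ _ _ (by decide), h13]
      split_ifs with hj
      · rfl
      · rw [Nat.testBit_lt_two_pow (lt_of_lt_of_le (Nat.lt_size_self M)
          (Nat.pow_le_pow_right (by decide) (by omega))),
          Nat.testBit_lt_two_pow (lt_of_lt_of_le (Nat.lt_size_self n)
          (Nat.pow_le_pow_right (by decide) (by omega)))]
    · rw [upd_same, v_eval, h16]
    · simp only [Test.cost, Expr.cost, v_cost] at ht ⊢
      omega

/-- Only digits of the new grade are visited, never those of a longer stored maximum. The cost is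
thus charged to the grade just read, and all maxima together take linear time. -/
theorem gradeMax_spec {n M : ℕ} {s : Store} (hs : Seg (s 0) (s 2 0) (codeNat n))
    (hM : GradeInv s M) {Q : Store → ℕ → Prop}
    (hQ : ∀ s' t, GradeInv s' (max M n) → Fr [2, 13, 14, 15, 16, 17] s s' →
      s' 2 0 = s 2 0 + n.size + 1 → t ≤ 200 * (n.size + 1) → Q s' t) : W p gradeMax s Q := by
  have hn := Nat.lt_size_self n
  have hMs := Nat.lt_size_self M
  refine W.seq (W.setv (W.seq (W.setv (W.seq (W.setv (W.seq ?_))))))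
  refine (compare_spec (n := n) (M := M) (o := s 2 0) ?_ ?_ ?_ ?_ ?_).mono ?_
  · simpa only [upd_of_ne, ne_eq, Nat.reduceEqDiff, not_false_eq_true, OfNat.zero_ne_ofNat] using hs
  · simpa only [GradeInv, upd_of_ne, ne_eq, Nat.reduceEqDiff, not_false_eq_true] using hM
  · simp [Expr.eval]
  · simp [upd_of_ne, Expr.eval]
  · simp [upd_of_ne, Expr.eval]
  rintro s₁ t₁ ⟨⟨f1, h16, h17, h15⟩, ht₁⟩
  have f1' : Fr [15, 16, 17] s s₁ :=
    ((((Fr.refl _ s).upd _ _ (by simp)).upd _ _ (by simp)).upd _ _ (by simp)).trans f1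
      (List.Subset.refl _) (List.Subset.refl _)
  have hM1 : GradeInv s₁ M := by
    unfold GradeInv
    rw [f1' 13 (by decide), f1' 14 (by decide)]; exact hM
  rw [Nat.mod_eq_of_lt hn] at h15
  refine W.seq ?_
  have fin : ∀ s₂ t, GradeInv s₂ (max M n) → Fr [13, 14, 15, 16, 17] s s₂ →
      s₂ 17 0 = s 2 0 + n.size → t ≤ 60 * (n.size + 1) + 40 → W p (setv 2 (.succ (v 17))) s₂ fun s' t' =>
        Q s' (1 + (2 + (Expr.lit 0).cost) + (1 + (2 + (v 2).cost) +
          (1 + (2 + (Expr.lit 0).cost) + (1 + t₁ + (1 + t + t'))))) := by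
    intro s₂ t hG hF h17 ht
    refine W.setv (hQ _ _ ?_ ((hF.mono (by simp)).upd _ _ (by simp)) ?_ ?_)
    · unfold GradeInv
      rw [upd_of_ne _ _ _ (by decide), upd_of_ne _ _ _ (by decide)]; exact hG
    · simp [Expr.eval, h17]
    · simp only [Expr.cost, v_cost]; omega
  by_cases c1 : s₁ 15 0 = 1
  · refine W.ite_true (by simpa [Test.Holds, Expr.eval] using c1) ?_
    by_cases c2 : n.size < M.size
    · refine W.ite_true (by simpa [Test.Holds, h16, hM1.2] using c2) (W.skip (fin s₁ _ ?_ (f1'.mono (by simp)) h17 ?_))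
      · have : n < M := lt_of_not_ge fun h => absurd (Nat.size_le_size h) (not_le.2 c2)
        rw [max_eq_left this.le]; exact hM1
      · simp only [Test.cost, Expr.cost, v_cost]
        omega
    · refine W.ite_false (by simpa [Test.Holds, h16, hM1.2] using c2) ?_
      refine W.seq (W.setv (W.seq (W.setv ?_)))
      refine (copyGrade_spec (n := n) (M := M) (o := s 2 0) ?_ ?_ (by omega) ?_ ?_).mono ?_
      · simpa only [upd_of_ne, ne_eq, Nat.reduceEqDiff, not_false_eq_true, OfNat.zero_ne_ofNat,
          f1' 0 (by decide)] using hs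
      · simpa only [GradeInv, upd_of_ne, ne_eq, Nat.reduceEqDiff, not_false_eq_true] using hM1
      · simp [upd_of_ne, Expr.eval]
      · simp [upd_of_ne, f1' 2 (by decide)]
      · rintro s₂ t₂ ⟨⟨f2, h17, hG⟩, ht⟩
        refine fin s₂ _ ?_ ?_ h17 ?_
        · have : M < n := by
            rw [h15, Nat.mod_eq_of_lt (lt_of_lt_of_le hMs (Nat.pow_le_pow_right (by decide)
              (by omega)))] at c1
            exact c1
          rwa [max_eq_right this.le]
        · exact ((f1'.upd _ _ (by simp)).upd _ _ (by simp)).trans f2 (by simp) (by simp)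
        · simp only [Test.cost, Expr.cost, v_cost]
          omega
  · refine W.ite_false (by simpa [Test.Holds, Expr.eval] using c1)
      (W.skip (fin s₁ _ ?_ (f1'.mono (by simp)) h17 ?_))
    · have : n ≤ M := by
        rw [h15, not_lt] at c1
        exact c1.trans (Nat.mod_le _ _)
      rw [max_eq_left this]; exact hM1
    · simp only [Test.cost, Expr.cost, v_cost]
      omega

end RAM

end FullGraded

/-! ### Codes of tables and the first pass: state count, programs, largest grade. -/

namespace FullGraded

/-! ### Codes of tables -/

/-- Code of a direction without bound. -/
def RDir.code : RDir → List ℕ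
  | .up => [0]
  | .stay => [1]
  | .dia n => 2 :: codeNat n
  | .box n => 3 :: codeNat n

variable {m r v : ℕ}

/-- Code of a transition of a table. -/
def codeRaw : PosBool (RAtom (Fin m) (Fin r)) → List ℕ
  | .tt => [0]
  | .ff => [1]
  | .atom (.pos g) => 2 :: codeLetter g
  | .atom (.neg g) => 3 :: codeLetter g
  | .atom (.move d q) => 4 :: (d.code ++ [q])
  | .and θ η => 5 :: (codeRaw θ ++ codeRaw η)
  | .or θ η => 6 :: (codeRaw θ ++ codeRaw η)

/-- Code of a row. -/
def rowCode (row : Row (Fin m) (Fin r)) : List ℕ := row.1 :: codeRaw row.2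

/-- On valid transitions neither the cut-off at the bound nor the default values of `toSym` take
effect, so the typed description has the code of the raw table. -/
theorem codeTrans_toSym {G : Set (Letter (Fin m) (Fin r))} {b N : ℕ}
    {θ : PosBool (RAtom (Fin m) (Fin r))} (h : θ.Valid G b N) :
    codeTrans (toSym G b N θ) = codeRaw θ := by
  induction θ with
  | tt => rfl
  | ff => rfl
  | atom y =>
    cases y with
    | pos g =>
      have hg : g ∈ G := h
      simp [toSym, hg, codeTrans, codeRaw]
    | neg g =>
      have hg : g ∈ G := h
      simp [toSym, hg, codeTrans, codeRaw]
    | move d q =>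
      have hd : d.Valid b := h.1
      have hq : q < N := h.2
      simp only [toSym, hq, dif_pos, codeTrans, codeRaw]
      congr 2
      cases d with
      | up => rfl
      | stay => rfl
      | dia n => simp [RDir.toDir, codeDir, RDir.code, min_eq_left (show n ≤ b from hd)]
      | box n => simp [RDir.toDir, codeDir, RDir.code, min_eq_left (show n ≤ b from hd)]
  | and θ η ih1 ih2 => simp only [toSym, codeTrans, codeRaw, ih1 h.1, ih2 h.2]
  | or θ η ih1 ih2 => simp only [toSym, codeTrans, codeRaw, ih1 h.1, ih2 h.2]

/-- The programs of a formula, appended to a list without repetitions. -/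
def collect (L : List (Fin r)) : Formula (Fin m) (Fin r) (Fin v) → List (Fin r)
  | .tt | .ff | .prop _ | .nprop _ | .var _ => L
  | .or φ ψ | .and φ ψ => collect (collect L φ) ψ
  | .dia _ α φ | .box _ α φ => collect (if α.base ∈ L then L else L ++ [α.base]) φ
  | .mu _ φ | .nu _ φ => collect L φ

theorem mem_collect (ψ : Formula (Fin m) (Fin r) (Fin v)) (L : List (Fin r)) (a : Fin r) :
    a ∈ collect L ψ ↔ a ∈ L ∨ a ∈ ψ.progs := by
  induction ψ generalizing L with
  | or φ ψ ih1 ih2 | and φ ψ ih1 ih2 =>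
    simp only [collect, ih1, ih2, Formula.progs, Set.mem_union]; tauto
  | dia n α φ ih | box n α φ ih =>
    simp only [collect, ih, Formula.progs, Set.mem_insert_iff]
    split_ifs with h
    · constructor
      · tauto
      · rintro (h' | rfl | h')
        · exact Or.inl h'
        · exact Or.inl h
        · exact Or.inr h'
    · simp only [List.mem_append, List.mem_singleton]; tauto
  | mu y φ ih | nu y φ ih => simp only [collect, ih, Formula.progs]
  | _ => simp [collect, Formula.progs]

theorem nodup_collect (ψ : Formula (Fin m) (Fin r) (Fin v)) (L : List (Fin r)) (hL : L.Nodup) :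
    (collect L ψ).Nodup := by
  induction ψ generalizing L with
  | or φ ψ ih1 ih2 | and φ ψ ih1 ih2 => exact ih2 _ (ih1 _ hL)
  | dia n α φ ih | box n α φ ih =>
    refine ih _ ?_
    split_ifs with h
    · exact hL
    · exact List.Nodup.append hL (List.nodup_singleton _) (by simpa using h)
  | mu y φ ih | nu y φ ih => exact ih _ hL
  | _ => exact hL

theorem collect_length_le (ψ : Formula (Fin m) (Fin r) (Fin v)) (L : List (Fin r)) :
    (collect L ψ).length ≤ L.length + ψ.length := by
  induction ψ generalizing L with
  | or φ ψ ih1 ih2 | and φ ψ ih1 ih2 =>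
    have := ih1 L
    have := ih2 (collect L φ)
    simp only [collect, Formula.length]; omega
  | dia n α φ ih | box n α φ ih =>
    refine (ih _).trans ?_
    simp only [Formula.length]
    split_ifs
    · omega
    · simp only [List.length_append, List.length_singleton]; omega
  | mu y φ ih | nu y φ ih =>
    have := ih L
    simp only [collect, Formula.length]; omega
  | _ => simp [collect]

namespace RAM

/-! ### The first pass -/

/-- The symbol at the input pointer. -/
def tok : Expr := .get 0 (RAM.v 2)

/-- Moving the input pointer to `e` and taking the next two states. -/
def advance (e : Expr) : Cmd := .seq (setv 2 e) (setv 3 (.succ (.succ (RAM.v 3))))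

/-- Procedure `1`: reading a formula, counting states, collecting programs and the largest grade. -/
def scanBody : Cmd :=
  .ite (.lt tok (.lit 2)) (advance (.succ (RAM.v 2)))
  (.ite (.lt tok (.lit 5)) (advance (.succ (.succ (RAM.v 2))))
  (.ite (.lt tok (.lit 7)) (.seq (advance (.succ (RAM.v 2))) (.seq (.call 1) (.call 1)))
  (.ite (.lt tok (.lit 9))
    (.seq (setv 24 (.get 0 (.succ (.succ (RAM.v 2)))))
      (.seq (.ite (.eq (.get 10 (RAM.v 24)) (.lit 0))
          (.seq (.set 10 (RAM.v 24) (.lit 1)) (.seq (.set 11 (RAM.v 12) (RAM.v 24)) (incr 12))) .skip)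
        (.seq (advance (.succ (.succ (.succ (RAM.v 2))))) (.seq gradeMax (.call 1)))))
    (.seq (advance (.succ (.succ (RAM.v 2)))) (.call 1)))))

/-- Array `11` lists the programs in `L`, array `10` marks them, and the variable `12` counts them. -/
def ProgInv (s : Store) (L : List (Fin r)) : Prop :=
  s 12 0 = L.length ∧ Seg (s 11) 0 (L.map Fin.val) ∧ ∀ a : Fin r, s 10 a = if a ∈ L then 1 else 0

theorem ProgInv.congr {s s' : Store} {L : List (Fin r)} (h : ProgInv s L) {A : List ℕ}
    (hF : Fr A s s') (hA : 10 ∉ A ∧ 11 ∉ A ∧ 12 ∉ A) : ProgInv s' L := by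
  unfold ProgInv
  rw [hF 10 hA.1, hF 11 hA.2.1, hF 12 hA.2.2]
  exact h

theorem GradeInv.congr {s s' : Store} {M : ℕ} (h : GradeInv s M) {A : List ℕ}
    (hF : Fr A s s') (hA : 13 ∉ A ∧ 14 ∉ A) : GradeInv s' M := by
  unfold GradeInv
  rw [hF 13 hA.1, hF 14 hA.2]
  exact h

variable {p : Program}

theorem advance_spec {e : Expr} {s : Store} {Q : Store → ℕ → Prop}
    (hQ : ∀ s', s' 2 0 = e.eval s → s' 3 0 = s 3 0 + 2 → Fr [2, 3] s s' → Q s' (9 + e.cost)) :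
    W p (advance e) s Q := by
  refine W.seq (W.setv (W.setv ?_))
  have := hQ (upd (upd s 2 0 (e.eval s)) 3 0 (s 3 0 + 2)) (by simp [upd_of_ne]) (by simp)
    (((Fr.refl _ s).upd _ _ (by simp)).upd _ _ (by simp))
  convert this using 1
  all_goals simp only [Expr.cost, v_cost, Expr.eval, v_eval, upd_of_ne, ne_eq, Nat.reduceEqDiff, not_false_eq_true]
  omega

/-- The machine pays for binary digits, while the length of a formula counts logarithms. This
converts one into the other. -/
theorem size_le_clog (n : ℕ) : n.size ≤ Nat.clog 2 n + 1 := by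
  rw [Nat.size_le]
  calc n ≤ 2 ^ Nat.clog 2 n := Nat.le_pow_clog (by decide) n
    _ < 2 ^ (Nat.clog 2 n + 1) := Nat.pow_lt_pow_right (by decide) (Nat.lt_succ_self _)

theorem mark_spec {s : Store} {L : List (Fin r)} (h : ProgInv s L) {a : Fin r} (ha : s 24 0 = a) :
    W p (.ite (.eq (.get 10 (RAM.v 24)) (.lit 0))
      (.seq (.set 10 (RAM.v 24) (.lit 1)) (.seq (.set 11 (RAM.v 12) (RAM.v 24)) (incr 12))) .skip) s
      fun s' t => ProgInv s' (if a ∈ L then L else L ++ [a]) ∧ Fr [10, 11, 12] s s' ∧ t ≤ 40 := by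
  obtain ⟨h1, h2, h3⟩ := h
  by_cases hL : a ∈ L
  · refine W.ite_false (by simp [Test.Holds, Expr.eval, ha, h3, hL]) (W.skip ?_)
    rw [if_pos hL]
    exact ⟨⟨h1, h2, h3⟩, Fr.refl _ _, by simp [Test.cost, Expr.cost]⟩
  · refine W.ite_true (by simp [Test.Holds, Expr.eval, ha, h3, hL])
      (W.seq (W.set (W.seq (W.set (W.incr ?_)))))
    rw [if_neg hL]
    refine ⟨⟨?_, ?_, fun b => ?_⟩, ?_, ?_⟩
    · simp [upd_of_ne, h1]
    · rw [List.map_append, Seg_append]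
      simp only [upd_of_ne, ne_eq, Nat.reduceEqDiff, not_false_eq_true, upd_array, v_eval, h1,
        List.map_cons, List.map_nil, Seg, List.length_map, zero_add, and_true, ha]
      refine ⟨h2.congr fun j _ hj => ?_, by simp⟩
      rw [List.length_map] at hj
      rw [Function.update_of_ne (by omega)]
    · simp only [upd_of_ne, ne_eq, Nat.reduceEqDiff, not_false_eq_true, upd_array, v_eval, ha,
        List.mem_append, List.mem_singleton]
      by_cases hb : b = a
      · subst hb
        simp [Expr.eval]
      · rw [Function.update_of_ne (fun h => hb (Fin.ext h)), h3]
        simp [hb]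
    · exact (((Fr.refl _ s).upd _ _ (by simp)).upd _ _ (by simp)).upd _ _ (by simp)
    · simp [Test.cost, Expr.cost]

/-- Apart from the digits of a grade, each syntax node costs a bounded number of steps. The list and
the maximum are accumulators, so the invariant composes over the two subformulas of a binary
connective. -/
theorem scan_spec (hp : p[1]? = some scanBody) (ψ : Formula (Fin m) (Fin r) (Fin v))
    (L : List (Fin r)) (M : ℕ) (s : Store) (hs : Seg (s 0) (s 2 0) (codeFormula ψ))
    (hL : ProgInv s L) (hM : GradeInv s M) :
    W p (.call 1) s fun s' t => s' 2 0 = s 2 0 + (codeFormula ψ).length ∧ s' 3 0 = s 3 0 + ψ.st ∧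
      ProgInv s' (collect L ψ) ∧ GradeInv s' (max M ψ.maxGrade) ∧
      Fr [2, 3, 10, 11, 12, 13, 14, 15, 16, 17, 24] s s' ∧ t ≤ 1000 * ψ.length := by
  have htok : ∀ {s : Store} {x : ℕ}, s 0 (s 2 0) = x → tok.eval s = x := fun h => h
  induction ψ generalizing L M s with
  | tt | ff =>
    refine W.call hp (W.ite_true ?_ (advance_spec fun s' h2 h3 hF => ?_))
    · simp only [Test.Holds, htok hs.1, Expr.eval]; decide
    · refine ⟨h2, h3, hL.congr hF (by decide), ?_, hF.mono (by simp), ?_⟩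
      · simpa [Formula.maxGrade] using hM.congr hF (by decide)
      · simp [Test.cost, Expr.cost, tok, Formula.length]
  | prop x | nprop x | var x =>
    refine W.call hp (W.ite_false ?_ (W.ite_true ?_ (advance_spec fun s' h2 h3 hF => ?_)))
    · simp only [Test.Holds, htok hs.1, Expr.eval]; decide
    · simp only [Test.Holds, htok hs.1, Expr.eval]; decide
    · refine ⟨h2, h3, hL.congr hF (by decide), ?_, hF.mono (by simp), ?_⟩
      · simpa [Formula.maxGrade] using hM.congr hF (by decide)
      · simp [Test.cost, Expr.cost, tok, Formula.length]
  | or φ ψ ih1 ih2 | and φ ψ ih1 ih2 =>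
    obtain ⟨h0, hs⟩ := hs
    rw [Seg_append] at hs
    refine W.call hp (W.ite_false ?_ (W.ite_false ?_ (W.ite_true ?_
      (W.seq (advance_spec fun s₁ a1 b1 f1 => W.seq ?_)))))
    · simp only [Test.Holds, htok h0, Expr.eval]; decide
    · simp only [Test.Holds, htok h0, Expr.eval]; decide
    · simp only [Test.Holds, htok h0, Expr.eval]; decide
    have a1' : s₁ 2 0 = s 2 0 + 1 := a1
    refine (ih1 L M s₁ (by rw [f1 0 (by decide), a1']; exact hs.1) (hL.congr f1 (by decide))
      (hM.congr f1 (by decide))).mono ?_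
    rintro s₂ t₂ ⟨a2, b2, l2, m2, f2, ht2⟩
    refine (ih2 _ _ s₂ (by rw [f2 0 (by decide), f1 0 (by decide), a2, a1']; exact hs.2) l2 m2).mono ?_
    rintro s₃ t₃ ⟨a3, b3, l3, m3, f3, ht3⟩
    refine ⟨?_, ?_, l3, ?_, (f1.mono (by simp)).trans (f2.trans f3 (List.Subset.refl _)
      (List.Subset.refl _)) (List.Subset.refl _) (List.Subset.refl _), ?_⟩
    · rw [a3, a2, a1']
      simp only [codeFormula, List.length_cons, List.length_append]; omega
    · rw [b3, b2, b1]
      simp only [Formula.st]; omega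
    · simpa only [Formula.maxGrade, max_assoc] using m3
    · simp only [Test.cost, Expr.cost, tok, v_cost, Formula.length]; omega
  | dia n α φ ih | box n α φ ih =>
    obtain ⟨h0, hs⟩ := hs
    rw [Seg_append, Seg_append] at hs
    have hα : (codePrg α).length = 2 ∧ s 0 (s 2 0 + 1 + 1) = α.base := by
      cases α with
      | fwd a => exact ⟨rfl, hs.1.1.2.1⟩
      | bwd a => exact ⟨rfl, hs.1.1.2.1⟩
    rw [List.length_append, hα.1, codeNat_length] at hs
    refine W.call hp (W.ite_false ?_ (W.ite_false ?_ (W.ite_false ?_ (W.ite_true ?_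
      (W.seq (W.setv (W.seq ?_)))))))
    · simp only [Test.Holds, htok h0, Expr.eval]; decide
    · simp only [Test.Holds, htok h0, Expr.eval]; decide
    · simp only [Test.Holds, htok h0, Expr.eval]; decide
    · simp only [Test.Holds, htok h0, Expr.eval]; decide
    set s₁ := upd s 24 0 ((Expr.get 0 (.succ (.succ (RAM.v 2)))).eval s) with hs₁
    have f1 : Fr [24] s s₁ := (Fr.refl _ s).upd _ _ (by simp)
    refine (mark_spec (hL.congr f1 (by decide)) (a := α.base) ?_).mono ?_
    · rw [hs₁, upd_same]; exact hα.2
    rintro s₂ t₂ ⟨l2, f2, ht2⟩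
    have f12 : Fr [10, 11, 12, 24] s s₂ := f1.trans f2 (by simp) (by simp)
    refine W.seq (advance_spec fun s₃ a3 b3 f3 => W.seq ?_)
    have f13 : Fr [2, 3, 10, 11, 12, 24] s s₃ := f12.trans f3 (by simp) (by simp)
    have a3' : s₃ 2 0 = s 2 0 + 1 + 2 := by
      rw [a3]; simp only [Expr.eval, v_eval, f12 2 (by decide)]
    refine gradeMax_spec (n := n) (by rw [f13 0 (by decide), a3']; exact hs.1.2)
      (hM.congr f13 (by decide)) fun s₄ t₄ m4 f4 a4 ht4 => ?_
    have f14 : Fr [2, 3, 10, 11, 12, 13, 14, 15, 16, 17, 24] s s₄ := f13.trans f4 (by simp) (by simp)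
    refine (ih _ _ s₄ (by
      rw [f14 0 (by decide), a4, a3']
      convert hs.2 using 1; omega) (l2.congr (f3.trans f4 (C := [2, 3, 13, 14, 15, 16, 17]) (by simp)
        (by simp)) (by decide)) m4).mono ?_
    rintro s₅ t₅ ⟨a5, b5, l5, m5, f5, ht5⟩
    refine ⟨?_, ?_, l5, ?_, f14.trans f5 (List.Subset.refl _) (List.Subset.refl _), ?_⟩
    · rw [a5, a4, a3']
      simp only [codeFormula, List.length_cons, List.length_append, hα.1, codeNat_length]; omega
    · rw [b5, f4 3 (by decide), b3, f12 3 (by decide)]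
      simp only [Formula.st]; omega
    · simpa only [Formula.maxGrade, max_assoc] using m5
    · have := size_le_clog n
      simp only [Test.cost, Expr.cost, tok, v_cost, Formula.length]; omega
  | mu y φ ih | nu y φ ih =>
    obtain ⟨h0, -, hs⟩ := hs
    refine W.call hp (W.ite_false ?_ (W.ite_false ?_ (W.ite_false ?_ (W.ite_false ?_
      (W.seq (advance_spec fun s₁ a1 b1 f1 => ?_))))))
    · simp only [Test.Holds, htok h0, Expr.eval]; decide
    · simp only [Test.Holds, htok h0, Expr.eval]; decide
    · simp only [Test.Holds, htok h0, Expr.eval]; decide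
    · simp only [Test.Holds, htok h0, Expr.eval]; decide
    have a1' : s₁ 2 0 = s 2 0 + 2 := a1
    refine (ih L M s₁ (by rw [f1 0 (by decide), a1']; exact hs) (hL.congr f1 (by decide))
      (hM.congr f1 (by decide))).mono ?_
    rintro s₂ t₂ ⟨a2, b2, l2, m2, f2, ht2⟩
    refine ⟨?_, ?_, l2, m2, (f1.mono (by simp)).trans f2 (List.Subset.refl _) (List.Subset.refl _), ?_⟩
    · rw [a2, a1']
      simp only [codeFormula, List.length_cons]; omega
    · rw [b2, b1]
      simp only [Formula.st]; omega
    · simp only [Test.cost, Expr.cost, tok, v_cost, Formula.length]; omega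

end RAM

end FullGraded

/-! ### The second pass: writing the rows, with patching and a stack for bindings. -/

namespace FullGraded

variable {m r v : ℕ}

namespace RAM

/-! ### The second pass -/

/-- The state after the current one. -/
def q1 : Expr := .succ (RAM.v 3)

/-- The second state after the current one. -/
def q2 : Expr := .succ (.succ (RAM.v 3))

/-- Writing a word, moving the input pointer to `e` and taking the next two states. -/
def write (es : List Expr) (e : Expr) : Cmd := .seq (emits es) (advance e)

/-- Writing the rows of a disjunction or a conjunction. The second state in the first row is filled
in when the rows of the first subformula have been written. -/
def binaryCmd : Cmd :=
  .seq (emits [q1, RAM.v 16, .lit 4, .lit 1, q2, .lit 4, .lit 1])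
    -- The address of the missing entry goes on a stack, since the first subformula may need patches
    -- of its own.
    (.seq (.set 7 (RAM.v 6) (RAM.v 5)) (.seq (incr 6)
      (.seq (write [.lit 0, q2, .lit 0] (.succ (RAM.v 2)))
        (.seq (.call 2) (.seq (setv 6 (.pred (RAM.v 6)))
          -- After the first subformula the state counter is the first state of the second one,
          -- which is the missing entry.
          (.seq (.set 1 (.get 7 (RAM.v 6)) (RAM.v 3)) (.call 2)))))))

/-- Writing the rows of a graded modality. -/
def modalCmd (A B l d x : ℕ) : Cmd :=
  .seq (setv 24 (.get 0 (.succ (.succ (RAM.v 2)))))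
    -- The letter of a program has the symbol of the program plus one. Variable `23` receives the
    -- symbol of the inverse program.
    (.seq (setv 22 (.succ (.get 0 (.succ (RAM.v 2)))))
    (.seq (.ite (.eq (RAM.v 22) (.lit 1)) (setv 23 (.lit 2)) (setv 23 (.lit 1)))
    (.seq (setv 2 (.succ (.succ (.succ (RAM.v 2)))))
    (.seq (emits [q1, .lit A, .lit B, .lit B, .lit l, RAM.v 23, RAM.v 24, .lit 4, .lit 0, q2])
    (.seq (.ite (.eq (.get 0 (RAM.v 2)) (.lit 2)) (emits [.lit x])
      -- The grade is needed twice. The lowered copy uses its own pointer `16`, so the input pointer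
      -- still stands at the grade for the plain copy.
      (.seq (emits [.lit 4, .lit d]) (.seq (setv 16 (RAM.v 2)) (.seq (decNat 0 16) (emits [q1])))))
    (.seq (emits [.lit 4, .lit d]) (.seq (copyNat 0 2)
    (.seq (write [q1, q2, .lit B, .lit l, RAM.v 22, RAM.v 24, .lit 4, .lit 1, q2] (.succ (RAM.v 2)))
      (.call 2)))))))))

/-- Writing the rows of a fixed point, with the state of the variable set for the subformula. -/
def binderCmd : Cmd :=
  .seq (emits [RAM.v 16, .lit 4, .lit 1, q2, q2, .lit 0])
    -- The variable and its previous state are stacked, so that a variable bound again inside the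
    -- formula regains its outer meaning.
    (.seq (.set 7 (RAM.v 6) (.get 0 (.succ (RAM.v 2))))
    (.seq (.set 8 (RAM.v 6) (.get 9 (.get 0 (.succ (RAM.v 2)))))
    (.seq (.set 9 (.get 0 (.succ (RAM.v 2))) (RAM.v 3)) (.seq (incr 6)
    (.seq (advance (.succ (.succ (RAM.v 2)))) (.seq (.call 2) (.seq (setv 6 (.pred (RAM.v 6)))
      (.set 9 (.get 7 (RAM.v 6)) (.get 8 (RAM.v 6))))))))))

/-- Procedure `2`: writing the rows of a formula. -/
def emitBody : Cmd :=
  .ite (.lt tok (.lit 2)) (write [q1, tok, q2, .lit 0] (.succ (RAM.v 2)))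
  (.ite (.lt tok (.lit 4))
    (write [q1, tok, .lit 0, .get 0 (.succ (RAM.v 2)), q2, .lit 0] (.succ (.succ (RAM.v 2))))
  (.ite (.lt tok (.lit 5))
    (write [q1, .lit 4, .lit 1, .get 9 (.get 0 (.succ (RAM.v 2))), q2, .lit 0]
      (.succ (.succ (RAM.v 2))))
  (.ite (.lt tok (.lit 7))
    -- Formulas and transitions number disjunction and conjunction in opposite order: `5, 6` in the
    -- input, `6, 5` in the output.
    (.seq (.ite (.eq tok (.lit 5)) (setv 16 (.lit 6)) (setv 16 (.lit 5))) binaryCmd)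
  (.ite (.eq tok (.lit 7)) (modalCmd 6 5 2 2 0)
  (.ite (.eq tok (.lit 8)) (modalCmd 5 6 3 3 1)
    (.seq (.ite (.eq tok (.lit 9)) (setv 16 q1) (setv 16 q2)) binderCmd))))))

variable {p : Program}

/-- The word `L` has been written, `len` input symbols have been read and `k` states have been
taken. -/
def Written (s s' : Store) (L : List ℕ) (len k : ℕ) : Prop :=
  Emits s s' L ∧ s' 2 0 = s 2 0 + len ∧ s' 3 0 = s 3 0 + k ∧ s' 6 0 = s 6 0 ∧
    (∀ j < s 6 0, s' 7 j = s 7 j ∧ s' 8 j = s 8 j) ∧ Fr [1, 2, 3, 5, 6, 7, 8, 16, 22, 23, 24] s s'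

/-- Procedure `2` writes the rows of `ψ`. -/
def Translates (p : Program) (env : Fin v → ℕ) (ψ : Formula (Fin m) (Fin r) (Fin v)) : Prop :=
  ∀ s : Store, Seg (s 0) (s 2 0) (codeFormula ψ) → (∀ x : Fin v, s 9 x = env x) →
    W p (.call 2) s fun s' t => Written s s' ((table env (s 3 0) ψ).flatMap rowCode)
      (codeFormula ψ).length ψ.st ∧ t ≤ 3000 * ψ.length

theorem write_spec {es : List Expr} (hes : es.all Expr.safe = true) {e : Expr} (he : e.safe = true)
    {s : Store} {Q : Store → ℕ → Prop}
    (hQ : ∀ s', Emits s s' (es.map (Expr.eval s)) → s' 2 0 = e.eval s → s' 3 0 = s 3 0 + 2 →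
      Fr [1, 2, 3, 5] s s' → Q s' (1 + ecost es + (9 + e.cost))) : W p (write es e) s Q := by
  refine W.seq (W.emits hes fun s₁ e1 f1 => advance_spec fun s₂ a2 b2 f2 => hQ s₂ ?_ ?_ ?_ ?_)
  · exact e1.congr rfl rfl (f2 1 (by decide)) (f2 5 (by decide))
  · rw [a2, Expr.eval_congr he f1]
  · rw [b2, f1 3 (by decide)]
  · exact f1.trans f2 (by simp) (by simp)

theorem setIf_spec {a x : ℕ} {b : Test} {e f : Expr} {s : Store} (hT : b.Holds s → e.eval s = x)
    (hF : ¬ b.Holds s → f.eval s = x) {Q : Store → ℕ → Prop}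
    (hQ : ∀ s' t, s' a 0 = x → Fr [a] s s' → t ≤ 3 + b.cost + e.cost + f.cost → Q s' t) :
    W p (.ite b (setv a e) (setv a f)) s Q := by
  by_cases hb : b.Holds s
  · refine W.ite_true hb (W.setv (hQ _ _ ?_ ((Fr.refl _ s).upd _ _ (by simp)) (by omega)))
    rw [upd_same, hT hb]
  · refine W.ite_false hb (W.setv (hQ _ _ ?_ ((Fr.refl _ s).upd _ _ (by simp)) (by omega)))
    rw [upd_same, hF hb]

theorem leaf_spec {es : List Expr} (hes : es.all Expr.safe = true) {e : Expr} (he : e.safe = true)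
    {s : Store} {L : List ℕ} {n : ℕ} (hL : es.map (Expr.eval s) = L) (hn : e.eval s = s 2 0 + n) :
    W p (write es e) s fun s' t => Written s s' L n 2 ∧ t ≤ ecost es + e.cost + 10 := by
  refine write_spec hes he fun s' e1 a1 b1 f1 => ⟨⟨hL ▸ e1, a1.trans hn, b1, ?_, fun j _ => ⟨?_, ?_⟩,
    f1.mono (by simp)⟩, by omega⟩
  · rw [f1 6 (by decide)]
  · rw [f1 7 (by decide)]
  · rw [f1 8 (by decide)]

/-- The assumption on the first recursive call protects the stack below the current height, so the
saved address survives; by `Emits.patch` the late write alters only the placeholder. -/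
theorem binary_spec {env : Fin v → ℕ} {φ ψ : Formula (Fin m) (Fin r) (Fin v)}
    (h1 : Translates p env φ) (h2 : Translates p env ψ) {s : Store}
    (hs : Seg (s 0) (s 2 0 + 1) (codeFormula φ ++ codeFormula ψ)) (henv : ∀ x : Fin v, s 9 x = env x) :
    W p binaryCmd s fun s' t => Written s s' ([s 3 0 + 1, s 16 0, 4, 1, s 3 0 + 2, 4, 1] ++
        (s 3 0 + 2 + φ.st) :: ([s 3 0 + 2, 0] ++ (table env (s 3 0 + 2) φ).flatMap rowCode) ++
          (table env (s 3 0 + 2 + φ.st) ψ).flatMap rowCode)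
      (1 + (codeFormula φ ++ codeFormula ψ).length) (2 + φ.st + ψ.st) ∧
      t ≤ 500 + 3000 * φ.length + 3000 * ψ.length := by
  rw [Seg_append] at hs
  refine W.seq (W.emits (by decide) fun s₁ e1 f1 => W.seq (W.set (W.seq (W.incr (W.seq ?_)))))
  set s₂ := upd (upd s₁ 7 ((RAM.v 6).eval s₁) ((RAM.v 5).eval s₁)) 6 0
    (upd s₁ 7 ((RAM.v 6).eval s₁) ((RAM.v 5).eval s₁) 6 0 + 1) with hs₂
  have f12 : Fr [6, 7] s₁ s₂ := ((Fr.refl _ s₁).upd _ _ (by simp)).upd _ _ (by simp)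
  have f2 : Fr [1, 5, 6, 7] s s₂ := f1.trans f12 (by simp) (by simp)
  have h27 : s₂ 7 = Function.update (s 7) (s 6 0) (s₁ 5 0) := by
    rw [hs₂, upd_of_ne _ _ _ (by decide), upd_array, v_eval, v_eval, f1 7 (by decide),
      f1 6 (by decide)]
  have h26 : s₂ 6 0 = s 6 0 + 1 := by
    rw [hs₂, upd_same, upd_of_ne _ _ _ (by decide), f1 6 (by decide)]
  refine write_spec (by decide) (by decide) fun s₃ e3 a3 b3 f3 => W.seq ?_
  have f23 : Fr [1, 2, 3, 5, 6, 7] s s₃ := f2.trans f3 (by simp) (by simp)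
  have a3' : s₃ 2 0 = s 2 0 + 1 := by rw [a3, ← f2 2 (by decide)]; rfl
  have b3' : s₃ 3 0 = s 3 0 + 2 := by rw [b3, f2 3 (by decide)]
  refine (h1 s₃ (by rw [f23 0 (by decide), a3']; exact hs.1)
    (by rw [f23 9 (by decide)]; exact henv)).mono ?_
  rintro s₄ t₄ ⟨⟨e4, a4, b4, c4, d4, f4⟩, ht4⟩
  rw [b3'] at e4
  rw [f3 6 (by decide), h26] at c4 d4
  refine W.seq (W.setv (W.seq (W.set ?_)))
  set s₅ := upd s₄ 6 0 ((Expr.pred (RAM.v 6)).eval s₄) with hs₅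
  have h56 : s₅ 6 0 = s 6 0 := by
    rw [hs₅, upd_same]; simp only [Expr.eval, v_eval, c4]; rfl
  have h57 : s₅ 7 = s₄ 7 := upd_of_ne _ _ _ (by decide)
  have h58 : s₅ 8 = s₄ 8 := upd_of_ne _ _ _ (by decide)
  have h53 : s₅ 3 0 = s 3 0 + 2 + φ.st := by
    rw [hs₅, upd_of_ne _ _ _ (by decide), b4, b3']
  have hptr : (Expr.get 7 (RAM.v 6)).eval s₅ = s₁ 5 0 := by
    simp only [Expr.eval, v_eval, h56, h57]
    rw [(d4 _ (Nat.lt_succ_self _)).1, f3 7 (by decide), h27, Function.update_self]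
  rw [hptr, v_eval, h53]
  set s₆ := upd s₅ 1 (s₁ 5 0) (s 3 0 + 2 + φ.st) with hs₆
  have f46 : Fr [1, 6] s₄ s₆ := ((Fr.refl _ s₄).upd _ _ (by simp)).upd _ _ (by simp)
  have f6 : Fr [1, 2, 3, 5, 6, 7, 8, 16, 22, 23, 24] s s₆ :=
    (f23.mono (by simp)).trans (f4.trans f46 (List.Subset.refl _) (by simp)) (List.Subset.refl _)
      (List.Subset.refl _)
  have E6 : Emits s s₆ ([s 3 0 + 1, s 16 0, 4, 1, s 3 0 + 2, 4, 1] ++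
      (s 3 0 + 2 + φ.st) :: ([s 3 0 + 2, 0] ++ (table env (s 3 0 + 2) φ).flatMap rowCode)) := by
    refine Emits.patch (x := 0) e1 ?_ _
    have := (e3.congr (t := s₁) (t' := s₃) (f12 1 (by decide)).symm (f12 5 (by decide)).symm
      rfl rfl).trans e4
    have hq : (q2).eval s₂ = s 3 0 + 2 := by
      simp only [q2, Expr.eval, v_eval, f2 3 (by decide)]
    simp only [List.map_cons, List.map_nil, hq, Expr.eval] at this
    exact this.congr rfl rfl (upd_of_ne _ _ _ (by decide)) (upd_of_ne _ _ _ (by decide))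
  have h62 : s₆ 2 0 = s 2 0 + 1 + (codeFormula φ).length := by
    rw [f46 2 (by decide), a4, a3']
  have h63 : s₆ 3 0 = s 3 0 + 2 + φ.st := by rw [f46 3 (by decide), b4, b3']
  have h66 : s₆ 6 0 = s 6 0 := by rw [hs₆, upd_of_ne _ _ _ (by decide), h56]
  refine (h2 s₆ (by rw [f6 0 (by decide), h62]; exact hs.2)
    (by rw [f6 9 (by decide)]; exact henv)).mono ?_
  rintro s₇ t₇ ⟨⟨e7, a7, b7, c7, d7, f7⟩, ht7⟩
  rw [h63] at e7
  refine ⟨⟨E6.trans e7, ?_, ?_, c7.trans h66, fun j hj => ?_, f6.trans f7 (List.Subset.refl _)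
    (List.Subset.refl _)⟩, ?_⟩
  · rw [a7, h62, List.length_append]; omega
  · rw [b7, h63]; omega
  · rw [(d7 j (h66.symm ▸ hj)).1, (d7 j (h66.symm ▸ hj)).2, f46 7 (by decide), f46 8 (by decide),
      (d4 j (by omega)).1, (d4 j (by omega)).2, f3 7 (by decide), f3 8 (by decide), h27,
      f2 8 (by decide), Function.update_of_ne (by omega)]
    exact ⟨rfl, rfl⟩
  · simp only [ecost, Expr.cost, v_cost, q1, q2]; omega

theorem binder_spec {env : Fin v → ℕ} {y : Fin v} {φ : Formula (Fin m) (Fin r) (Fin v)} {s : Store}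
    (h1 : Translates p (Function.update env y (s 3 0)) φ)
    (hs : Seg (s 0) (s 2 0 + 1) (y.1 :: codeFormula φ)) (henv : ∀ x : Fin v, s 9 x = env x) :
    W p binderCmd s fun s' t => Written s s' ([s 16 0, 4, 1, s 3 0 + 2, s 3 0 + 2, 0] ++
        (table (Function.update env y (s 3 0)) (s 3 0 + 2) φ).flatMap rowCode)
      (2 + (codeFormula φ).length) (2 + φ.st) ∧ t ≤ 500 + 3000 * φ.length := by
  obtain ⟨hy, hs⟩ := hs
  refine W.seq (W.emits (by decide) fun s₁ e1 f1 =>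
    W.seq (W.set (W.seq (W.set (W.seq (W.set (W.seq (W.incr (W.seq ?_)))))))))
  have hy1 : s₁ 0 (s₁ 2 0 + 1) = y := by rw [f1 0 (by decide), f1 2 (by decide)]; exact hy
  have h16 : s₁ 6 0 = s 6 0 := by rw [f1 6 (by decide)]
  have h13 : s₁ 3 0 = s 3 0 := by rw [f1 3 (by decide)]
  simp only [Expr.eval, v_eval, upd_of_ne, ne_eq, Nat.reduceEqDiff, not_false_eq_true,
    OfNat.zero_ne_ofNat, hy1, h16, h13]
  set s₂ := upd (upd (upd (upd s₁ 7 (s 6 0) y) 8 (s 6 0) (s₁ 9 y)) 9 y (s 3 0)) 6 0 (s 6 0 + 1)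
    with hs₂
  have f2 : Fr [1, 5, 6, 7, 8, 9] s s₂ := ((((f1.mono (by simp)).upd _ _ (by simp)).upd _ _
    (by simp)).upd _ _ (by simp)).upd _ _ (by simp)
  have h27 : s₂ 7 = Function.update (s 7) (s 6 0) y := by
    simp [hs₂, upd_of_ne, upd_array, f1 7]
  have h28 : s₂ 8 = Function.update (s 8) (s 6 0) (s 9 y) := by
    simp [hs₂, upd_of_ne, upd_array, f1 8, f1 9]
  have h29 : s₂ 9 = Function.update (s 9) y (s 3 0) := by
    simp [hs₂, upd_of_ne, upd_array, f1 9]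
  have h26 : s₂ 6 0 = s 6 0 + 1 := upd_same _ _ _ _
  have E2 : Emits s s₂ [s 16 0, 4, 1, s 3 0 + 2, s 3 0 + 2, 0] :=
    e1.congr rfl rfl (by simp [hs₂, upd_of_ne]) (by simp [hs₂, upd_of_ne])
  refine advance_spec fun s₃ a3 b3 f3 => W.seq ?_
  have a3' : s₃ 2 0 = s 2 0 + 1 + 1 := by
    rw [a3]; simp only [Expr.eval, v_eval, f2 2 (by decide)]
  have b3' : s₃ 3 0 = s 3 0 + 2 := by rw [b3, f2 3 (by decide)]
  refine (h1 s₃ (by rw [f3 0 (by decide), f2 0 (by decide), a3']; exact hs) (fun x => ?_)).mono ?_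
  · rw [f3 9 (by decide), h29]
    by_cases hx : x = y
    · subst hx; simp
    · rw [Function.update_of_ne (fun h => hx (Fin.ext h)), Function.update_of_ne hx, henv]
  rintro s₄ t₄ ⟨⟨e4, a4, b4, c4, d4, f4⟩, ht4⟩
  rw [b3'] at e4
  rw [f3 6 (by decide), h26] at c4 d4
  refine W.seq (W.setv (W.set ?_))
  obtain ⟨d7, d8⟩ := d4 _ (Nat.lt_succ_self _)
  rw [f3 7 (by decide), h27, Function.update_self] at d7
  rw [f3 8 (by decide), h28, Function.update_self] at d8
  simp only [Expr.eval, v_eval, upd_of_ne, ne_eq, Nat.reduceEqDiff, not_false_eq_true, upd_same,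
    c4, Nat.add_sub_cancel, d7, d8]
  set s₅ := upd (upd s₄ 6 0 (s 6 0)) 9 y (s 9 y) with hs₅
  have f45 : Fr [6, 9] s₄ s₅ := ((Fr.refl _ s₄).upd _ _ (by simp)).upd _ _ (by simp)
  have f5 : Fr [1, 2, 3, 5, 6, 7, 8, 9, 16, 22, 23, 24] s s₅ :=
    (f2.trans f3 (C := [1, 2, 3, 5, 6, 7, 8, 9, 16, 22, 23, 24]) (by simp) (by simp)).trans
      (f4.trans f45 (C := [1, 2, 3, 5, 6, 7, 8, 9, 16, 22, 23, 24]) (by simp) (by simp))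
      (List.Subset.refl _) (List.Subset.refl _)
  refine ⟨⟨?_, ?_, ?_, ?_, fun j hj => ?_, fun a ha => ?_⟩, ?_⟩
  · exact E2.trans (e4.congr (f3 1 (by decide)).symm (f3 5 (by decide)).symm (f45 1 (by decide))
      (f45 5 (by decide)))
  · rw [f45 2 (by decide), a4, a3']; omega
  · rw [f45 3 (by decide), b4, b3']; omega
  · rw [hs₅, upd_of_ne _ _ _ (by decide), upd_same]
  · rw [f45 7 (by decide), f45 8 (by decide), (d4 j (by omega)).1, (d4 j (by omega)).2,
      f3 7 (by decide), f3 8 (by decide), h27, h28, Function.update_of_ne (by omega),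
      Function.update_of_ne (by omega)]
    exact ⟨rfl, rfl⟩
  -- Array `9` was changed during the recursive call, but its old entry has been restored, so on the
  -- whole it is unchanged.
  · by_cases h9 : a = 9
    · subst h9
      rw [hs₅, upd_array, upd_of_ne _ _ _ (by decide), f4 9 (by decide), f3 9 (by decide), h29,
        Function.update_idem, Function.update_eq_self]
    · refine f5 a ?_
      simp only [List.mem_cons, List.not_mem_nil, or_false, not_or] at ha ⊢
      tauto
  · simp only [ecost, Expr.cost, v_cost, q2]; omega

end RAM

end FullGraded

/-! ### The second pass: modalities and the induction over formulas. -/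

namespace FullGraded

variable {m r v : ℕ}

namespace RAM

variable {p : Program}

/-- The code of the move for one successor less than the grade `n` requires. -/
def lowerMove (d x q : ℕ) : ℕ → List ℕ
  | 0 => [x]
  | k + 1 => 4 :: d :: (codeNat k ++ [q])

theorem lowerMove_spec {d x n : ℕ} {s : Store} (hs : Seg (s 0) (s 2 0) (codeNat n))
    {Q : Store → ℕ → Prop}
    (hQ : ∀ s' t, Emits s s' (lowerMove d x (s 3 0 + 1) n) → Fr [1, 5, 16] s s' →
      t ≤ 100 * (n.size + 1) + 100 → Q s' t) :
    W p (.ite (.eq (.get 0 (RAM.v 2)) (.lit 2)) (emits [.lit x])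
      (.seq (emits [.lit 4, .lit d]) (.seq (setv 16 (RAM.v 2)) (.seq (decNat 0 16) (emits [q1]))))) s
      Q := by
  cases n with
  | zero =>
    refine W.ite_true hs.1 (W.emits rfl fun s₁ e1 f1 => hQ _ _ e1 (f1.mono (by simp)) ?_)
    simp [ecost, Expr.cost, Test.cost]
  | succ k =>
    have h2 : s 0 (s 2 0) ≠ 2 := by
      have h := (Seg_codeNat.1 hs).1 0 (Nat.size_pos.2 (Nat.succ_pos k))
      rw [add_zero] at h
      rw [h]
      have := Bool.toNat_lt ((k + 1).testBit 0)
      omega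
    refine W.ite_false h2 (W.seq (W.emits rfl fun s₁ e1 f1 => W.seq (W.setv (W.seq ?_))))
    set s₂ := upd s₁ 16 0 ((RAM.v 2).eval s₁) with hs₂
    have f12 : Fr [16] s₁ s₂ := (Fr.refl _ s₁).upd _ _ (by simp)
    have f2 : Fr [1, 5, 16] s s₂ := f1.trans f12 (by simp) (by simp)
    refine decNat_spec (n := k) (by decide) (by decide) (by decide) (by decide) (by decide)
      (by rw [f2 0 (by decide), hs₂, upd_same, v_eval, f1 2 (by decide)]; exact hs)
      fun s₃ t₃ e3 f3 ht3 => W.emits rfl fun s₄ e4 f4 => ?_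
    have f3' : Fr [1, 5, 16] s s₃ := f2.trans f3 (by simp) (by simp)
    refine hQ _ _ ?_ (f3'.trans f4 (by simp) (by simp)) ?_
    · have := (e1.congr (t' := s₂) rfl rfl (f12 1 (by decide)) (f12 5 (by decide))).trans
        (e3.trans e4)
      simp only [List.map_cons, List.map_nil, q1, Expr.eval, v_eval, f3' 3 (by decide)] at this
      exact this
    · simp only [ecost, Expr.cost, v_cost, Test.cost, q1]; omega

/-- Both modalities are handled at once, because their rows are dual: `A`, `B` are the connectives,
`l` the kind of label test, `d` the direction, and `x` the constant used for grade `0`. -/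
theorem modal_spec {A B l d x n c a : ℕ} {env : Fin v → ℕ} {φ : Formula (Fin m) (Fin r) (Fin v)}
    (h1 : Translates p env φ) {s : Store}
    (hs : Seg (s 0) (s 2 0 + 1) (c :: a :: (codeNat n ++ codeFormula φ)))
    (henv : ∀ x : Fin v, s 9 x = env x) :
    W p (modalCmd A B l d x) s fun s' t => Written s s'
      ([s 3 0 + 1, A, B, B, l, if c = 0 then 2 else 1, a, 4, 0, s 3 0 + 2] ++
        (lowerMove d x (s 3 0 + 1) n ++ ([4, d] ++ (codeNat n ++
          ([s 3 0 + 1, s 3 0 + 2, B, l, c + 1, a, 4, 1, s 3 0 + 2] ++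
            (table env (s 3 0 + 2) φ).flatMap rowCode)))))
      (3 + (codeNat n ++ codeFormula φ).length) (2 + φ.st) ∧
      t ≤ 1000 + 200 * n.size + 3000 * φ.length := by
  obtain ⟨hc, ha, hs⟩ := hs
  rw [Seg_append, codeNat_length] at hs
  refine W.seq (W.setv (W.seq (W.setv (W.seq ?_))))
  have ha' : (Expr.get 0 (.succ (.succ (RAM.v 2)))).eval s = a := ha
  rw [ha']
  set s₁ := upd s 24 0 a with hs₁
  have f1 : Fr [24] s s₁ := (Fr.refl _ s).upd _ _ (by simp)
  have hc' : (Expr.succ (.get 0 (.succ (RAM.v 2)))).eval s₁ = c + 1 := by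
    simp only [Expr.eval, v_eval, f1 0 (by decide), f1 2 (by decide), hc]
  rw [hc']
  set s₂ := upd s₁ 22 0 (c + 1) with hs₂
  have f2 : Fr [22, 24] s s₂ := (f1.mono (by simp)).upd _ _ (by simp)
  refine setIf_spec (x := if c = 0 then 2 else 1) ?_ ?_ fun s₃ t₃ h23 f3 ht3 => W.seq (W.setv ?_)
  · intro h
    have h' : c + 1 = 1 := h
    rw [if_pos (by omega)]; rfl
  · intro h
    have h' : ¬ c + 1 = 1 := h
    rw [if_neg (by omega)]; rfl
  have f3' : Fr [22, 23, 24] s s₃ := f2.trans f3 (by simp) (by simp)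
  have hpos : (Expr.succ (.succ (.succ (RAM.v 2)))).eval s₃ = s 2 0 + 1 + 1 + 1 := by
    simp only [Expr.eval, v_eval, f3' 2 (by decide)]
  rw [hpos]
  set s₄ := upd s₃ 2 0 (s 2 0 + 1 + 1 + 1) with hs₄
  have f34 : Fr [2] s₃ s₄ := (Fr.refl _ s₃).upd _ _ (by simp)
  have f4 : Fr [2, 22, 23, 24] s s₄ := f3'.trans f34 (by simp) (by simp)
  have h42 : s₄ 2 0 = s 2 0 + 1 + 1 + 1 := upd_same _ _ _ _
  have h422 : s₄ 22 0 = c + 1 := by rw [f34 22 (by decide), f3 22 (by decide), hs₂, upd_same]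
  have h424 : s₄ 24 0 = a := by
    rw [f34 24 (by decide), f3 24 (by decide), hs₂, upd_of_ne _ _ _ (by decide), hs₁, upd_same]
  have h423 : s₄ 23 0 = if c = 0 then 2 else 1 := by rw [f34 23 (by decide), h23]
  refine W.seq (W.emits rfl fun s₅ e5 f5 => W.seq ?_)
  have f5' : Fr [1, 2, 5, 22, 23, 24] s s₅ := f4.trans f5 (by simp) (by simp)
  have h52 : s₅ 2 0 = s 2 0 + 1 + 1 + 1 := by rw [f5 2 (by decide), h42]
  refine lowerMove_spec (n := n) (by rw [f5' 0 (by decide), h52]; exact hs.1)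
    fun s₆ t₆ e6 f6 ht6 => W.seq (W.emits rfl fun s₇ e7 f7 => W.seq ?_)
  have f57 : Fr [1, 5, 16] s₅ s₇ := f6.trans f7 (by simp) (by simp)
  have f7' : Fr [1, 2, 5, 16, 22, 23, 24] s s₇ := f5'.trans f57 (by simp) (by simp)
  have h72 : s₇ 2 0 = s 2 0 + 1 + 1 + 1 := by rw [f57 2 (by decide), h52]
  refine copyNat_spec (n := n) (by decide) (by decide) (by decide) (by decide) (by decide)
    (by rw [f7' 0 (by decide), h72]; exact hs.1) fun s₈ t₈ e8 f8 a8 ht8 => W.seq ?_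
  have f8' : Fr [1, 2, 5, 16, 22, 23, 24] s s₈ := f7'.trans f8 (by simp) (by simp)
  have f48 : Fr [1, 2, 5, 16] s₄ s₈ := f5.trans (f57.trans f8 (C := [1, 2, 5, 16]) (by simp) (by simp))
    (by simp) (by simp)
  refine write_spec rfl rfl fun s₉ e9 a9 b9 f9 => ?_
  have f9' : Fr [1, 2, 3, 5, 16, 22, 23, 24] s s₉ := f8'.trans f9 (by simp) (by simp)
  have a9' : s₉ 2 0 = s 2 0 + 1 + 1 + 1 + (n.size + 1) := by
    rw [a9]; simp only [Expr.eval, v_eval, a8, h72]; omega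
  have b9' : s₉ 3 0 = s 3 0 + 2 := by rw [b9, f8' 3 (by decide)]
  refine (h1 s₉ (by rw [f9' 0 (by decide), a9']; exact hs.2)
    (by rw [f9' 9 (by decide)]; exact henv)).mono ?_
  rintro s' t' ⟨⟨e', a', b', c', d', f'⟩, ht'⟩
  rw [b9'] at e'
  refine ⟨⟨?_, ?_, ?_, ?_, fun j hj => ?_, (f9'.mono (by simp)).trans f' (List.Subset.refl _)
    (List.Subset.refl _)⟩, ?_⟩
  · simp only [List.map_cons, List.map_nil, q1, q2, Expr.eval, v_eval, h423, h424,
      f4 3 (by decide)] at e5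
    rw [f5' 3 (by decide)] at e6
    simp only [List.map_cons, List.map_nil, Expr.eval] at e7
    simp only [List.map_cons, List.map_nil, q1, q2, Expr.eval, v_eval, f8' 3 (by decide),
      f48 22 (by decide), f48 24 (by decide), h422, h424] at e9
    exact (e5.congr (f4 1 (by decide)).symm (f4 5 (by decide)).symm rfl rfl).trans
      (e6.trans (e7.trans (e8.trans (e9.trans e'))))
  · rw [a', a9', List.length_append, codeNat_length]; omega
  · rw [b', b9']; omega
  · rw [c', f9' 6 (by decide)]
  · rw [(d' j (by rwa [f9' 6 (by decide)])).1, (d' j (by rwa [f9' 6 (by decide)])).2,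
      f9' 7 (by decide), f9' 8 (by decide)]
    exact ⟨rfl, rfl⟩
  · simp only [Test.cost, Expr.cost, v_cost] at ht3
    simp only [ecost, Expr.cost, v_cost, q1, q2]; omega

theorem emit_spec (hp : p[2]? = some emitBody) (ψ : Formula (Fin m) (Fin r) (Fin v))
    (env : Fin v → ℕ) : Translates p env ψ := by
  have htok : ∀ {s : Store} {x : ℕ}, s 0 (s 2 0) = x → tok.eval s = x := fun h => h
  induction ψ generalizing env with
  | tt | ff =>
    intro s hs henv
    refine W.call hp (W.ite_true ?_ ((leaf_spec rfl rfl ?_ (n := 1) rfl).mono fun s' t h => ⟨h.1, ?_⟩))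
    · simp only [Test.Holds, htok hs.1, Expr.eval]; decide
    · simp only [List.map_cons, List.map_nil, htok hs.1, q1, q2, Expr.eval, v_eval]; rfl
    · have ht := h.2
      simp only [ecost, Test.cost, Expr.cost, v_cost, tok, q1, q2] at ht ⊢
      simp only [Formula.length]; omega
  | prop x | nprop x =>
    intro s hs henv
    have hx : s 0 (s 2 0 + 1) = x := hs.2.1
    refine W.call hp (W.ite_false ?_ (W.ite_true ?_ ((leaf_spec rfl rfl ?_ (n := 2) rfl).mono
      fun s' t h => ⟨h.1, ?_⟩)))
    · simp only [Test.Holds, htok hs.1, Expr.eval]; decide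
    · simp only [Test.Holds, htok hs.1, Expr.eval]; decide
    · simp only [List.map_cons, List.map_nil, htok hs.1, q1, q2, Expr.eval, v_eval, hx]; rfl
    · have ht := h.2
      simp only [ecost, Test.cost, Expr.cost, v_cost, tok, q1, q2] at ht ⊢
      simp only [Formula.length]; omega
  | var x =>
    intro s hs henv
    have hx : s 0 (s 2 0 + 1) = x := hs.2.1
    refine W.call hp (W.ite_false ?_ (W.ite_false ?_ (W.ite_true ?_
      ((leaf_spec rfl rfl ?_ (n := 2) rfl).mono
      fun s' t h => ⟨h.1, ?_⟩))))
    · simp only [Test.Holds, htok hs.1, Expr.eval]; decide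
    · simp only [Test.Holds, htok hs.1, Expr.eval]; decide
    · simp only [Test.Holds, htok hs.1, Expr.eval]; decide
    · simp only [List.map_cons, List.map_nil, q1, q2, Expr.eval, v_eval, hx, henv]; rfl
    · have ht := h.2
      simp only [ecost, Test.cost, Expr.cost, v_cost, tok, q1, q2] at ht ⊢
      simp only [Formula.length]; omega
  | or φ ψ ih1 ih2 | and φ ψ ih1 ih2 =>
    intro s hs henv
    refine W.call hp (W.ite_false ?_ (W.ite_false ?_ (W.ite_false ?_ (W.ite_true ?_ (W.seq
      (setIf_spec (x := 11 - s 0 (s 2 0)) ?_ ?_ fun s₁ t₁ h1 f1 ht1 => ?_))))))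
    · simp only [Test.Holds, htok hs.1, Expr.eval]; decide
    · simp only [Test.Holds, htok hs.1, Expr.eval]; decide
    · simp only [Test.Holds, htok hs.1, Expr.eval]; decide
    · simp only [Test.Holds, htok hs.1, Expr.eval]; decide
    · simp only [Test.Holds, htok hs.1, Expr.eval, hs.1]; decide
    · simp only [Test.Holds, htok hs.1, Expr.eval, hs.1]; decide
    refine (binary_spec (ih1 env) (ih2 env) (s := s₁)
      (by rw [f1 0 (by decide), f1 2 (by decide)]; exact hs.2)
      (by rw [f1 9 (by decide)]; exact henv)).mono ?_
    rintro s' t ⟨⟨e, a, b, c, d, f⟩, ht⟩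
    rw [f1 3 (by decide)] at b e
    rw [f1 2 (by decide)] at a
    rw [f1 6 (by decide)] at c d
    refine ⟨⟨?_, ?_, b, c, fun j hj => ?_, (f1.mono (by simp)).trans f (List.Subset.refl _)
      (List.Subset.refl _)⟩, ?_⟩
    · have := e.congr (f1 1 (by decide)).symm (f1 5 (by decide)).symm rfl rfl
      rw [h1, hs.1] at this
      simpa only [table, rowCode, codeRaw, mv, RDir.code, List.flatMap_cons, List.flatMap_append,
        List.cons_append, List.nil_append, List.append_assoc] using this
    · rw [a, codeFormula, List.length_cons]; omega
    · rw [(d j hj).1, (d j hj).2, f1 7 (by decide), f1 8 (by decide)]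
      exact ⟨rfl, rfl⟩
    · simp only [Test.cost, Expr.cost, v_cost, tok] at ht1 ⊢
      simp only [Formula.length]; omega
  | dia n α φ ih =>
    intro s hs henv
    refine W.call hp (W.ite_false ?_ (W.ite_false ?_ (W.ite_false ?_ (W.ite_false ?_ (W.ite_true ?_
      ((modal_spec (ih env) (c := (codePrg α).getD 0 0) (a := α.base) (n := n) ?_ henv).mono ?_))))))
    · simp only [Test.Holds, htok hs.1, Expr.eval]; decide
    · simp only [Test.Holds, htok hs.1, Expr.eval]; decide
    · simp only [Test.Holds, htok hs.1, Expr.eval]; decide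
    · simp only [Test.Holds, htok hs.1, Expr.eval]; decide
    · simp only [Test.Holds, htok hs.1, Expr.eval]
    · have := hs.2
      rw [List.append_assoc] at this
      cases α <;> exact this
    rintro s' t ⟨⟨e, a, b, c, d, f⟩, ht⟩
    refine ⟨⟨?_, ?_, b, c, d, f⟩, ?_⟩
    · cases n <;> cases α <;> simpa [table, rowCode, codeRaw, mv, RDir.code, diaTrans, lowerMove,
        Prg.inv, codePrg, codeLetter, Prg.base] using e
    · rw [a]
      cases α <;> simp only [codeFormula, codePrg, List.length_cons, List.length_append,
        List.length_nil] <;> omega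
    · have := size_le_clog n
      simp only [Test.cost, Expr.cost, v_cost, tok, Formula.length]; omega
  | box n α φ ih =>
    intro s hs henv
    refine W.call hp (W.ite_false ?_ (W.ite_false ?_ (W.ite_false ?_ (W.ite_false ?_ (W.ite_false ?_
      (W.ite_true ?_ ((modal_spec (ih env) (c := (codePrg α).getD 0 0) (a := α.base) (n := n) ?_
        henv).mono ?_)))))))
    · simp only [Test.Holds, htok hs.1, Expr.eval]; decide
    · simp only [Test.Holds, htok hs.1, Expr.eval]; decide
    · simp only [Test.Holds, htok hs.1, Expr.eval]; decide
    · simp only [Test.Holds, htok hs.1, Expr.eval]; decide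
    · simp only [Test.Holds, htok hs.1, Expr.eval]; decide
    · simp only [Test.Holds, htok hs.1, Expr.eval]
    · have := hs.2
      rw [List.append_assoc] at this
      cases α <;> exact this
    rintro s' t ⟨⟨e, a, b, c, d, f⟩, ht⟩
    refine ⟨⟨?_, ?_, b, c, d, f⟩, ?_⟩
    · cases n <;> cases α <;> simpa [table, rowCode, codeRaw, mv, RDir.code, boxTrans, lowerMove,
        Prg.inv, codePrg, codeLetter, Prg.base] using e
    · rw [a]
      cases α <;> simp only [codeFormula, codePrg, List.length_cons, List.length_append,
        List.length_nil] <;> omega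
    · have := size_le_clog n
      simp only [Test.cost, Expr.cost, v_cost, tok, Formula.length]; omega
  | mu y φ ih | nu y φ ih =>
    intro s hs henv
    refine W.call hp (W.ite_false ?_ (W.ite_false ?_ (W.ite_false ?_ (W.ite_false ?_ (W.ite_false ?_
      -- The symbols of `μ` and `ν` are `9` and `10`, so this is the rank `q + 1` or `q + 2`.
      (W.ite_false ?_ (W.seq (setIf_spec (x := s 3 0 + 1 + (s 0 (s 2 0) - 9)) ?_ ?_
        fun s₁ t₁ h1 f1 ht1 => ?_))))))))
    · simp only [Test.Holds, htok hs.1, Expr.eval]; decide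
    · simp only [Test.Holds, htok hs.1, Expr.eval]; decide
    · simp only [Test.Holds, htok hs.1, Expr.eval]; decide
    · simp only [Test.Holds, htok hs.1, Expr.eval]; decide
    · simp only [Test.Holds, htok hs.1, Expr.eval]; decide
    · simp only [Test.Holds, htok hs.1, Expr.eval]; decide
    · simp only [Test.Holds, htok hs.1, Expr.eval, hs.1, q1, v_eval]; simp
    · simp only [Test.Holds, htok hs.1, Expr.eval, hs.1, q2, v_eval]; simp
    refine (binder_spec (s := s₁) (ih _)
      (by rw [f1 0 (by decide), f1 2 (by decide)]; exact hs.2)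
      (by rw [f1 9 (by decide)]; exact henv)).mono ?_
    rintro s' t ⟨⟨e, a, b, c, d, f⟩, ht⟩
    rw [f1 3 (by decide)] at b e
    rw [f1 2 (by decide)] at a
    rw [f1 6 (by decide)] at c d
    refine ⟨⟨?_, ?_, b, c, fun j hj => ?_, (f1.mono (by simp)).trans f (List.Subset.refl _)
      (List.Subset.refl _)⟩, ?_⟩
    · have := e.congr (f1 1 (by decide)).symm (f1 5 (by decide)).symm rfl rfl
      rw [h1, hs.1] at this
      simpa only [table, rowCode, codeRaw, mv, RDir.code, List.flatMap_cons, List.flatMap_append,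
        List.cons_append, List.nil_append, List.append_assoc] using this
    · rw [a]; simp only [codeFormula, List.length_cons]; omega
    · rw [(d j hj).1, (d j hj).2, f1 7 (by decide), f1 8 (by decide)]
      exact ⟨rfl, rfl⟩
    · simp only [Test.cost, Expr.cost, v_cost, tok, q1, q2] at ht1 ⊢
      simp only [Formula.length]; omega

end RAM

end FullGraded

/-! ### The complete program and its running time. -/

namespace FullGraded

variable {m r v : ℕ}

namespace RAM

variable {p : Program}

/-- Writing tests for all listed programs and their inverses, each after the symbols `op` and `l`. -/
def chain (op l : ℕ) : Cmd :=
  .seq (setv 16 (.lit 0)) (.loop (.lt (RAM.v 16) (RAM.v 12))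
    (.seq (emits [.lit op, .lit l, .lit 1, .get 11 (RAM.v 16), .lit op, .lit l, .lit 2,
      .get 11 (RAM.v 16)]) (incr 16)))

/-- The word written by `chain`. -/
def chainWord (op l : ℕ) (L : List (Fin r)) : List ℕ :=
  (L.map fun a => [op, l, 1, a.1, op, l, 2, a.1]).flatten

theorem chain_spec {op l : ℕ} {L : List (Fin r)} {s : Store} (hL : ProgInv s L)
    {Q : Store → ℕ → Prop}
    (hQ : ∀ s' t, Emits s s' (chainWord op l L) → Fr [1, 5, 16] s s' → t ≤ 200 * (L.length + 1) →
      Q s' t) : W p (chain op l) s Q := by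
  obtain ⟨h12, h11, -⟩ := hL
  rw [Seg_iff] at h11
  refine W.seq (W.setv ?_)
  have e0 : (Expr.lit 0).eval s = 0 := rfl
  rw [e0]
  set s₁ := upd s 16 0 0 with hs₁
  have f1 : Fr [16] s s₁ := (Fr.refl _ s).upd _ _ (by simp)
  have h16 : s₁ 16 0 = 0 := upd_same _ _ _ _
  refine W.emitLoop (by decide) (by decide) rfl
    (L.map fun a => [op, l, 1, a.1, op, l, 2, a.1]) ?_ ?_ ?_
  · intro j hj s' hF hp
    have hj' : j < L.length := by simpa using hj
    have h16' : s' 16 0 = j := by rw [hp, h16, zero_add]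
    have h11' : s' 11 j = L[j] := by
      have := h11 j (by simpa using hj')
      rw [hF 11 (by decide), f1 11 (by decide)]
      simpa using this
    constructor
    · simp only [Test.Holds, v_eval, h16', hF 12 (by decide), f1 12 (by decide), h12]
      exact hj'
    · simp only [List.map_cons, List.map_nil, Expr.eval, v_eval, h16', h11', List.getElem_map]
  · intro s' hF hp
    rw [h16, List.length_map] at hp
    simp only [Test.Holds, v_eval, hp, hF 12 (by decide), f1 12 (by decide), h12]
    omega
  · intro s' t e f hp ht
    refine hQ _ _ (e.congr (f1 1 (by decide)).symm (f1 5 (by decide)).symm rfl rfl)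
      ((f1.mono (by simp)).trans f (List.Subset.refl _) (List.Subset.refl _)) ?_
    simp only [List.length_map, Test.cost, ecost, Expr.cost, v_cost] at ht ⊢
    omega

/-- Procedure `0`: the description of the automaton of a sentence. -/
def mainBody : Cmd :=
  -- The formula starts after the three sizes, and the state counter at `2`, because states `0` and
  -- `1` are reserved for checking the encoding.
  .seq (setv 2 (.lit 3)) (.seq (setv 3 (.lit 2)) (.seq (.call 1)
    -- An end marker turns the digits of the largest grade into a code that `incNat` can read; the
    -- successor is the counting bound.
    (.seq (.set 13 (RAM.v 14) (.lit 2)) (.seq (setv 16 (.lit 0)) (.seq (incNat 13 16)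
    -- The number of states serves as the index too. Then come the initial state and the rank of
    -- state `0`.
    (.seq (emits [RAM.v 3, RAM.v 3, .lit 0, .lit 1]) (.seq (chain 5 3)
    -- The first eight symbols finish the transition of state `0`; the others are the rank of state
    -- `1` and the start of its transition.
    (.seq (emits [.lit 5, .lit 4, .lit 1, .lit 2, .lit 4, .lit 3, .lit 2, .lit 1, .lit 2, .lit 5,
      .lit 4, .lit 3, .lit 2, .lit 1]) (.seq (chain 6 2)
    (.seq (.ite (.eq (RAM.v 12) (.get 0 (.lit 1))) (emits [.lit 1]) (emits [.lit 0]))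
    (.seq (setv 2 (.lit 3)) (.seq (setv 3 (.lit 2)) (.call 2)))))))))))))

/-- The program that translates sentences to automata. -/
def translator : Program := [mainBody, scanBody, emitBody]

theorem codeRaw_rootTrans (L : List (Fin r)) :
    codeRaw (rootTrans L : PosBool (RAtom (Fin m) (Fin r))) =
      chainWord 5 3 L ++ [5, 4, 1, 2, 4, 3, 2, 1] := by
  induction L with
  | nil => simp [rootTrans, codeRaw, mv, RDir.code, chainWord, codeNat_zero]
  | cons a L ih =>
    simp only [rootTrans, List.foldr_cons, codeRaw, codeLetter] at ih ⊢
    rw [ih]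
    rfl

theorem codeRaw_nodeTrans (L : List (Fin r)) (all : Bool) :
    codeRaw (nodeTrans L all : PosBool (RAtom (Fin m) (Fin r))) =
      [5, 4, 3, 2, 1] ++ (chainWord 6 2 L ++ [bif all then 1 else 0]) := by
  have : ∀ θ : PosBool (RAtom (Fin m) (Fin r)), codeRaw (L.foldr (fun a θ =>
      .or (.atom (.pos (.edge (.fwd a)))) (.or (.atom (.pos (.edge (.bwd a)))) θ)) θ) =
      chainWord 6 2 L ++ codeRaw θ := by
    intro θ
    induction L with
    | nil => rfl
    | cons a L ih =>
      simp only [List.foldr_cons, codeRaw, codeLetter]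
      rw [ih]
      rfl
  simp only [nodeTrans, codeRaw, mv, RDir.code, codeNat_zero, this]
  cases all <;> rfl

/-- The output for a sentence. -/
def outputWord (φ : Formula (Fin m) (Fin r) (Fin v)) (all : Bool) : List ℕ :=
  codeNat (φ.maxGrade + 1) ++ ([φ.st + 2, φ.st + 2, 0] ++
    (topTable (collect [] φ) all φ).flatMap rowCode)

theorem size_maxGrade_le (φ : Formula (Fin m) (Fin r) (Fin v)) : φ.maxGrade.size ≤ φ.length := by
  induction φ with
  | or φ ψ ih1 ih2 | and φ ψ ih1 ih2 =>
    simp only [Formula.maxGrade, Formula.length]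
    rcases max_choice φ.maxGrade ψ.maxGrade with h | h <;> rw [h] <;> omega
  | dia n α φ ih | box n α φ ih =>
    have := size_le_clog n
    simp only [Formula.maxGrade, Formula.length]
    rcases max_choice n φ.maxGrade with h | h <;> rw [h] <;> omega
  | mu y φ ih | nu y φ ih => simp only [Formula.maxGrade, Formula.length]; omega
  | _ => simp [Formula.maxGrade]

/-- The passes cost at most `1000` and `3000` steps per unit of length. The two lists of tests and
the counting bound are linear by `collect_length_le` and `size_maxGrade_le`, and the constants are
absorbed because the length is at least `1`. -/
theorem translator_spec (φ : Formula (Fin m) (Fin r) (Fin v)) :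
    W translator (.call 0) (initStore (inputCode φ)) fun s' t =>
      Emits (initStore (inputCode φ)) s' (outputWord φ (decide ((collect [] φ).length = r))) ∧
        t ≤ 6000 * φ.length := by
  set s := initStore (inputCode φ) with hs
  have hlen : 1 ≤ φ.length := by cases φ <;> simp only [Formula.length] <;> omega
  have h0 : ∀ a i, a ≠ 0 → s a i = 0 := fun a i ha => if_neg ha
  have hin : Seg (s 0) 3 (codeFormula φ) := by
    rw [Seg_iff]
    intro i hi
    have : s 0 (3 + i) = (inputCode φ).getD (3 + i) 0 := rfl
    rw [this, inputCode, add_comm 3 i]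
    simp [hi]
  have h01 : s 0 1 = r := rfl
  refine W.call (c := mainBody) rfl (W.seq (W.setv (W.seq (W.setv (W.seq ?_)))))
  set s₁ := upd (upd s 2 0 ((Expr.lit 3).eval s)) 3 0
    ((Expr.lit 2).eval (upd s 2 0 ((Expr.lit 3).eval s))) with hs₁
  have f1 : Fr [2, 3] s s₁ := ((Fr.refl _ s).upd _ _ (by simp)).upd _ _ (by simp)
  have a1 : s₁ 2 0 = 3 := rfl
  have b1 : s₁ 3 0 = 2 := rfl
  refine (scan_spec rfl φ [] 0 s₁ (by rw [f1 0 (by decide), a1]; exact hin) ?_ ?_).mono ?_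
  · refine ⟨?_, trivial, fun a => ?_⟩
    · rw [f1 12 (by decide), h0 _ _ (by decide)]; rfl
    · rw [f1 10 (by decide), h0 _ _ (by decide)]; simp
  · refine ⟨fun j => ?_, ?_⟩
    · rw [f1 13 (by decide), h0 _ _ (by decide)]; simp
    · rw [f1 14 (by decide), h0 _ _ (by decide)]; simp
  rintro s₂ t₂ ⟨-, b2, l2, m2, f2, ht2⟩
  rw [Nat.zero_max] at m2
  refine W.seq (W.set (W.seq (W.setv (W.seq ?_))))
  set s₃ := upd (upd s₂ 13 ((RAM.v 14).eval s₂) ((Expr.lit 2).eval s₂)) 16 0 ((Expr.lit 0).eval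
    (upd s₂ 13 ((RAM.v 14).eval s₂) ((Expr.lit 2).eval s₂))) with hs₃
  have f23 : Fr [13, 16] s₂ s₃ := ((Fr.refl _ s₂).upd _ _ (by simp)).upd _ _ (by simp)
  have f3 : Fr [2, 3, 10, 11, 12, 13, 14, 15, 16, 17, 24] s s₃ :=
    f1.trans (f2.trans f23 (C := [2, 3, 10, 11, 12, 13, 14, 15, 16, 17, 24]) (by simp) (by simp))
      (by simp) (by simp)
  have h313 : s₃ 13 = Function.update (s₂ 13) φ.maxGrade.size 2 := by
    rw [hs₃, upd_of_ne _ _ _ (by decide), upd_array, v_eval, m2.2]; rfl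
  have b3 : s₃ 3 0 = φ.st + 2 := by rw [f23 3 (by decide), b2, b1, add_comm]
  refine incNat_spec (n := φ.maxGrade) (by decide) (by decide) (by decide) (by decide) (by decide)
    ?_ fun s₄ t₄ e4 f4 ht4 => W.seq (W.emits rfl fun s₅ e5 f5 => W.seq ?_)
  · have : s₃ 16 0 = 0 := upd_same _ _ _ _
    rw [this, Seg_codeNat, h313]
    refine ⟨fun j hj => ?_, ?_⟩
    · rw [Function.update_of_ne (by omega), m2.1, zero_add]
    · rw [zero_add, Function.update_self]
  have f35 : Fr [1, 5, 16] s₃ s₅ := f4.trans f5 (by simp) (by simp)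
  have l5 : ProgInv s₅ (collect [] φ) := l2.congr (f23.trans f35 (C := [1, 5, 13, 16]) (by simp)
    (by simp)) (by decide)
  refine chain_spec l5 fun s₆ t₆ e6 f6 ht6 => W.seq (W.emits rfl fun s₇ e7 f7 => W.seq ?_)
  have f57 : Fr [1, 5, 16] s₅ s₇ := f6.trans f7 (by simp) (by simp)
  have l7 := l5.congr f57 (by decide)
  refine chain_spec l7 fun s₈ t₈ e8 f8 ht8 => W.seq ?_
  have l8 := l7.congr f8 (by decide)
  have f38 : Fr [1, 5, 16] s₃ s₈ := f35.trans (f57.trans f8 (C := [1, 5, 16]) (by simp) (by simp))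
    (by simp) (by simp)
  have f8' : Fr [1, 2, 3, 5, 10, 11, 12, 13, 14, 15, 16, 17, 24] s s₈ :=
    f3.trans f38 (by simp) (by simp)
  have hend : W translator (.ite (.eq (RAM.v 12) (.get 0 (.lit 1))) (emits [.lit 1])
      (emits [.lit 0])) s₈ fun s₉ t₉ => Emits s₈ s₉
        [bif decide ((collect [] φ).length = r) then 1 else 0] ∧ Fr [1, 5] s₈ s₉ ∧ t₉ ≤ 30 := by
    have hT : (Test.eq (RAM.v 12) (.get 0 (.lit 1))).Holds s₈ ↔ (collect [] φ).length = r := by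
      simp only [Test.Holds, v_eval, Expr.eval, l8.1, f8' 0 (by decide), h01]
    by_cases h : (collect [] φ).length = r
    · refine W.ite_true (hT.2 h) (W.emits rfl fun s' e f => ⟨?_, f, ?_⟩)
      · simpa [h, Expr.eval] using e
      · simp [Test.cost, ecost, Expr.cost]
    · refine W.ite_false (fun h' => h (hT.1 h')) (W.emits rfl fun s' e f => ⟨?_, f, ?_⟩)
      · simpa [h, Expr.eval] using e
      · simp [Test.cost, ecost, Expr.cost]
  refine hend.mono ?_
  rintro s₉ t₉ ⟨e9, f9, ht9⟩
  refine W.seq (W.setv (W.seq (W.setv ?_)))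
  set s' := upd (upd s₉ 2 0 ((Expr.lit 3).eval s₉)) 3 0
    ((Expr.lit 2).eval (upd s₉ 2 0 ((Expr.lit 3).eval s₉))) with hs'
  have f' : Fr [2, 3] s₉ s' := ((Fr.refl _ s₉).upd _ _ (by simp)).upd _ _ (by simp)
  have a' : s' 2 0 = 3 := rfl
  have b' : s' 3 0 = 2 := rfl
  have fs : Fr [1, 2, 3, 5, 10, 11, 12, 13, 14, 15, 16, 17, 24] s s' :=
    f8'.trans (f9.trans f' (C := [1, 2, 3, 5, 10, 11, 12, 13, 14, 15, 16, 17, 24]) (by simp) (by simp))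
      (by simp) (List.Subset.refl _)
  refine (emit_spec rfl φ (fun _ => 0) s' (by rw [fs 0 (by decide), a']; exact hin)
    -- Array `9` is still zero, which agrees with the default environment of `topTable`; a sentence
    -- never uses that default.
    (fun x => by rw [fs 9 (by decide), h0 _ _ (by decide)])).mono ?_
  rintro s'' t'' ⟨⟨e'', -⟩, ht''⟩
  constructor
  · have e4' := e4.congr (t := s) (f3 1 (by decide)).symm (f3 5 (by decide)).symm rfl rfl
    have e9' := e9.congr (t' := s') rfl rfl (f' 1 (by decide)) (f' 5 (by decide))
    simp only [List.map_cons, List.map_nil, v_eval, Expr.eval, f4 3 (by decide), b3] at e5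
    simp only [List.map_cons, List.map_nil, Expr.eval] at e7
    rw [b'] at e''
    have := e4'.trans (e5.trans (e6.trans (e7.trans (e8.trans (e9'.trans e'')))))
    simpa only [outputWord, topTable, List.flatMap_cons, rowCode, codeRaw_rootTrans,
      codeRaw_nodeTrans, List.cons_append, List.nil_append, List.append_assoc] using this
  · have h1 := size_maxGrade_le φ
    have h2 := collect_length_le φ []
    rw [List.length_nil, zero_add] at h2
    simp only [ecost, Expr.cost, v_cost]
    omega

end RAM

theorem sentenceAut_code {L : List (Fin r)} (all : Bool) {φ : Formula (Fin m) (Fin r) (Fin v)} {b : ℕ}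
    (hL : ∀ a ∈ L, a ∈ φ.progs) (hb : φ.CountsUpTo b) :
    (sentenceAut all hL hb).code =
      codeNat b ++ ([φ.st + 2, φ.st + 2, 0] ++ (topTable L all φ).flatMap rowCode) := by
  have hlen := topTable_length L all φ
  have hrows : (List.ofFn fun q => (sentenceAut all hL hb).rank q ::
      codeTrans ((sentenceAut all hL hb).trans q)) = (topTable L all φ).map rowCode := by
    refine List.ext_getElem ?_ fun i h1 h2 => ?_
    · simp [sentenceAut, tableAut]
    · have hv := (topTable_valid (all := all) hL (Nat.le_of_succ_le hb.le) _
        (List.getElem_mem (n := i) (by simpa using h2))).2.2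
      simp [sentenceAut, tableAut, rowCode, codeTrans_toSym hv]
  rw [SymAut.code, hrows, List.flatMap_def, List.append_assoc]
  simp [sentenceAut, tableAut, hlen]

/-- The collected list has no repetitions, so one comparison of its length with `r` tells the
machine whether every program occurs. -/
theorem collect_length_eq_iff (φ : Formula (Fin m) (Fin r) (Fin v)) :
    (collect [] φ).length = r ↔ ∀ a, a ∈ φ.progs := by
  have hn := nodup_collect φ [] List.nodup_nil
  have hm : ∀ a, a ∈ collect [] φ ↔ a ∈ φ.progs := fun a => by simp [mem_collect]
  have hc : (collect [] φ).toFinset.card = (collect [] φ).length := List.toFinset_card_of_nodup hn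
  have hu : (collect [] φ).toFinset.card = Fintype.card (Fin r) ↔ _ :=
    Finset.card_eq_iff_eq_univ _
  rw [hc, Fintype.card_fin] at hu
  rw [hu, Finset.eq_univ_iff_forall]
  simp [hm]

end FullGraded

/-! ### Assembly of the theorem. -/

theorem mainTheorem6 :
    ∃ (C : ℕ) (prog : FullGraded.RAM.Program),
      ∀ (m r v : ℕ) (φ : FullGraded.Formula (Fin m) (Fin r) (Fin v)) (b : ℕ),
        φ.IsSentence → φ.CountsUpTo b →
        ∃ D : FullGraded.SymAut (FullGraded.Gam φ),
          -- the automaton is constructed in linear time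
          FullGraded.RAM.ComputesIn prog (FullGraded.inputCode φ) D.code (C * φ.length) ∧
          -- it accepts exactly the encodings of tree models
          (∀ (T : FullGraded.NTree) (V : T.nodes → Set (FullGraded.Gam φ)),
            D.toTwoGAPT.Accepts T V ↔
              ∃ K : FullGraded.Kripke (Fin m) (Fin r) T.nodes,
                FullGraded.IsTreeModel K φ ∧ FullGraded.encoding φ K = V) ∧
          -- number of states, index and counting bound
          D.toTwoGAPT.numStates ≤ C * φ.length ∧
          D.toTwoGAPT.index ≤ C * φ.length ∧
          D.toTwoGAPT.bound = b := by
  refine ⟨6000, FullGraded.RAM.translator, fun m r v φ b hφ hb => ?_⟩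
  have hL : ∀ a, a ∈ FullGraded.collect [] φ ↔ a ∈ φ.progs := fun a => by
    simp [FullGraded.mem_collect]
  have hlen : 1 ≤ φ.length := by cases φ <;> simp only [FullGraded.Formula.length] <;> omega
  -- There are two states per syntax node and two for the check of the encoding; this bounds the
  -- index as well.
  have hst : φ.st + 2 ≤ 6000 * φ.length := by
    have := φ.st_le
    omega
  have htop := FullGraded.topTable_length (FullGraded.collect [] φ)
    (decide ((FullGraded.collect [] φ).length = r)) φ
  refine ⟨FullGraded.sentenceAut (decide ((FullGraded.collect [] φ).length = r))
    (fun a => (hL a).1) hb, ?_, ?_, ?_, ?_, rfl⟩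
  · obtain ⟨s', t, h1, ⟨-, -, h2⟩, h3⟩ := FullGraded.RAM.translator_spec φ
    refine ⟨s', t, h3, h1, fun i hi => ?_⟩
    rw [FullGraded.Seg_iff] at h2
    have h5 : FullGraded.RAM.initStore (FullGraded.inputCode φ) 5 0 = 0 := rfl
    have hcode := FullGraded.sentenceAut_code (decide ((FullGraded.collect [] φ).length = r))
      (fun a => (hL a).1) hb
    simp only [hcode] at hi ⊢
    obtain rfl : φ.maxGrade + 1 = b := hb
    have := h2 i hi
    rwa [h5, zero_add] at this
  · exact FullGraded.sentenceAut_accepts_iff hφ _ (fun a => (hL a).2)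
      (by rw [decide_eq_true_iff]; exact FullGraded.collect_length_eq_iff φ) hb
  · refine le_trans (le_of_eq ?_) hst
    exact (Fintype.card_fin _).trans htop
  · exact le_trans (le_of_eq htop) hst
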